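/- **Setting.** Write $\|\cdot\|$ for the Euclidean norm. An observation $Z\in\mathcal Z$ contains features $X\in[0,1]^d$ ($d\ge1$) and controls $W\in\mathbb R^k$. Let $\psi(z;\theta,\xi)\in\mathbb R^p$ be a measurable score ($\theta\in\mathbb R^p$, $\xi\in\mathbb R^l$), $\Theta\subseteq\mathbb R^p$ the parameter set and $H$ a class of measurable nuisance functions $h:\mathbb R^d\times\mathbb R^k\to\mathbb R^l$ containing the true one, $h_0$. Let $\mathcal U\supseteq\Theta$ and $\mathcal V\supseteq\{h(x',w): h\in H,\ x'\in[0,1]^d,\ w\in\mathbb R^k\}$ be open convex sets (for instance $\mathbb R^p$ and $\mathbb R^l$). Fix versions of the conditional laws of $W$ given $X=x'$ and of $Z$ given $(X,W)=(x',w)$. Put $m(x';\theta,h)=\mathbb E[\psi(Z;\theta,h(X,W))\mid X=x']$ (assumed to exist for $x'\in[0,1]^d$, $\theta\in\Theta$, $h\in H$) and $\mathcal E(h)=(\mathbb E[\|h(x,W)-h_0(x,W)\|^2\mid X=x])^{1/2}$, where $x\in[0,1]^d$ is the target. **Assumptions**, with constants $L,R,\psi_{\max}$ and $\sigma_0>0$: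 1. $\mathbb E[\nabla_\xi\psi(Z;\theta_0,h_0(x,W))(h(x,W)-h_0(x,W))\mid X=x]=0$ for all $h\in H$. 2. $\theta_0\in\Theta$ is the unique zero in $\Theta$ of $m(x;\cdot,h_0)$. 3. $m(\cdot;\theta,h)$ is $L$-Lipschitz on $[0,1]^d$ for all $\theta\in\Theta$, $h\in H$. 4. All eigenvalues of the Jacobian $M=\nabla_\theta m(x;\theta_0,h_0)$ are at least $\sigma_0$. 5. $\psi(z;\cdot,\cdot)$ is $C^2$ on $\mathcal U\times\mathcal V$. For almost every $w$ under the law of $W$ given $X=x$, for each $j$, the Hessian of $\psi_j(Z;\cdot,\cdot)$ is locally dominated on $\mathcal U\times\mathcal V$ by functions integrable given $X=x,W=w$, and the eigenvalues of $\mathbb E[\nabla^2_{(\theta,\xi)}\psi_j(Z;\theta,\xi)\mid X=x,W=w]$ are at most $L$ in absolute value for all $(\theta,\xi)\in\mathcal U\times\mathcal V$. On $\mathcal U\times\mathcal V$, $\psi(z;\cdot,\cdot)$ is $L$-Lipschitz in $\theta$ and in $\xi$, and $\nabla_\theta\psi$ is $L$-Lipschitz in $\xi$. 6. $\Theta$ has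 diameter at most $R$. 7. $X$ has a continuous density $f$ on $[0,1]^d$ that is bounded away from zero and infinity. **Estimator.** Let $Z_1,\dots,Z_{2n}$ be i.i.d. The first-stage estimate $\hat h$ is computed from $Z_{n+1},\dots,Z_{2n}$ and possibly independent internal randomness, jointly measurably in these and its arguments; almost surely $\hat h\in H$ and $|\psi_j(z;\theta,\hat h(X,W))|\le\psi_{\max}$ for every observation $z$ (with components $X,W$), $\theta\in\Theta$ and $j$. Let $1\le s<n$ and let $B\ge n/s$ be an integer. For $b=1,\dots,B$, draw independently a uniformly random subsample $S_b\subset\{1,\dots,n\}$ of size $s$ without replacement, randomly partitioned into $S_b^1,S_b^2$ with $|S_b^2|\ge\gamma s$, and the internal randomness of a tree learner, all independent of the data. The learner grows a tree with axis-aligned splits. It is measurable, and *honest*: the tree depends on the observations in $S_b^2$ only through their features. For parameters $0<\rho\le0.2$, $0<\pi\le1$, $r\ge1$, almost surely each split leaves at least a fraction $\rho$ of the $S_b^2$-observations of the split cell on each side, and each leaf contains between $r$ and $2r-1$ observations of $S_b^2$. Conditionally on the data, on the splits at the ancestors of a node and on the node being split, the split is along feature $j$ with probability at least $\pi/d$,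 for every $j$. Let $L_b(x)$ be the leaf containing $x$, and let $$a_i=\frac1B\sum_{b=1}^B\frac{\mathbf 1[i\in S_b^2,\ X_i\in L_b(x)]}{|\{i'\in S_b^2:X_{i'}\in L_b(x)\}|}.$$ The estimate $\hat\theta\in\Theta$ almost surely solves $\sum_{i=1}^n a_i\,\psi(Z_i;\hat\theta,\hat h(X_i,W_i))=0$. Put $\alpha=\log(\rho^{-1})/(\pi\log((1-\rho)^{-1}))$. **Theorem (High Probability Error Bound).** There are constants $C_1,C_2>0$, depending only on $d,p,l,f,L,R,\psi_{\max},\sigma_0,\rho,\pi,\gamma,r$, such that the following holds for every such setting, every $n,s,B$, every $\delta\in(0,1)$ and every $\chi_{n,\delta}\ge0$. Suppose in addition that $\psi(z;\theta,\xi)=\nabla_\theta\ell(z;\theta,\xi)$ on $\mathcal U\times\mathcal V$ for a loss $\ell$ that is convex in $\theta\in\mathcal U$, that $\sigma$ is the minimum eigenvalue of $M$, and that $\mathcal E(\hat h)\le\chi_{n,\delta}$ with probability at least $1-\delta$. If $\sigma-C_2\chi_{n,\delta}>0$, then with probability at least $1-2\delta$, $$\|\hat\theta-\theta_0\|\le\frac{C_1\Big(s^{-1/(2\alpha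 d)}+\sqrt{\tfrac{s\log(n/(s\delta))}{n}}+\chi_{n,\delta}^2\Big)}{\sigma-C_2\,\chi_{n,\delta}}.$$ -/

import Mathlib

open MeasureTheory ProbabilityTheory

namespace ORF

/-- `ℝ^d` with the Euclidean norm. -/
abbrev Vec (d : ℕ) : Type := EuclideanSpace ℝ (Fin d)

/-- The feature space `[0,1]^d`. -/
def cube (d : ℕ) : Set (Vec d) := {x | ∀ j, 0 ≤ x j ∧ x j ≤ 1}

/-! ### Trees with axis-aligned splits -/

/-- A finite binary tree with axis-aligned splits. `node j c t₁ t₂` splits its cell along the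
feature `j` at the threshold `c`: points with `y j ≤ c` go to `t₁`, the others to `t₂`. -/
inductive SplitTree (d : ℕ) : Type
  | leaf : SplitTree d
  | node (j : Fin d) (c : ℝ) (t₁ t₂ : SplitTree d) : SplitTree d

namespace SplitTree

variable {d : ℕ}

/-- The leaf (as a subset of the feature space) that contains the point `x`. -/
noncomputable def leafOf : SplitTree d → Vec d → Set (Vec d)
  | leaf, _ => Set.univ
  | node j c t₁ t₂, x =>
      open Classical in
      if x j ≤ c then {y | y j ≤ c} ∩ leafOf t₁ x else {y | c < y j} ∩ leafOf t₂ x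

/-- The splitting feature at the node with address `v` (`false` = first child, `true` = second
child); `none` if there is no node with this address or if it is a leaf. -/
def splitDir : SplitTree d → List Bool → Option (Fin d)
  | leaf, _ => none
  | node j _ _ _, [] => some j
  | node _ _ t₁ t₂, b :: v => if b then splitDir t₂ v else splitDir t₁ v

/-- The splitting threshold at the node with address `v` (`0` if there is no split there). -/
def splitThr : SplitTree d → List Bool → ℝ
  | leaf, _ => 0
  | node _ c _ _, [] => c
  | node _ _ t₁ t₂, b :: v => if b then splitThr t₂ v else splitThr t₁ v

/-- The σ-algebra generated by the split (feature and threshold) made at the address `v`. -/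
@[reducible] def nodeSigma (v : List Bool) : MeasurableSpace (SplitTree d) :=
  MeasurableSpace.comap (fun t => t.splitDir v) ⊤ ⊔
    MeasurableSpace.comap (fun t => t.splitThr v) (borel ℝ)

/-- The σ-algebra on trees generated by all splits. -/
instance : MeasurableSpace (SplitTree d) := ⨆ v, nodeSigma v

/-- The σ-algebra generated by the splits made at the proper ancestors of the address `v`. -/
@[reducible] def historySigma (v : List Bool) : MeasurableSpace (SplitTree d) :=
  ⨆ w ∈ {w : List Bool | w <+: v ∧ w ≠ v}, nodeSigma w

variable {ι : Type*}

/-- Each split leaves at least a fraction `ρ` of the points `X i`, `i ∈ S`, that are in the split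
cell on each of its two sides. -/
noncomputable def Balanced (ρ : ℝ) (X : ι → Vec d) : SplitTree d → Finset ι → Prop
  | leaf, _ => True
  | node j c t₁ t₂, S =>
      open Classical in
      ρ * (S.card : ℝ) ≤ ((S.filter fun i => X i j ≤ c).card : ℝ) ∧
      ρ * (S.card : ℝ) ≤ ((S.filter fun i => c < X i j).card : ℝ) ∧
      Balanced ρ X t₁ (S.filter fun i => X i j ≤ c) ∧
      Balanced ρ X t₂ (S.filter fun i => c < X i j)

/-- Each leaf contains between `r` and `2 r - 1` of the points `X i`, `i ∈ S`. -/
noncomputable def LeafSize (r : ℕ) (X : ι → Vec d) : SplitTree d → Finset ι → Prop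
  | leaf, S => r ≤ S.card ∧ S.card < 2 * r
  | node j c t₁ t₂, S =>
      open Classical in
      LeafSize r X t₁ (S.filter fun i => X i j ≤ c) ∧
      LeafSize r X t₂ (S.filter fun i => c < X i j)

/-- The tree weight `1[X i ∈ L(x), i ∈ S²] / |L(x) ∩ S²|` of the observation `i`. -/
noncomputable def weight {n : ℕ} (t : SplitTree d) (x : Vec d) (X : Fin n → Vec d)
    (S2 : Finset (Fin n)) (i : Fin n) : ℝ :=
  open Classical in
  if i ∈ S2 ∧ X i ∈ t.leafOf x then
    1 / ((S2.filter fun i' => X i' ∈ t.leafOf x).card : ℝ) else 0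

end SplitTree

/-! ### The conditional moment model -/

/-- A conditional moment model with nuisance. An observation `z : 𝒵` contains a feature vector
`feat z` and a vector of controls `conf z`. The joint law of `(X, W, Z)` is given by the law of
`X`, the conditional law of `W` given `X = x`, and the conditional law of `Z` given
`(X, W) = (x, w)`. -/
structure MomentModel (d p l k : ℕ) (𝒵 : Type*) [MeasurableSpace 𝒵] where
  feat : 𝒵 → Vec d
  conf : 𝒵 → Vec k
  measurable_feat : Measurable feat
  measurable_conf : Measurable conf
  feat_mem : ∀ z, feat z ∈ cube d
  featLaw : Measure (Vec d)
  confKernel : Kernel (Vec d) (Vec k)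
  obsKernel : Kernel (Vec d × Vec k) 𝒵
  isProb_featLaw : IsProbabilityMeasure featLaw
  isMarkov_confKernel : IsMarkovKernel confKernel
  isMarkov_obsKernel : IsMarkovKernel obsKernel
  /-- Under the conditional law of `Z` given `(X, W) = (x, w)` one has `X = x` and `W = w`. -/
  consistent : ∀ x ∈ cube d, ∀ᵐ w ∂(confKernel x), ∀ᵐ z ∂(obsKernel (x, w)),
    feat z = x ∧ conf z = w
  /-- The score `ψ(z; θ, ξ)`. -/
  score : 𝒵 → Vec p → Vec l → Vec p
  measurable_score : Measurable fun q : 𝒵 × Vec p × Vec l => score q.1 q.2.1 q.2.2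
  /-- The parameter set. -/
  Θ : Set (Vec p)
  /-- The domain on which the score is regular in `θ` (an open convex set containing `Θ`, for
  instance the whole space). -/
  domθ : Set (Vec p)
  /-- The domain on which the score is regular in the nuisance value (an open convex set
  containing the values of all nuisance functions, for instance the whole space). -/
  domξ : Set (Vec l)
  isOpen_domθ : IsOpen domθ
  convex_domθ : Convex ℝ domθ
  isOpen_domξ : IsOpen domξ
  convex_domξ : Convex ℝ domξ
  Θ_subset : Θ ⊆ domθ
  /-- The class of nuisance functions. -/
  H : Set (Vec d → Vec k → Vec l)
  measurable_of_mem : ∀ h ∈ H, Measurable fun q : Vec d × Vec k => h q.1 q.2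
  maps_of_mem : ∀ h ∈ H, ∀ x ∈ cube d, ∀ w, h x w ∈ domξ
  /-- The true nuisance function. -/
  h₀ : Vec d → Vec k → Vec l
  h₀_mem : h₀ ∈ H

attribute [instance] MomentModel.isProb_featLaw MomentModel.isMarkov_confKernel
  MomentModel.isMarkov_obsKernel

namespace MomentModel

variable {d p l k : ℕ} {𝒵 : Type*} [MeasurableSpace 𝒵] (M : MomentModel d p l k 𝒵)

/-- The conditional law of `Z` given `X = x`. -/
noncomputable def condLaw : Kernel (Vec d) 𝒵 := (M.confKernel ⊗ₖ M.obsKernel).snd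

/-- The law of an observation `Z`. -/
noncomputable def law : Measure 𝒵 := M.featLaw.bind M.condLaw

/-- The integrand `ψ(z; θ, h(X, W))`. -/
def plugIn (θ : Vec p) (h : Vec d → Vec k → Vec l) (z : 𝒵) : Vec p :=
  M.score z θ (h (M.feat z) (M.conf z))

/-- The moment `m(x; θ, h) = E[ψ(Z; θ, h(X, W)) | X = x]`. -/
noncomputable def moment (x : Vec d) (θ : Vec p) (h : Vec d → Vec k → Vec l) : Vec p :=
  ∫ z, M.plugIn θ h z ∂(M.condLaw x)

/-- The Jacobian `∇_θ m(x; θ, h₀)`. -/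
noncomputable def jacobian (x : Vec d) (θ : Vec p) : Vec p →L[ℝ] Vec p :=
  fderiv ℝ (fun θ' => M.moment x θ' M.h₀) θ

/-- The second derivative of `ψ_j(z; ·, ·)` at `(θ, ξ)`. -/
noncomputable def score_fderiv2 (j : Fin p) (z : 𝒵) (q : Vec p × Vec l) :
    (Vec p × Vec l) →L[ℝ] (Vec p × Vec l) →L[ℝ] ℝ :=
  fderiv ℝ (fderiv ℝ fun q' : Vec p × Vec l => M.score z q'.1 q'.2 j) q

/-- The standard basis vectors of `ℝ^p × ℝ^l`. -/
noncomputable def stdVec {p l : ℕ} : Fin p ⊕ Fin l → Vec p × Vec l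
  | Sum.inl i => (EuclideanSpace.single i 1, 0)
  | Sum.inr i => (0, EuclideanSpace.single i 1)

/-- The expected Hessian `E[∇²_{(θ,ξ)} ψ_j(Z; θ, ξ) | X = x, W = w]`. -/
noncomputable def expHessian (j : Fin p) (x : Vec d) (w : Vec k) (q : Vec p × Vec l) :
    Matrix (Fin p ⊕ Fin l) (Fin p ⊕ Fin l) ℝ :=
  Matrix.of fun a b => ∫ z, M.score_fderiv2 j z q (stdVec a) (stdVec b) ∂(M.obsKernel (x, w))

/-- The root mean squared error `(E[‖h(x, W) - h₀(x, W)‖² | X = x])^{1/2}`, with values in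
`[0, ∞]`. -/
noncomputable def rmse (x : Vec d) (h : Vec d → Vec k → Vec l) : ENNReal :=
  eLpNorm (fun w => h x w - M.h₀ x w) 2 (M.confKernel x)

/-- The standing assumptions on the moments, the score and the distribution of `X`, at the target
feature `x` with true parameter `θ₀`. All constants called `O(1)` are controlled by `L`
(Lipschitz constants and bound on the expected Hessians), `R` (diameter of `Θ`) and `σ₀` (lower
bound on the eigenvalues of the Jacobian). -/
structure Regular (f : Vec d → ℝ) (L R σ₀ : ℝ) (x : Vec d) (θ₀ : Vec p) : Prop where
  /-- `X` has density `f` on the cube. -/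
  density : M.featLaw =
    (volume.restrict (cube d)).withDensity fun y => ENNReal.ofReal (f y)
  /-- The moments exist. -/
  integrable : ∀ y ∈ cube d, ∀ θ ∈ M.Θ, ∀ h ∈ M.H, Integrable (M.plugIn θ h) (M.condLaw y)
  /-- Local orthogonality. -/
  orthogonal : ∀ h ∈ M.H,
    ∫ z, fderiv ℝ (fun ξ => M.score z θ₀ ξ) (M.h₀ x (M.conf z))
      (h x (M.conf z) - M.h₀ x (M.conf z)) ∂(M.condLaw x) = 0
  /-- Identifiability: `θ₀` is the unique zero in `Θ` of the moment. -/
  θ₀_mem : θ₀ ∈ M.Θ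
  moment_eq_zero_iff : ∀ θ ∈ M.Θ, M.moment x θ M.h₀ = 0 ↔ θ = θ₀
  /-- Smooth signal. -/
  smooth_signal : ∀ θ ∈ M.Θ, ∀ h ∈ M.H, ∀ y ∈ cube d, ∀ y' ∈ cube d,
    ‖M.moment y θ h - M.moment y' θ h‖ ≤ L * ‖y - y'‖
  /-- Curvature: the eigenvalues of the Jacobian are bounded away from zero. -/
  curvature : ∀ c : ℝ,
    Module.End.HasEigenvalue (M.jacobian x θ₀ : Vec p →ₗ[ℝ] Vec p) c → σ₀ ≤ c
  /-- The score is twice continuously differentiable in `(θ, ξ)`. -/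
  contDiffOn : ∀ z, ContDiffOn ℝ 2 (fun q : Vec p × Vec l => M.score z q.1 q.2)
    (M.domθ ×ˢ M.domξ)
  /-- The second derivatives of the score are locally dominated by an integrable function, so that
  the expected Hessian is the Hessian of the conditionally expected score. -/
  dominated : ∀ᵐ w ∂(M.confKernel x), ∀ j, ∀ q ∈ M.domθ ×ˢ M.domξ,
    ∃ V ∈ nhds q, ∃ g : 𝒵 → ℝ, Integrable g (M.obsKernel (x, w)) ∧
      ∀ᵐ z ∂(M.obsKernel (x, w)), ∀ q' ∈ V, ‖M.score_fderiv2 j z q'‖ ≤ g z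
  /-- The eigenvalues of the expected Hessian are bounded. -/
  hessian_bound : ∀ᵐ w ∂(M.confKernel x), ∀ j, ∀ q ∈ M.domθ ×ˢ M.domξ, ∀ c : ℝ,
    Module.End.HasEigenvalue (Matrix.toLin' (M.expHessian j x w q)) c → |c| ≤ L
  /-- The score is Lipschitz in `θ`. -/
  lipschitz_θ : ∀ z, ∀ ξ ∈ M.domξ, ∀ θ ∈ M.domθ, ∀ θ' ∈ M.domθ,
    ‖M.score z θ ξ - M.score z θ' ξ‖ ≤ L * ‖θ - θ'‖
  /-- The score is Lipschitz in the nuisance value. -/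
  lipschitz_ξ : ∀ z, ∀ θ ∈ M.domθ, ∀ ξ ∈ M.domξ, ∀ ξ' ∈ M.domξ,
    ‖M.score z θ ξ - M.score z θ ξ'‖ ≤ L * ‖ξ - ξ'‖
  /-- The `θ`-gradient of the score is Lipschitz in the nuisance value. -/
  lipschitz_grad : ∀ z, ∀ θ ∈ M.domθ, ∀ ξ ∈ M.domξ, ∀ ξ' ∈ M.domξ,
    ‖fderiv ℝ (fun θ' => M.score z θ' ξ) θ - fderiv ℝ (fun θ' => M.score z θ' ξ') θ‖
      ≤ L * ‖ξ - ξ'‖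
  /-- The parameter set has diameter at most `R`. -/
  diam_le : ∀ θ ∈ M.Θ, ∀ θ' ∈ M.Θ, ‖θ - θ'‖ ≤ R

/-- The score is the `θ`-gradient of a loss that is convex in `θ`. -/
def IsGradientOfConvexLoss : Prop :=
  ∃ loss : 𝒵 → Vec p → Vec l → ℝ, ∀ z, ∀ ξ ∈ M.domξ,
    ConvexOn ℝ M.domθ (fun θ => loss z θ ξ) ∧
    ∀ θ ∈ M.domθ, HasGradientAt (fun θ' => loss z θ' ξ) (M.score z θ ξ) θ

end MomentModel

/-! ### The forest -/

/-- A subsample of size `s` without replacement is an injection `Fin s ↪ Fin n`; the positions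
`t < s₂` form the estimation half `S²` and the others the splitting half `S¹`. With a uniformly
random injection, this is a uniformly random subsample with a uniformly random partition. -/
def estPositions (s s₂ : ℕ) : Finset (Fin s) := Finset.univ.filter fun t => (t : ℕ) < s₂

instance (s n : ℕ) : MeasurableSpace (Fin s ↪ Fin n) := ⊤

section Learner

variable {d p l k : ℕ} {𝒵 : Type*} [MeasurableSpace 𝒵]

/-- Forest regularity of a randomized tree learner `T`, which maps a (partitioned) sample of size
`s` and the internal randomness `ω ∼ ν` to a tree. -/
structure IsForestLearner (M : MomentModel d p l k 𝒵) (ρ π : ℝ) (r s s₂ : ℕ)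
    {Ωt : Type*} [MeasurableSpace Ωt] (ν : Measure Ωt)
    (T : (Fin s → 𝒵) → Ωt → SplitTree d) : Prop where
  measurable : Measurable fun q : (Fin s → 𝒵) × Ωt => T q.1 q.2
  /-- Honesty: the tree depends on the observations in `S²` only through their features. -/
  honest : ∀ z z' ω, (∀ t ∉ estPositions s s₂, z t = z' t) →
    (∀ t ∈ estPositions s s₂, M.feat (z t) = M.feat (z' t)) → T z ω = T z' ω
  balanced : ∀ᵐ q ∂((Measure.pi fun _ : Fin s => M.law).prod ν),
    (T q.1 q.2).Balanced ρ (fun t => M.feat (q.1 t)) (estPositions s s₂)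
  leafSize : ∀ᵐ q ∂((Measure.pi fun _ : Fin s => M.law).prod ν),
    (T q.1 q.2).LeafSize r (fun t => M.feat (q.1 t)) (estPositions s s₂)
  /-- Random split: given the sample, the splits above a node and that the node is split, the
  split is along the feature `j` with conditional probability at least `π / d`. -/
  randomSplit : ∀ᵐ z ∂(Measure.pi fun _ : Fin s => M.law), ∀ (v : List Bool) (j : Fin d)
    (A : Set (SplitTree d)), MeasurableSet[SplitTree.historySigma v] A →
      π / d * ν.real {ω | T z ω ∈ A ∧ (T z ω).splitDir v ≠ none} ≤
        ν.real {ω | T z ω ∈ A ∧ (T z ω).splitDir v = some j}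

/-- The forest weight `a_i = (1/B) ∑_b a_{ib}`; the `b`-th tree is grown on the subsample
`(draws b).1` with internal randomness `(draws b).2`. -/
noncomputable def forestWeight (M : MomentModel d p l k 𝒵) {n s B : ℕ} (s₂ : ℕ) {Ωt : Type*}
    (T : (Fin s → 𝒵) → Ωt → SplitTree d) (x : Vec d) (D : Fin n → 𝒵)
    (draws : Fin B → (Fin s ↪ Fin n) × Ωt) (i : Fin n) : ℝ :=
  (1 / (B : ℝ)) * ∑ b, (T (fun t => D ((draws b).1 t)) (draws b).2).weight x
    (fun i' => M.feat (D i')) ((estPositions s s₂).map (draws b).1) i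

/-- The weighted empirical score `∑ i, a_i ψ(Z_i; θ, h(X_i, W_i))`. -/
noncomputable def weightedScore (M : MomentModel d p l k 𝒵) {n s B : ℕ} (s₂ : ℕ) {Ωt : Type*}
    (T : (Fin s → 𝒵) → Ωt → SplitTree d) (x : Vec d) (D : Fin n → 𝒵)
    (draws : Fin B → (Fin s ↪ Fin n) × Ωt) (θ : Vec p) (h : Vec d → Vec k → Vec l) : Vec p :=
  ∑ i, forestWeight M s₂ T x D draws i • M.plugIn θ h (D i)

/-- The joint law of the first `n` observations, the last `n` observations, the internal
randomness of the first stage, and the `B` independent pairs (subsample, tree randomness). -/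
noncomputable def sampleLaw (M : MomentModel d p l k 𝒵) (n s B : ℕ) {Ωa : Type*}
    [MeasurableSpace Ωa] (α : Measure Ωa) {Ωt : Type*} [MeasurableSpace Ωt] (ν : Measure Ωt) :
    Measure ((Fin n → 𝒵) × (Fin n → 𝒵) × Ωa × (Fin B → (Fin s ↪ Fin n) × Ωt)) :=
  (Measure.pi fun _ => M.law).prod ((Measure.pi fun _ => M.law).prod (α.prod
    (Measure.pi fun _ => (uniformOn (Set.univ : Set (Fin s ↪ Fin n))).prod ν)))

end Learner

/-- The exponent constant `α = log(1/ρ) / (π log(1/(1-ρ)))`. -/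
noncomputable def kernelAlpha (ρ π : ℝ) : ℝ := Real.log ρ⁻¹ / (π * Real.log (1 - ρ)⁻¹)

end ORF

/-! The estimate is a zero of the weighted score at the estimated nuisance `ĥ`. It is therefore
enough to compare the weighted score with the moment at the target, uniformly over `Θ`, and to
invert the moment near its zero.

Comparison. One tree gives a bounded statistic of its subsample, and the forest averages it over `B`
random subsamples. Given the data the draws are i.i.d., and their conditional mean is a complete
U-statistic, that is, an average over permutations of means of `⌊n/s⌋` independent blocks.
Hoeffding's lemma on both levels gives deviations of order `√(s/n)` (`measureReal_forestMean_le`).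
The first stage is independent of the forest data, so `ĥ` can be frozen by Fubini, and a finite net
of `Θ` makes the bound uniform (`measure_weightedScore_le`). The mean of the statistic differs from
the moment only by a bias: by honesty every score in the leaf may be replaced by its conditional
mean given the features, and moments are Lipschitz, so the bias is at most `L` times the expected
weighted distance to the target (`abs_integral_treeStat_sub_le`).

Size of the leaves. Outside of a rare event, every box with many sample points has an empirical mass
close to its true mass (`exists_regularSample`). A balanced split then removes a definite proportion
of the mass, hence of the length, of a cell. The contraction factor must not depend on the ratio of
the density bounds, or the exponent would deteriorate. For short cells this follows from uniform
continuity of the density; replacing the length `l` by `l * exp (A * l)` achieves it for long cells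
too, at the price of a constant factor (`exists_potential`). Each split goes along a given feature
with conditional probability at least `π / d`, so the expected potential decays geometrically with
the depth (`lintegral_descPot_le`). About `0.8 * log m / log ρ⁻¹` generations are available, which
gives the exponent `1 / (2 α d)` (`exists_shrinkage`).

Inversion. Orthogonality removes the linear effect of the nuisance error at `θ₀`, so only `χ ^ 2`
remains there (`norm_moment_le_sq`), and increments of the moment in `θ` change by at most `L * χ *
‖θ - θ₀‖` (`norm_moment_mixed_le`); the latter term goes into the denominator. As the score is the
gradient of a convex loss, the Jacobian is symmetric, so `σ` bounds its quadratic form from below,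
and the moment is monotone. Near `θ₀` the quadratic form beats the second order remainder; far away,
monotonicity transports the estimate from a point at a fixed distance
(`norm_sub_le_of_monotone_expansion`). -/

namespace ORF

/-! ### Cells, addresses and paths in a tree -/

namespace SplitTree

variable {d : ℕ}

/-- Lower end, along feature `j`, of the cell whose reversed address is `u`. -/
noncomputable def lower (t : SplitTree d) (j : Fin d) : List Bool → ℝ
  | [] => 0
  | b :: u =>
      if b = true ∧ t.splitDir u.reverse = some j then max (lower t j u) (t.splitThr u.reverse)
      else lower t j u

/-- Upper end, along feature `j`, of the cell whose reversed address is `u`. -/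
noncomputable def upper (t : SplitTree d) (j : Fin d) : List Bool → ℝ
  | [] => 1
  | b :: u =>
      if b = false ∧ t.splitDir u.reverse = some j then min (upper t j u) (t.splitThr u.reverse)
      else upper t j u

/-- The node with reversed address `u` exists, and the point `x` belongs to its cell. -/
def OnPath (t : SplitTree d) (x : Vec d) : List Bool → Prop
  | [] => True
  | b :: u => OnPath t x u ∧
      ∃ j, t.splitDir u.reverse = some j ∧ (b = true ↔ t.splitThr u.reverse < x j)

lemma lower_nonneg (t : SplitTree d) (j : Fin d) (u : List Bool) : 0 ≤ t.lower j u := by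
  induction u with
  | nil => exact le_rfl
  | cons b u ih =>
    rw [lower]; split_ifs
    · exact ih.trans (le_max_left _ _)
    · exact ih

lemma upper_le_one (t : SplitTree d) (j : Fin d) (u : List Bool) : t.upper j u ≤ 1 := by
  induction u with
  | nil => exact le_rfl
  | cons b u ih =>
    rw [upper]; split_ifs
    · exact (min_le_left _ _).trans ih
    · exact ih

lemma OnPath.mem_Icc {t : SplitTree d} {y : Vec d} (hy : y ∈ cube d) (j : Fin d)
    {u : List Bool} (h : t.OnPath y u) : t.lower j u ≤ y j ∧ y j ≤ t.upper j u := by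
  induction u with
  | nil => exact hy j
  | cons b u ih =>
    obtain ⟨hu, j', hj', hb⟩ := h
    obtain ⟨h1, h2⟩ := ih hu
    rw [lower, upper]
    constructor
    · split_ifs with hc
      · obtain ⟨rfl, hc⟩ := hc
        obtain rfl : j' = j := by rw [hj'] at hc; exact Option.some.inj hc
        exact max_le h1 (hb.1 rfl).le
      · exact h1
    · split_ifs with hc
      · obtain ⟨rfl, hc⟩ := hc
        obtain rfl : j' = j := by rw [hj'] at hc; exact Option.some.inj hc
        refine le_min h2 (not_lt.1 fun h => ?_)
        simpa using hb.2 h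
      · exact h2

/-- Strict inequalities decide every split above the cell, whichever side boundary points are sent
to; `OnPath.mem_Icc` gives only the closed cell in return. Because of this gap, points are counted
in open boxes for one bound and in closed boxes for the other. -/
lemma onPath_of_mem_Ioo {t : SplitTree d} {x y : Vec d} {u : List Bool} (hx : t.OnPath x u)
    (hy : ∀ j, t.lower j u < y j ∧ y j < t.upper j u) : t.OnPath y u := by
  induction u with
  | nil => trivial
  | cons b u ih =>
    obtain ⟨hu, j, hj, hb⟩ := hx
    refine ⟨ih hu fun i => ⟨lt_of_le_of_lt ?_ (hy i).1, lt_of_lt_of_le (hy i).2 ?_⟩, j, hj, ?_⟩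
    · rw [lower]; split_ifs
      · exact le_max_left _ _
      · exact le_rfl
    · rw [upper]; split_ifs
      · exact min_le_left _ _
      · exact le_rfl
    · have h := hy j
      rw [lower, upper] at h
      cases b
      · simp only [hj, and_self, if_true] at h
        simpa using (h.2.trans_le (min_le_right _ _)).le
      · simp only [hj, and_self, if_true] at h
        simpa using (le_max_right _ _).trans_lt h.1

/-- Addresses are reversed: `cons` descends by one generation, and the last entry is the decision at
the root. Peeling it off is what makes induction over the tree compatible with addresses. -/
lemma onPath_node_append (j : Fin d) (c : ℝ) (t₁ t₂ : SplitTree d) (y : Vec d) (b : Bool)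
    (u : List Bool) : (node j c t₁ t₂).OnPath y (u ++ [b]) ↔
      (b = true ↔ c < y j) ∧ (if b then t₂ else t₁).OnPath y u := by
  induction u with
  | nil => simp [OnPath, splitDir, splitThr]
  | cons b' u ih =>
    rw [List.cons_append, OnPath, ih, OnPath]
    cases b <;> simp [splitDir, splitThr, and_assoc]

lemma splitDir_node_append (j : Fin d) (c : ℝ) (t₁ t₂ : SplitTree d) (b : Bool)
    (u : List Bool) : (node j c t₁ t₂).splitDir (u ++ [b]).reverse =
      (if b then t₂ else t₁).splitDir u.reverse := by
  cases b <;> simp [splitDir]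

variable {ι : Type*}

open Classical in
lemma filter_onPath_node (X : ι → Vec d) (S : Finset ι) (j : Fin d) (c : ℝ)
    (t₁ t₂ : SplitTree d) (b : Bool) (u : List Bool) :
    (S.filter fun i => (node j c t₁ t₂).OnPath (X i) (u ++ [b])) =
      (if b then S.filter fun i => c < X i j else S.filter fun i => X i j ≤ c).filter
        fun i => (if b then t₂ else t₁).OnPath (X i) u := by
  ext i
  cases b <;> simp [onPath_node_append, and_assoc]

open Classical in
lemma Balanced.le_card {ρ : ℝ} {X : ι → Vec d} {t : SplitTree d} {S : Finset ι}
    (h : t.Balanced ρ X S) {u : List Bool} (hu : t.splitDir u.reverse ≠ none) (b : Bool) :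
    ρ * ((S.filter fun i => t.OnPath (X i) u).card : ℝ) ≤
      ((S.filter fun i => t.OnPath (X i) (b :: u)).card : ℝ) := by
  induction t generalizing S u with
  | leaf => simp [splitDir] at hu
  | node j c t₁ t₂ ih₁ ih₂ =>
    obtain ⟨h1, h2, h3, h4⟩ := h
    rcases List.eq_nil_or_concat u with rfl | ⟨u, b', rfl⟩
    · have e : (S.filter fun i => (node j c t₁ t₂).OnPath (X i) []) = S :=
        Finset.filter_true_of_mem fun _ _ => trivial
      rw [e]
      cases b
      · simpa [OnPath, splitDir, splitThr] using h1
      · simpa [OnPath, splitDir, splitThr] using h2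
    · rw [List.concat_eq_append, splitDir_node_append] at hu
      rw [List.concat_eq_append, ← List.cons_append, filter_onPath_node, filter_onPath_node]
      cases b'
      · simpa using ih₁ h3 (by simpa using hu)
      · simpa using ih₂ h4 (by simpa using hu)

open Classical in
lemma LeafSize.card_lt {r : ℕ} {X : ι → Vec d} {t : SplitTree d} {S : Finset ι}
    (h : t.LeafSize r X S) {x : Vec d} {u : List Bool} (hx : t.OnPath x u)
    (hu : t.splitDir u.reverse = none) :
    (S.filter fun i => t.OnPath (X i) u).card < 2 * r := by
  induction t generalizing S u with
  | leaf =>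
    cases u with
    | nil =>
      have e : (S.filter fun i => (leaf : SplitTree d).OnPath (X i) []) = S :=
        Finset.filter_true_of_mem fun _ _ => trivial
      rw [e]
      exact h.2
    | cons b u => obtain ⟨-, j, hj, -⟩ := hx; simp [splitDir] at hj
  | node j c t₁ t₂ ih₁ ih₂ =>
    obtain ⟨h1, h2⟩ := h
    rcases List.eq_nil_or_concat u with rfl | ⟨u, b', rfl⟩
    · simp [splitDir] at hu
    · rw [List.concat_eq_append, splitDir_node_append] at hu
      rw [List.concat_eq_append, onPath_node_append] at hx
      rw [List.concat_eq_append, filter_onPath_node]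
      cases b'
      · simpa using ih₁ h1 (by simpa using hx.2) (by simpa using hu)
      · simpa using ih₂ h2 (by simpa using hx.2) (by simpa using hu)

open Classical in
lemma LeafSize.le_card_leafOf {r : ℕ} {X : ι → Vec d} {t : SplitTree d} {S : Finset ι}
    (h : t.LeafSize r X S) (x : Vec d) : r ≤ (S.filter fun i => X i ∈ t.leafOf x).card := by
  induction t generalizing S with
  | leaf => simpa [leafOf] using h.1
  | node j c t₁ t₂ ih₁ ih₂ =>
    rw [leafOf]; split_ifs with hc
    · refine (ih₁ h.1).trans (Finset.card_le_card fun i => ?_)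
      simp +contextual
    · refine (ih₂ h.2).trans (Finset.card_le_card fun i => ?_)
      simp +contextual

/-- Replaces the recursive leaf by conditions at fixed addresses. This yields its measurability, and
shows that it lies in every cell through which `x` passes. -/
lemma mem_leafOf_iff (t : SplitTree d) (x y : Vec d) :
    y ∈ t.leafOf x ↔ ∀ u, t.OnPath x u → t.OnPath y u := by
  induction t with
  | leaf =>
    simp only [leafOf, Set.mem_univ, true_iff]
    rintro (_ | ⟨b, u⟩) h
    · trivial
    · obtain ⟨-, j, hj, -⟩ := h; simp [splitDir] at hj
  | node j c t₁ t₂ ih₁ ih₂ =>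
    have key : (∀ u, (node j c t₁ t₂).OnPath x u → (node j c t₁ t₂).OnPath y u) ↔
        ∀ b u, (b = true ↔ c < x j) → (if b then t₂ else t₁).OnPath x u →
          (b = true ↔ c < y j) ∧ (if b then t₂ else t₁).OnPath y u := by
      constructor
      · intro h b u h1 h2
        rw [← onPath_node_append]
        exact h _ ((onPath_node_append ..).2 ⟨h1, h2⟩)
      · intro h u hu
        rcases List.eq_nil_or_concat u with rfl | ⟨u, b', rfl⟩
        · trivial
        · rw [List.concat_eq_append, onPath_node_append] at hu ⊢
          exact h _ _ hu.1 hu.2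
    rw [key, leafOf]
    by_cases hc : x j ≤ c
    · have hc' : ¬ c < x j := not_lt.2 hc
      simp only [hc, if_true, Set.mem_inter_iff, Set.mem_ofPred_eq, ih₁]
      constructor
      · rintro ⟨h1, h2⟩ b u hb hu
        obtain rfl : b = false := by simpa [hc'] using hb
        exact ⟨by simpa using h1, by simpa using h2 u (by simpa using hu)⟩
      · intro h
        exact ⟨by simpa [OnPath] using (h false [] (by simpa using hc) trivial).1,
          fun u hu => by simpa using (h false u (by simpa using hc) (by simpa using hu)).2⟩
    · have hc' : c < x j := not_le.1 hc
      simp only [hc, if_false, Set.mem_inter_iff, Set.mem_ofPred_eq, ih₂]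
      constructor
      · rintro ⟨h1, h2⟩ b u hb hu
        obtain rfl : b = true := by simpa [hc'] using hb
        exact ⟨by simpa using h1, by simpa using h2 u (by simpa using hu)⟩
      · intro h
        exact ⟨by simpa [OnPath] using (h true [] (by simpa using hc') trivial).1,
          fun u hu => by simpa using (h true u (by simpa using hc') (by simpa using hu)).2⟩

/-! Measurability -/

lemma nodeSigma_le_historySigma (b : Bool) (u : List Bool) :
    nodeSigma (d := d) u.reverse ≤ historySigma (b :: u).reverse := by
  refine le_iSup₂_of_le (f := fun w (_ : w ∈ _) => nodeSigma w) u.reverse ?_ le_rfl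
  simp

lemma historySigma_mono (b : Bool) (u : List Bool) :
    historySigma (d := d) u.reverse ≤ historySigma (b :: u).reverse := by
  refine iSup₂_le fun w hw => le_iSup₂_of_le (f := fun w (_ : w ∈ _) => nodeSigma w) w ?_ le_rfl
  obtain ⟨h1, h2⟩ := hw
  refine ⟨h1.trans (by simp), fun h => h2 (h1.eq_of_length_le ?_)⟩
  subst h; simp

lemma nodeSigma_le (v : List Bool) :
    nodeSigma (d := d) v ≤ (inferInstance : MeasurableSpace (SplitTree d)) :=
  le_iSup (fun v => nodeSigma (d := d) v) v

lemma historySigma_le (v : List Bool) :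
    historySigma (d := d) v ≤ (inferInstance : MeasurableSpace (SplitTree d)) :=
  iSup₂_le fun w _ => nodeSigma_le w

lemma measurableSet_splitDir (v : List Bool) (A : Set (Option (Fin d))) :
    MeasurableSet[nodeSigma v] {t : SplitTree d | t.splitDir v ∈ A} :=
  (le_sup_left : _ ≤ nodeSigma (d := d) v) _ ⟨A, trivial, rfl⟩

lemma measurable_splitThr (v : List Bool) :
    Measurable[nodeSigma v] fun t : SplitTree d => t.splitThr v := by
  intro A hA
  refine (le_sup_right : _ ≤ nodeSigma (d := d) v) _ ⟨A, ?_, rfl⟩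
  rwa [← BorelSpace.measurable_eq (α := ℝ)]

/-- Only splits strictly above a cell decide whether `x` reaches it. Measurability for the history,
and not just for the full σ-algebra, matters because the random split property is conditional on the
history. -/
lemma measurableSet_onPath (x : Vec d) (u : List Bool) :
    MeasurableSet[historySigma u.reverse] {t : SplitTree d | t.OnPath x u} := by
  induction u with
  | nil => simp [OnPath]
  | cons b u ih =>
    have : {t : SplitTree d | t.OnPath x (b :: u)} = {t | t.OnPath x u} ∩
        ⋃ j, ({t | t.splitDir u.reverse ∈ ({some j} : Set (Option (Fin d)))} ∩
          {t | b = true ↔ t.splitThr u.reverse < x j}) := by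
      ext t; simp [OnPath]
    rw [this]
    refine MeasurableSet.inter (historySigma_mono b u _ ih) (nodeSigma_le_historySigma b u _ ?_)
    refine MeasurableSet.iUnion fun j => (measurableSet_splitDir _ _).inter ?_
    have h : MeasurableSet[nodeSigma u.reverse] {t : SplitTree d | t.splitThr u.reverse < x j} :=
      measurable_splitThr u.reverse measurableSet_Iio
    cases b
    · convert h.compl using 1; ext; simp
    · simpa using h

lemma measurable_lower (j : Fin d) (u : List Bool) :
    Measurable[historySigma u.reverse] fun t : SplitTree d => t.lower j u := by
  induction u with
  | nil => exact measurable_const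
  | cons b u ih =>
    simp only [lower]
    refine Measurable.ite (p := fun t : SplitTree d => b = true ∧ t.splitDir u.reverse = some j)
      ?_ ?_ (ih.mono (historySigma_mono b u) le_rfl)
    · cases b
      · simp
      · simpa using nodeSigma_le_historySigma true u _ (measurableSet_splitDir u.reverse {some j})
    · exact (ih.mono (historySigma_mono b u) le_rfl).max
        ((measurable_splitThr _).mono (nodeSigma_le_historySigma b u) le_rfl)

lemma measurable_upper (j : Fin d) (u : List Bool) :
    Measurable[historySigma u.reverse] fun t : SplitTree d => t.upper j u := by
  induction u with
  | nil => exact measurable_const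
  | cons b u ih =>
    simp only [upper]
    refine Measurable.ite (p := fun t : SplitTree d => b = false ∧ t.splitDir u.reverse = some j)
      ?_ ?_ (ih.mono (historySigma_mono b u) le_rfl)
    · cases b
      · simpa using nodeSigma_le_historySigma false u _ (measurableSet_splitDir u.reverse {some j})
      · simp
    · exact (ih.mono (historySigma_mono b u) le_rfl).min
        ((measurable_splitThr _).mono (nodeSigma_le_historySigma b u) le_rfl)

lemma measurableSet_onPath_prod (u : List Bool) :
    MeasurableSet {q : SplitTree d × Vec d | q.1.OnPath q.2 u} := by
  induction u with
  | nil => simp [OnPath]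
  | cons b u ih =>
    have : {q : SplitTree d × Vec d | q.1.OnPath q.2 (b :: u)} = {q | q.1.OnPath q.2 u} ∩
        ⋃ j, ({q | q.1.splitDir u.reverse ∈ ({some j} : Set (Option (Fin d)))} ∩
          {q | b = true ↔ q.1.splitThr u.reverse < q.2 j}) := by
      ext t; simp [OnPath]
    rw [this]
    refine MeasurableSet.inter ih (MeasurableSet.iUnion fun j => MeasurableSet.inter ?_ ?_)
    · exact measurable_fst (nodeSigma_le _ _ (measurableSet_splitDir _ _))
    · have h : MeasurableSet {q : SplitTree d × Vec d | q.1.splitThr u.reverse < q.2 j} :=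
        measurableSet_lt (((measurable_splitThr _).mono (nodeSigma_le _) le_rfl).comp
          measurable_fst) (by fun_prop)
      cases b
      · convert h.compl using 1; ext; simp
      · simpa using h

lemma measurableSet_mem_leafOf (x : Vec d) :
    MeasurableSet {q : SplitTree d × Vec d | q.2 ∈ q.1.leafOf x} := by
  have : {q : SplitTree d × Vec d | q.2 ∈ q.1.leafOf x} =
      ⋂ u, ({q | q.1.OnPath x u}ᶜ ∪ {q | q.1.OnPath q.2 u}) := by
    ext q; simp [mem_leafOf_iff, imp_iff_not_or]
  rw [this]
  refine MeasurableSet.iInter fun u => MeasurableSet.union ?_ (measurableSet_onPath_prod u)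
  exact (measurable_fst (historySigma_le _ _ (measurableSet_onPath x u))).compl

end SplitTree

end ORF

/-! ### Masses of boxes under the law of the features -/

namespace ORF

variable {d : ℕ}

/-- The closed axis-aligned box with lower corner `lo` and upper corner `hi`. -/
def box (lo hi : Fin d → ℝ) : Set (Vec d) := {y | ∀ k, lo k ≤ y k ∧ y k ≤ hi k}

lemma measurableSet_box (lo hi : Fin d → ℝ) : MeasurableSet (box lo hi) := by
  have : box lo hi = ⋂ k, {y : Vec d | lo k ≤ y k} ∩ {y | y k ≤ hi k} := by
    ext y; simp [box]
  rw [this]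
  exact MeasurableSet.iInter fun k => (measurableSet_le (by fun_prop) (by fun_prop)).inter
    (measurableSet_le (by fun_prop) (by fun_prop))

lemma cube_eq_box : cube d = box 0 1 := rfl

lemma measurableSet_cube : MeasurableSet (cube d) := measurableSet_box 0 1

lemma isClosed_cube : IsClosed (cube d) := by
  have : cube d = ⋂ k, {y : Vec d | 0 ≤ y k} ∩ {y | y k ≤ 1} := by
    ext y; simp [cube]
  rw [this]
  exact isClosed_iInter fun k => (isClosed_le (by fun_prop) (by fun_prop)).inter
    (isClosed_le (by fun_prop) (by fun_prop))

lemma isCompact_cube : IsCompact (cube d) := by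
  refine Metric.isCompact_of_isClosed_isBounded isClosed_cube
    (Metric.isBounded_iff_subset_closedBall 0 |>.2 ⟨√d, fun y hy => ?_⟩)
  rw [mem_closedBall_zero_iff, EuclideanSpace.norm_eq]
  refine Real.sqrt_le_sqrt ?_
  calc ∑ i, ‖y i‖ ^ 2 ≤ ∑ i : Fin d, (1 : ℝ) := by
        refine Finset.sum_le_sum fun i _ => ?_
        rw [Real.norm_eq_abs, sq_abs]
        have := hy i; nlinarith
    _ = d := by simp

lemma box_subset_cube {lo hi : Fin d → ℝ} (hlo : ∀ k, 0 ≤ lo k) (hhi : ∀ k, hi k ≤ 1) :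
    box lo hi ⊆ cube d := fun _ hy k => ⟨(hlo k).trans (hy k).1, (hy k).2.trans (hhi k)⟩

/-- The distribution on the cube with density `f`. -/
noncomputable def cubeLaw (f : Vec d → ℝ) : Measure (Vec d) :=
  (volume.restrict (cube d)).withDensity fun y => ENNReal.ofReal (f y)

lemma measurable_indicator_cube {f : Vec d → ℝ} (hf : ContinuousOn f (cube d)) :
    Measurable ((cube d).indicator fun y => ENNReal.ofReal (f y)) := by
  classical
  rw [← Set.piecewise_eq_indicator]
  exact ContinuousOn.measurable_piecewise
    (ENNReal.continuous_ofReal.comp_continuousOn hf) continuousOn_const measurableSet_cube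

/-- Moves the mass to the product space `Fin d → ℝ`, where one coordinate can be integrated out by
`lmarginal`. -/
lemma cubeLaw_apply_box {f : Vec d → ℝ} {lo hi : Fin d → ℝ}
    (hlo : ∀ k, 0 ≤ lo k) (hhi : ∀ k, hi k ≤ 1) :
    cubeLaw f (box lo hi) = ∫⁻ v : Fin d → ℝ, (box lo hi).indicator
      ((cube d).indicator fun y => ENNReal.ofReal (f y)) (WithLp.toLp 2 v) := by
  rw [cubeLaw, withDensity_apply _ (measurableSet_box lo hi), Measure.restrict_restrict
    (measurableSet_box lo hi), Set.inter_eq_left.2 (box_subset_cube hlo hhi),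
    ← lintegral_indicator (measurableSet_box lo hi),
    (PiLp.volume_preserving_toLp (Fin d)).lintegral_comp_emb
      (MeasurableEquiv.toLp 2 (Fin d → ℝ)).measurableEmbedding]
  refine lintegral_congr fun y => ?_
  rw [Set.indicator_indicator, Set.inter_eq_left.2 (box_subset_cube hlo hhi)]

/-- Fubini over the coordinates other than `j`: on each line parallel to the `j`-th axis, the share
of the mass is at most `κ` times the share of the length. Only points that differ in coordinate `j`
are compared, so the other sides of the box may be long. -/
lemma cubeLaw_box_ratio {f : Vec d → ℝ} (hf : ContinuousOn f (cube d)) {lo hi : Fin d → ℝ}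
    (hlo : ∀ k, 0 ≤ lo k) (hhi : ∀ k, hi k ≤ 1) {j : Fin d} {a b κ : ℝ} (ha : lo j ≤ a)
    (hb : b ≤ hi j) (hκ : 0 ≤ κ)
    (hfκ : ∀ y ∈ box lo hi, ∀ y' ∈ box lo hi, (∀ k, k ≠ j → y k = y' k) → f y ≤ κ * f y') :
    ENNReal.ofReal (hi j - lo j) * cubeLaw f (box (Function.update lo j a) (Function.update hi j b))
      ≤ ENNReal.ofReal (κ * (b - a)) * cubeLaw f (box lo hi) := by
  classical
  set F : Vec d → ENNReal := (cube d).indicator fun y => ENNReal.ofReal (f y) with hF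
  have hFm : Measurable F := measurable_indicator_cube hf
  set lo' := Function.update lo j a
  set hi' := Function.update hi j b
  have hlo' : ∀ k, 0 ≤ lo' k := fun k => by
    by_cases h : k = j
    · subst h; simpa [lo'] using (hlo k).trans ha
    · simpa [lo', h] using hlo k
  have hhi' : ∀ k, hi' k ≤ 1 := fun k => by
    by_cases h : k = j
    · subst h; simpa [hi'] using hb.trans (hhi k)
    · simpa [hi', h] using hhi k
  rw [cubeLaw_apply_box hlo' hhi', cubeLaw_apply_box hlo hhi]
  have hm : ∀ l h : Fin d → ℝ, Measurable fun v : Fin d → ℝ =>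
      (box l h).indicator F (WithLp.toLp 2 v) := fun l h =>
    (hFm.indicator (measurableSet_box l h)).comp (WithLp.measurable_toLp 2 (Fin d → ℝ))
  rw [← lintegral_const_mul _ (hm _ _), ← lintegral_const_mul _ (hm _ _)]
  refine lintegral_le_of_lmarginal_le (μ := fun _ : Fin d => (volume : Measure ℝ)) {j}
    ((hm _ _).const_mul _) ((hm _ _).const_mul _) fun v => ?_
  rw [lmarginal_singleton, lmarginal_singleton]
  have hmu : ∀ l h : Fin d → ℝ, Measurable fun c : ℝ =>
      (box l h).indicator F (WithLp.toLp 2 (Function.update v j c)) := fun l h =>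
    (hm l h).comp (measurable_update v)
  beta_reduce
  rw [lintegral_const_mul _ (hmu _ _), lintegral_const_mul _ (hmu _ _)]
  by_cases hv : ∀ k, k ≠ j → lo k ≤ v k ∧ v k ≤ hi k
  swap
  · have h0 : ∀ c, (box lo' hi').indicator F (WithLp.toLp 2 (Function.update v j c)) = 0 := by
      intro c
      refine Set.indicator_of_notMem (fun h => hv fun k hk => ?_) _
      simpa [lo', hi', hk] using h k
    simp [h0]
  have hmem : ∀ c, lo j ≤ c → c ≤ hi j → WithLp.toLp 2 (Function.update v j c) ∈ box lo hi := by
    intro c h1 h2 k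
    by_cases h : k = j
    · subst h; simpa using ⟨h1, h2⟩
    · simpa [h] using hv k h
  have hI' : ∀ c, (box lo' hi').indicator F (WithLp.toLp 2 (Function.update v j c)) ≤
      (Set.Icc a b).indicator (fun c => F (WithLp.toLp 2 (Function.update v j c))) c := by
    intro c
    by_cases hc : WithLp.toLp 2 (Function.update v j c) ∈ box lo' hi'
    · rw [Set.indicator_of_mem hc, Set.indicator_of_mem]
      simpa [lo', hi'] using hc j
    · rw [Set.indicator_of_notMem hc]; exact zero_le
  have hI : ∀ c, (box lo hi).indicator F (WithLp.toLp 2 (Function.update v j c)) ≥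
      (Set.Icc (lo j) (hi j)).indicator
        (fun c => F (WithLp.toLp 2 (Function.update v j c))) c := by
    intro c
    by_cases hc : c ∈ Set.Icc (lo j) (hi j)
    · rw [Set.indicator_of_mem hc, Set.indicator_of_mem (hmem c hc.1 hc.2)]
    · rw [Set.indicator_of_notMem hc]; exact zero_le
  refine (mul_le_mul_right (lintegral_mono hI') _).trans
    (le_trans ?_ (mul_le_mul_right (lintegral_mono hI) _))
  rw [lintegral_indicator measurableSet_Icc, lintegral_indicator measurableSet_Icc]
  set G := ∫⁻ c in Set.Icc (lo j) (hi j), F (WithLp.toLp 2 (Function.update v j c))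
  -- Averaging `f y ≤ κ * f y'` over the points `y'` of the line bounds the density at one point by
  -- `κ` times the mean density.
  have key : ∀ c ∈ Set.Icc a b, ENNReal.ofReal (hi j - lo j) *
      F (WithLp.toLp 2 (Function.update v j c)) ≤ ENNReal.ofReal κ * G := by
    intro c hc
    have hc' := hmem c (ha.trans hc.1) (hc.2.trans hb)
    have : ∫⁻ _ in Set.Icc (lo j) (hi j), F (WithLp.toLp 2 (Function.update v j c)) ≤
        ∫⁻ c' in Set.Icc (lo j) (hi j), ENNReal.ofReal κ *
          F (WithLp.toLp 2 (Function.update v j c')) := by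
      refine setLIntegral_mono' measurableSet_Icc fun c' hc'' => ?_
      have hc2 := hmem c' hc''.1 hc''.2
      rw [hF, Set.indicator_of_mem (box_subset_cube hlo hhi hc'),
        Set.indicator_of_mem (box_subset_cube hlo hhi hc2), ← ENNReal.ofReal_mul hκ]
      refine ENNReal.ofReal_le_ofReal (hfκ _ hc' _ hc2 fun k hk => ?_)
      simp [hk]
    rw [setLIntegral_const, Real.volume_Icc, lintegral_const_mul] at this
    · rwa [mul_comm]
    · exact hFm.comp ((WithLp.measurable_toLp 2 (Fin d → ℝ)).comp (measurable_update v))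
  rw [← lintegral_const_mul]
  · refine (setLIntegral_mono' measurableSet_Icc key).trans ?_
    rw [setLIntegral_const, Real.volume_Icc, ENNReal.ofReal_mul hκ]
    exact le_of_eq (by ring)
  · exact hFm.comp ((WithLp.measurable_toLp 2 (Fin d → ℝ)).comp (measurable_update v))

lemma cubeLaw_box_ratio_real {f : Vec d → ℝ} (hf : ContinuousOn f (cube d))
    [IsProbabilityMeasure (cubeLaw f)] {lo hi : Fin d → ℝ}
    (hlo : ∀ k, 0 ≤ lo k) (hhi : ∀ k, hi k ≤ 1) {j : Fin d} {a b κ : ℝ} (ha : lo j ≤ a)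
    (hb : b ≤ hi j) (hlh : lo j ≤ hi j) (hab : a ≤ b) (hκ : 0 ≤ κ)
    (hfκ : ∀ y ∈ box lo hi, ∀ y' ∈ box lo hi, (∀ k, k ≠ j → y k = y' k) → f y ≤ κ * f y') :
    (hi j - lo j) * (cubeLaw f).real (box (Function.update lo j a) (Function.update hi j b))
      ≤ κ * (b - a) * (cubeLaw f).real (box lo hi) := by
  have h := ENNReal.toReal_mono (ENNReal.mul_ne_top ENNReal.ofReal_ne_top (measure_ne_top _ _))
    (cubeLaw_box_ratio hf hlo hhi ha hb hκ hfκ)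
  rwa [ENNReal.toReal_mul, ENNReal.toReal_mul, ENNReal.toReal_ofReal (sub_nonneg.2 hlh),
    ENNReal.toReal_ofReal (mul_nonneg hκ (sub_nonneg.2 hab))] at h

lemma cubeLaw_cube (f : Vec d → ℝ) [IsProbabilityMeasure (cubeLaw f)] :
    (cubeLaw f).real (cube d) = 1 := by
  have h : cubeLaw f (cube d)ᶜ = 0 := by
    rw [cubeLaw, withDensity_apply _ measurableSet_cube.compl,
      Measure.restrict_restrict measurableSet_cube.compl]
    simp
  have := prob_compl_eq_zero_iff (μ := cubeLaw f) measurableSet_cube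
  rw [Measure.real, this.1 h]; rfl

/-- The mass of a slab of the cube is at most a constant times its width. -/
lemma cubeLaw_slab_le {f : Vec d → ℝ} (hf : ContinuousOn f (cube d))
    [IsProbabilityMeasure (cubeLaw f)] {κ : ℝ} (hκ : 0 ≤ κ)
    (hfκ : ∀ y ∈ cube d, ∀ y' ∈ cube d, f y ≤ κ * f y') (j : Fin d) {a b : ℝ} (hab : a ≤ b) :
    (cubeLaw f).real {y ∈ cube d | a ≤ y j ∧ y j ≤ b} ≤ κ * (b - a) := by
  by_cases h : max 0 a ≤ min 1 b
  · have h1 := cubeLaw_box_ratio_real hf (lo := 0) (hi := 1) (j := j) (a := max 0 a)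
      (b := min 1 b) (fun k => le_rfl) (fun k => le_rfl) (le_max_left _ _) (min_le_left _ _)
      (by simp) h hκ (fun y hy y' hy' _ => hfκ y hy y' hy')
    rw [← cube_eq_box, cubeLaw_cube] at h1
    simp only [Pi.one_apply, Pi.zero_apply, sub_zero, one_mul, mul_one] at h1
    refine le_trans (measureReal_mono fun y hy => ?_) (h1.trans ?_)
    · intro k
      by_cases hk : k = j
      · subst hk
        simpa using ⟨⟨(hy.1 k).1, hy.2.1⟩, (hy.1 k).2, hy.2.2⟩
      · simpa [hk] using hy.1 k
    · have := le_max_right 0 a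
      have := min_le_right 1 b
      exact mul_le_mul_of_nonneg_left (by linarith) hκ
  · have : {y ∈ cube d | a ≤ y j ∧ y j ≤ b} = ∅ := by
      ext y
      simp only [Set.mem_ofPred_eq, Set.mem_empty_iff_false, iff_false, not_and]
      intro h1 h2 h3
      exact h ((max_le (h1 j).1 h2).trans (le_min (h1 j).2 h3))
    rw [this]
    simpa using mul_nonneg hκ (sub_nonneg.2 hab)

end ORF

/-! ### Chernoff bounds for the number of sample points in a set -/

namespace ORF

section Binomial

variable {𝒵 ι : Type*}

open Classical in
/-- The number of sample points with index in `S` that belong to `A`. -/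
noncomputable def count (S : Finset ι) (A : Set 𝒵) (z : ι → 𝒵) : ℝ :=
  ((S.filter fun i => z i ∈ A).card : ℝ)

open Classical in
lemma count_eq_sum [Fintype ι] (S : Finset ι) (A : Set 𝒵) (z : ι → 𝒵) :
    count S A z = ∑ i, if i ∈ S then A.indicator (fun _ => (1 : ℝ)) (z i) else 0 := by
  rw [count, Finset.card_filter]
  push_cast
  rw [← Finset.sum_filter]
  simp [Set.indicator_apply]

lemma count_nonneg (S : Finset ι) (A : Set 𝒵) (z : ι → 𝒵) : 0 ≤ count S A z := Nat.cast_nonneg _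

lemma count_mono (S : Finset ι) {A B : Set 𝒵} (h : A ⊆ B) (z : ι → 𝒵) :
    count S A z ≤ count S B z := by
  classical
  refine Nat.cast_le.2 (Finset.card_le_card fun i => ?_)
  simp only [Finset.mem_filter]
  exact fun hi => ⟨hi.1, h hi.2⟩

lemma count_le_card (S : Finset ι) (A : Set 𝒵) (z : ι → 𝒵) : count S A z ≤ S.card := by
  classical
  exact Nat.cast_le.2 (Finset.card_filter_le _ _)

variable [MeasurableSpace 𝒵] [Fintype ι]

lemma measurable_count (S : Finset ι) {A : Set 𝒵} (hA : MeasurableSet A) :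
    Measurable (count S A) := by
  classical
  have : count S A = fun z => ∑ i, if i ∈ S then A.indicator (fun _ => (1 : ℝ)) (z i) else 0 :=
    funext fun z => count_eq_sum S A z
  rw [this]
  refine Finset.measurable_sum _ fun i _ => ?_
  by_cases hi : i ∈ S
  · simp only [hi, if_true]
    exact (measurable_const.indicator hA).comp (measurable_pi_apply i)
  · simp only [hi, if_false]; exact measurable_const

variable (μ : Measure 𝒵) [IsProbabilityMeasure μ]

/-- The count is a sum of independent Bernoulli variables, and `1 + x ≤ exp x` bounds each factor.
-/
lemma integral_exp_count_le (S : Finset ι) {A : Set 𝒵} (hA : MeasurableSet A) (c : ℝ) :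
    ∫ z, Real.exp (c * count S A z) ∂(Measure.pi fun _ : ι => μ) ≤
      Real.exp (S.card * μ.real A * (Real.exp c - 1)) := by
  classical
  have h1 : ∀ z : ι → 𝒵, Real.exp (c * count S A z) =
      ∏ i, (if i ∈ S then Real.exp (c * A.indicator (fun _ => (1 : ℝ)) (z i)) else 1) := by
    intro z
    rw [count_eq_sum, Finset.mul_sum, Real.exp_sum]
    refine Finset.prod_congr rfl fun i _ => ?_
    split_ifs <;> simp
  simp_rw [h1]
  rw [integral_fintype_prod_eq_prod (μ := fun _ : ι => μ) (𝕜 := ℝ)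
    (fun i y => if i ∈ S then Real.exp (c * A.indicator (fun _ => (1 : ℝ)) y) else 1)]
  have h2 : ∀ i, (∫ y, (if i ∈ S then Real.exp (c * A.indicator (fun _ => (1 : ℝ)) y) else 1) ∂μ)
      = if i ∈ S then 1 + μ.real A * (Real.exp c - 1) else 1 := by
    intro i
    split_ifs
    · have : ∀ y, Real.exp (c * A.indicator (fun _ => (1 : ℝ)) y) =
          1 + A.indicator (fun _ => Real.exp c - 1) y := by
        intro y
        by_cases hy : y ∈ A <;> simp [hy]
      simp_rw [this]
      rw [integral_add (integrable_const _) ((integrable_const _).indicator hA),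
        integral_indicator_const _ hA]
      simp
    · simp
  simp_rw [h2]
  rw [Finset.prod_ite_mem, Finset.univ_inter, Finset.prod_const, mul_assoc, Real.exp_nat_mul]
  refine pow_le_pow_left₀ ?_ ?_ _
  · nlinarith [Real.exp_pos c, measureReal_le_one (μ := μ) (s := A),
      measureReal_nonneg (μ := μ) (s := A)]
  · linarith [Real.add_one_le_exp (μ.real A * (Real.exp c - 1))]

/-- Markov's inequality for the exponential of the count, normalized to have mean at most one. -/
lemma measureReal_count_le (S : Finset ι) {A : Set 𝒵} (hA : MeasurableSet A) (c K : ℝ)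
    (E : Set (ι → 𝒵))
    (hE : ∀ z ∈ E, K ≤ c * count S A z - S.card * μ.real A * (Real.exp c - 1)) :
    (Measure.pi fun _ : ι => μ).real E ≤ Real.exp (-K) := by
  set P := Measure.pi fun _ : ι => μ
  set g : (ι → 𝒵) → ℝ := fun z =>
    Real.exp (c * count S A z) * Real.exp (-(S.card * μ.real A * (Real.exp c - 1)))
  have hgi : Integrable g P := by
    refine Integrable.mul_const (Integrable.of_bound (C := Real.exp (|c| * S.card)) ?_ ?_) _
    · exact (((measurable_count S hA).const_mul c).exp).aestronglyMeasurable
    · refine Filter.Eventually.of_forall fun z => ?_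
      rw [Real.norm_eq_abs, Real.abs_exp, Real.exp_le_exp]
      refine (le_abs_self _).trans ?_
      rw [abs_mul, abs_of_nonneg (count_nonneg S A z)]
      exact mul_le_mul_of_nonneg_left (count_le_card S A z) (abs_nonneg _)
  have h1 : ∫ z, g z ∂P ≤ 1 := by
    rw [integral_mul_const]
    have := mul_le_mul_of_nonneg_right (integral_exp_count_le μ S hA c)
      (Real.exp_nonneg (-(S.card * μ.real A * (Real.exp c - 1))))
    rwa [← Real.exp_add, add_neg_cancel, Real.exp_zero] at this
  have h2 := mul_meas_ge_le_integral_of_nonneg (μ := P)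
    (Filter.Eventually.of_forall fun z => by positivity : 0 ≤ᵐ[P] g) hgi (Real.exp K)
  have h3 : P.real E ≤ P.real {z | Real.exp K ≤ g z} := by
    refine measureReal_mono fun z hz => ?_
    simp only [Set.mem_ofPred_eq, g, ← Real.exp_add, Real.exp_le_exp]
    linarith [hE z hz]
  rw [Real.exp_neg, ← one_div, le_div_iff₀ (Real.exp_pos K)]
  nlinarith [Real.exp_pos K]

/-- With the tilt 0.015 and `exp 0.015 - 1 ≤ 0.015225`, the exponent is at least `(0.015 - 0.97 *
0.015225)` times the count, which is more than `1 / 5000` of it. -/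
lemma measureReal_count_large_le (S : Finset ι) {A : Set 𝒵} (hA : MeasurableSet A) (K : ℝ) :
    (Measure.pi fun _ : ι => μ).real {z | K ≤ count S A z ∧
      S.card * μ.real A < 0.97 * count S A z} ≤ Real.exp (-(K / 5000)) := by
  refine measureReal_count_le μ S hA 0.015 _ _ fun z hz => ?_
  obtain ⟨h1, h2⟩ := hz
  have h := Real.abs_exp_sub_one_sub_id_le (x := 0.015) (by norm_num [abs_le])
  rw [abs_le] at h
  have hc := count_nonneg S A z
  have h3 : Real.exp 0.015 - 1 ≤ 0.015225 := by linarith [h.2]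
  have h0 : 0 ≤ (S.card : ℝ) * μ.real A := by positivity
  nlinarith

/-- The opposite tilt: `exp (-0.015) - 1 ≤ -0.014775`, and `1.03 * 0.014775 - 0.015` exceeds `1 /
5000`. -/
lemma measureReal_count_small_le (S : Finset ι) {A : Set 𝒵} (hA : MeasurableSet A) (K : ℝ) :
    (Measure.pi fun _ : ι => μ).real {z | 1.03 * max (count S A z) K < S.card * μ.real A}
      ≤ Real.exp (-(K / 5000)) := by
  refine measureReal_count_le μ S hA (-0.015) _ _ fun z hz => ?_
  have hz' : 1.03 * max (count S A z) K < S.card * μ.real A := hz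
  have h := Real.abs_exp_sub_one_sub_id_le (x := -0.015) (by norm_num [abs_le])
  rw [abs_le] at h
  have h3 : Real.exp (-0.015) - 1 ≤ -0.014775 := by linarith [h.2]
  have h0 : 0 ≤ (S.card : ℝ) * μ.real A := by positivity
  have h1 := le_max_left (count S A z) K
  have h2 := le_max_right (count S A z) K
  have hc := count_nonneg S A z
  nlinarith

end Binomial

/-! ### From grid boxes to all boxes -/

section Grid

variable {d : ℕ}

/-- The open axis-aligned box. -/
def openBox (lo hi : Fin d → ℝ) : Set (Vec d) := {y | ∀ k, lo k < y k ∧ y k < hi k}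

/-- The empirical distribution of the points `X i`, `i ∈ S`, agrees with `cubeLaw f` up to five
percent on all boxes that contain at least `K` of the points. -/
def RegularSample {ι : Type*} (f : Vec d → ℝ) (S : Finset ι) (K : ℝ)
    (X : ι → Vec d) : Prop :=
  ∀ lo hi : Fin d → ℝ, (∀ k, 0 ≤ lo k) → (∀ k, lo k ≤ hi k) → (∀ k, hi k ≤ 1) →
    (K ≤ count S (box lo hi) X →
      0.95 * count S (box lo hi) X ≤ S.card * (cubeLaw f).real (box lo hi)) ∧
    S.card * (cubeLaw f).real (box lo hi) ≤ 1.05 * max (count S (openBox lo hi) X) K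

/-- The box whose corners are points of the grid of mesh `1 / m`. -/
noncomputable def gridBox (m : ℕ) (q : (Fin d → Fin (m + 2)) × (Fin d → Fin (m + 2))) :
    Set (Vec d) :=
  box (fun k => (q.1 k : ℕ) / (m : ℝ)) (fun k => (q.2 k : ℕ) / (m : ℝ))

/-- Nested boxes whose faces are at distance at most `1 / m` differ by `2 * d` slabs of mass at most
`κ / m` each. Multiplied by `m`, the loss does not depend on the sample size. -/
lemma measureReal_le_add_slabs {f : Vec d → ℝ} (hf : ContinuousOn f (cube d))
    [IsProbabilityMeasure (cubeLaw f)] {κ : ℝ} (hκ : 0 ≤ κ)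
    (hfκ : ∀ y ∈ cube d, ∀ y' ∈ cube d, f y ≤ κ * f y') {m : ℕ} (hm : 0 < m)
    {a a' b b' : Fin d → ℝ} (ha : ∀ k, a k ≤ a' k) (hb : ∀ k, b' k ≤ b k)
    (ha' : ∀ k, a' k ≤ a k + 1 / m) (hb' : ∀ k, b k ≤ b' k + 1 / m) :
    m * (cubeLaw f).real (box a b) ≤ m * (cubeLaw f).real (box a' b') + 2 * d * κ := by
  set slab : Fin d → ℝ → ℝ → Set (Vec d) := fun k u v => {y ∈ cube d | u ≤ y k ∧ y k ≤ v}
  have hm' : (0 : ℝ) < m := Nat.cast_pos.2 hm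
  have hsub : box a b ∩ cube d ⊆ box a' b' ∪
      ⋃ k ∈ (Finset.univ : Finset (Fin d)), (slab k (a k) (a' k) ∪ slab k (b' k) (b k)) := by
    rintro y ⟨hy, hyc⟩
    by_cases h : y ∈ box a' b'
    · exact Or.inl h
    · right
      simp only [box, Set.mem_ofPred_eq, not_forall, not_and_or, not_le] at h
      obtain ⟨k, hk | hk⟩ := h
      · exact Set.mem_iUnion₂.2 ⟨k, Finset.mem_univ k, Or.inl ⟨hyc, (hy k).1, hk.le⟩⟩
      · exact Set.mem_iUnion₂.2 ⟨k, Finset.mem_univ k, Or.inr ⟨hyc, hk.le, (hy k).2⟩⟩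
  have h0 : (cubeLaw f).real (box a b) = (cubeLaw f).real (box a b ∩ cube d) := by
    have h1 : cubeLaw f (cube d)ᶜ = 0 := (prob_compl_eq_zero_iff measurableSet_cube).2 (by
      have := cubeLaw_cube f
      rwa [Measure.real, ENNReal.toReal_eq_one_iff] at this)
    have := measure_inter_add_sdiff (μ := cubeLaw f) (box a b) (measurableSet_cube (d := d))
    rw [measure_mono_null (t := (cube d)ᶜ) (s := box a b \ cube d) (fun y hy => hy.2) h1, add_zero] at this
    rw [Measure.real, Measure.real, this]
  have h1 : (cubeLaw f).real (box a b) ≤ (cubeLaw f).real (box a' b') +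
      ∑ k : Fin d, (κ * (1 / m) + κ * (1 / m)) := by
    rw [h0]
    refine (measureReal_mono hsub).trans ((measureReal_union_le _ _).trans ?_)
    gcongr
    refine (measureReal_biUnion_finset_le _ _).trans (Finset.sum_le_sum fun k _ => ?_)
    refine (measureReal_union_le _ _).trans (add_le_add ?_ ?_)
    · refine (cubeLaw_slab_le hf hκ hfκ k (ha k)).trans ?_
      gcongr
      linarith [ha' k]
    · refine (cubeLaw_slab_le hf hκ hfκ k (hb k)).trans ?_
      gcongr
      linarith [hb' k]
  have h2 := mul_le_mul_of_nonneg_left h1 hm'.le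
  refine h2.trans (le_of_eq ?_)
  rw [Finset.sum_const, Finset.card_univ, Fintype.card_fin, nsmul_eq_mul]
  field_simp
  ring

/-- With mesh `1 / S.card`, rounding the corners costs `2 * d * κ`, at most two percent of `K`; this
turns 0.97 into 0.95 and 1.03 into 1.05. -/
lemma regularSample_of_grid {ι : Type*} {f : Vec d → ℝ}
    (hf : ContinuousOn f (cube d)) [IsProbabilityMeasure (cubeLaw f)] {κ : ℝ} (hκ : 0 ≤ κ)
    (hfκ : ∀ y ∈ cube d, ∀ y' ∈ cube d, f y ≤ κ * f y') {S : Finset ι} (hS : S.Nonempty)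
    {K : ℝ} (hK : 2 * d * κ ≤ 0.02 * K) {X : ι → Vec d}
    (h1 : ∀ q, K ≤ count S (gridBox S.card q) X →
      0.97 * count S (gridBox S.card q) X ≤ S.card * (cubeLaw f).real (gridBox S.card q))
    (h2 : ∀ q, S.card * (cubeLaw f).real (gridBox S.card q) ≤
      1.03 * max (count S (gridBox S.card q) X) K) :
    RegularSample f S K X := by
  intro lo hi hlo hlh hhi
  set m := S.card
  have hm : 0 < m := hS.card_pos
  have hm' : (0 : ℝ) < m := Nat.cast_pos.2 hm
  have hhi0 : ∀ k, 0 ≤ hi k * m := fun k => mul_nonneg ((hlo k).trans (hlh k)) hm'.le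
  have hlo0 : ∀ k, 0 ≤ lo k * m := fun k => mul_nonneg (hlo k) hm'.le
  have hfl : ∀ k, ⌊lo k * m⌋₊ ≤ m := fun k => by
    refine Nat.floor_le_of_le ?_
    have := (hlh k).trans (hhi k); nlinarith
  have hce : ∀ k, ⌈hi k * m⌉₊ ≤ m := fun k => by
    refine Nat.ceil_le.2 ?_
    have := hhi k; nlinarith
  constructor
  · intro hcount
    -- Outward rounding: the count can only grow, and the mass grows by little.
    set q : (Fin d → Fin (m + 2)) × (Fin d → Fin (m + 2)) :=
      (fun k => ⟨⌊lo k * m⌋₊, by have := hfl k; omega⟩, fun k => ⟨⌈hi k * m⌉₊, by have := hce k; omega⟩)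
    have ha : ∀ k, (⌊lo k * m⌋₊ : ℝ) / m ≤ lo k := fun k => by
      rw [div_le_iff₀ hm']; exact Nat.floor_le (hlo0 k)
    have hb : ∀ k, hi k ≤ (⌈hi k * m⌉₊ : ℝ) / m := fun k => by
      rw [le_div_iff₀ hm']; exact Nat.le_ceil _
    have hsub : box lo hi ⊆ gridBox m q := fun y hy k =>
      ⟨(ha k).trans (hy k).1, (hy k).2.trans (hb k)⟩
    have hc := count_mono S hsub X
    have h3 := h1 q (hcount.trans hc)
    have h4 := measureReal_le_add_slabs hf hκ hfκ hm (a := fun k => (⌊lo k * m⌋₊ : ℝ) / m)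
      (b := fun k => (⌈hi k * m⌉₊ : ℝ) / m) ha hb
      (fun k => by
        rw [← add_div, le_div_iff₀ hm']; exact (Nat.lt_floor_add_one _).le)
      (fun k => by
        rw [div_le_iff₀ hm', add_mul, one_div_mul_cancel hm'.ne']
        exact (Nat.ceil_lt_add_one (hhi0 k)).le)
    change 0.97 * count S (gridBox m q) X ≤ m * (cubeLaw f).real (gridBox m q) at h3
    change m * (cubeLaw f).real (gridBox m q) ≤ _ at h4
    linarith
  -- Inward rounding, strict so that the grid box lies in the open box. The lower index can reach `m
  -- + 1`, hence `m + 2` grid points per axis.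
  · set q : (Fin d → Fin (m + 2)) × (Fin d → Fin (m + 2)) :=
      (fun k => ⟨⌊lo k * m⌋₊ + 1, by have := hfl k; omega⟩,
        fun k => ⟨⌈hi k * m⌉₊ - 1, by have := hce k; omega⟩)
    have ha : ∀ k, lo k < ((⌊lo k * m⌋₊ + 1 : ℕ) : ℝ) / m := fun k => by
      rw [lt_div_iff₀ hm']; push_cast; exact Nat.lt_floor_add_one _
    -- If `hi k = 0`, the truncated subtraction gives `0`; the grid box is then empty, since its
    -- lower ends are positive.
    have hb0 : ∀ k, ((⌈hi k * m⌉₊ - 1 : ℕ) : ℝ) / m < hi k ∨ ⌈hi k * m⌉₊ = 0 := fun k => by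
      rcases Nat.eq_zero_or_pos ⌈hi k * m⌉₊ with h | h
      · exact Or.inr h
      · left
        rw [div_lt_iff₀ hm']
        exact Nat.lt_ceil.1 (Nat.sub_lt h one_pos)
    have hb : ∀ k, ((⌈hi k * m⌉₊ - 1 : ℕ) : ℝ) / m ≤ hi k := fun k => by
      rcases hb0 k with h | h
      · exact h.le
      · rw [h]; simpa using (hlo k).trans (hlh k)
    have hsub : gridBox m q ⊆ openBox lo hi := fun y hy k => by
      refine ⟨(ha k).trans_le (hy k).1, ?_⟩
      rcases hb0 k with h | h
      · exact (hy k).2.trans_lt h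
      · have h5 : y k ≤ ((⌈hi k * m⌉₊ - 1 : ℕ) : ℝ) / m := (hy k).2
        have h6 : ((⌊lo k * m⌋₊ + 1 : ℕ) : ℝ) / m ≤ y k := (hy k).1
        rw [h] at h5
        have : (0 : ℝ) < ((⌊lo k * m⌋₊ + 1 : ℕ) : ℝ) / m := by positivity
        simp at h5
        linarith
    have hc := count_mono S hsub X
    have h3 := h2 q
    have h4 := measureReal_le_add_slabs hf hκ hfκ hm (a := lo) (b := hi)
      (a' := fun k => ((⌊lo k * m⌋₊ + 1 : ℕ) : ℝ) / m)
      (b' := fun k => ((⌈hi k * m⌉₊ - 1 : ℕ) : ℝ) / m) (fun k => (ha k).le) hb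
      (fun k => by
        rw [div_le_iff₀ hm', add_mul, one_div_mul_cancel hm'.ne']
        push_cast
        linarith [Nat.floor_le (hlo0 k)])
      (fun k => by
        rw [← add_div, le_div_iff₀ hm']
        have h5 : ⌈hi k * m⌉₊ ≤ (⌈hi k * m⌉₊ - 1) + 1 := by omega
        refine (Nat.le_ceil _).trans ?_
        exact_mod_cast h5)
    change m * (cubeLaw f).real (gridBox m q) ≤ _ at h3
    change _ ≤ m * (cubeLaw f).real (gridBox m q) + _ at h4
    have h5 := max_le_max_right K hc
    have h6 := le_max_right (count S (openBox lo hi) X) K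
    linarith

/-- Outside of an event of small probability, an i.i.d. sample is regular. -/
lemma exists_regularSample {𝒵 ι : Type*} [MeasurableSpace 𝒵] [Fintype ι]
    (μ : Measure 𝒵) [IsProbabilityMeasure μ] {feat : 𝒵 → Vec d} (hfeat : Measurable feat)
    {f : Vec d → ℝ} (hlaw : μ.map feat = cubeLaw f)
    (hf : ContinuousOn f (cube d)) {κ : ℝ} (hκ : 0 ≤ κ)
    (hfκ : ∀ y ∈ cube d, ∀ y' ∈ cube d, f y ≤ κ * f y') {S : Finset ι} (hS : S.Nonempty)
    {K : ℝ} (hK : 2 * d * κ ≤ 0.02 * K) :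
    ∃ Bad : Set (ι → 𝒵), MeasurableSet Bad ∧
      (Measure.pi fun _ : ι => μ).real Bad ≤
        2 * ((S.card + 2 : ℕ) : ℝ) ^ (2 * d) * Real.exp (-(K / 5000)) ∧
      ∀ z ∉ Bad, RegularSample f S K fun i => feat (z i) := by
  have : IsProbabilityMeasure (cubeLaw f) := by
    rw [← hlaw]; exact Measure.isProbabilityMeasure_map hfeat.aemeasurable
  set m := S.card with hmdef
  set Q := (Fin d → Fin (m + 2)) × (Fin d → Fin (m + 2))
  set A : Q → Set 𝒵 := fun q => feat ⁻¹' gridBox m q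
  have hA : ∀ q, MeasurableSet (A q) := fun q => hfeat (measurableSet_box _ _)
  have hμA : ∀ q, μ.real (A q) = (cubeLaw f).real (gridBox m q) := fun q => by
    rw [← hlaw]; exact (map_measureReal_apply hfeat (measurableSet_box _ _)).symm
  have hcount : ∀ q z, count S (A q) z = count S (gridBox m q) fun i => feat (z i) :=
    fun q z => rfl
  set E : Q → Set (ι → 𝒵) := fun q =>
    {z | K ≤ count S (A q) z ∧ S.card * μ.real (A q) < 0.97 * count S (A q) z} ∪
    {z | 1.03 * max (count S (A q) z) K < S.card * μ.real (A q)}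
  -- A union bound over the `(m + 2) ^ (2 * d)` pairs of grid corners.
  refine ⟨⋃ q ∈ (Finset.univ : Finset Q), E q, ?_, ?_, ?_⟩
  · refine Finset.measurableSet_biUnion _ fun q _ => ?_
    have hc := measurable_count S (hA q)
    refine MeasurableSet.union (MeasurableSet.inter ?_ ?_) ?_
    · exact measurableSet_le measurable_const hc
    · exact measurableSet_lt measurable_const (hc.const_mul _)
    · exact measurableSet_lt ((hc.max measurable_const).const_mul _) measurable_const
  · refine (measureReal_biUnion_finset_le _ _).trans ?_
    have : ∀ q ∈ (Finset.univ : Finset Q), (Measure.pi fun _ : ι => μ).real (E q) ≤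
        Real.exp (-(K / 5000)) + Real.exp (-(K / 5000)) := fun q _ =>
      (measureReal_union_le _ _).trans (add_le_add (measureReal_count_large_le μ S (hA q) K)
        (measureReal_count_small_le μ S (hA q) K))
    refine (Finset.sum_le_sum this).trans (le_of_eq ?_)
    rw [Finset.sum_const, Finset.card_univ, nsmul_eq_mul]
    have hQ : Fintype.card Q = (m + 2) ^ (2 * d) := by
      simp [Q, Fintype.card_prod, two_mul, pow_add]
    rw [hQ]
    push_cast
    ring
  · intro z hz
    simp only [Finset.mem_univ, Set.iUnion_true, Set.mem_iUnion, not_exists, E, Set.mem_union,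
      Set.mem_ofPred_eq, not_or, not_and, not_lt] at hz
    refine regularSample_of_grid hf hκ hfκ hS hK (fun q h => ?_) fun q => ?_
    · have := (hz q).1 (by rwa [hcount])
      rwa [hμA] at this
    · have := (hz q).2
      rwa [hμA] at this

end Grid

end ORF

/-! ### Contraction of cells under balanced splits -/

namespace ORF

namespace SplitTree

variable {d : ℕ}

/-- The length, along feature `j`, of the cell with reversed address `u`. -/
noncomputable def len (t : SplitTree d) (j : Fin d) (u : List Bool) : ℝ := t.upper j u - t.lower j u

open Classical in
/-- The number of points `X i`, `i ∈ S`, in the cell with reversed address `u`. -/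
noncomputable def cellCount {ι : Type*} (t : SplitTree d) (X : ι → Vec d) (S : Finset ι)
    (u : List Bool) : ℝ := ((S.filter fun i => t.OnPath (X i) u).card : ℝ)

variable {ι : Type*} {t : SplitTree d} {X : ι → Vec d} {S : Finset ι}

lemma count_openBox_le_cellCount {x : Vec d} {u : List Bool} (hx : t.OnPath x u) :
    count S (openBox (fun k => t.lower k u) (fun k => t.upper k u)) X ≤ t.cellCount X S u := by
  classical
  refine Nat.cast_le.2 (Finset.card_le_card fun i => ?_)
  simp only [Finset.mem_filter]
  exact fun hi => ⟨hi.1, onPath_of_mem_Ioo hx hi.2⟩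

lemma cellCount_le_count_box (hX : ∀ i, X i ∈ cube d) (u : List Bool) :
    t.cellCount X S u ≤ count S (box (fun k => t.lower k u) (fun k => t.upper k u)) X := by
  classical
  refine Nat.cast_le.2 (Finset.card_le_card fun i => ?_)
  simp only [Finset.mem_filter]
  exact fun hi => ⟨hi.1, fun k => hi.2.mem_Icc (hX i) k⟩

lemma exists_onPath_of_cellCount_pos {u : List Bool} (h : 0 < t.cellCount X S u) :
    ∃ i ∈ S, t.OnPath (X i) u := by
  classical
  rw [cellCount, Nat.cast_pos, Finset.card_pos] at h
  obtain ⟨i, hi⟩ := h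
  rw [Finset.mem_filter] at hi
  exact ⟨i, hi⟩

/-- A split along `j` shrinks the length of the cell along `j`. -/
lemma len_cons_le {f : Vec d → ℝ} (hf : ContinuousOn f (cube d))
    [IsProbabilityMeasure (cubeLaw f)] {K ρ κ : ℝ} (hK : 0 < K) (hρ : 0 < ρ)
    (hreg : RegularSample f S K X) (hX : ∀ i, X i ∈ cube d) (hbal : t.Balanced ρ X S)
    {x : Vec d} (hx : x ∈ cube d) {u : List Bool} (hxu : t.OnPath x u) {j : Fin d}
    (hj : t.splitDir u.reverse = some j) (hN : K ≤ ρ * t.cellCount X S u)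
    (hρ1 : ρ ≤ 1) (hκ : 0 < κ)
    (hfκ : ∀ y ∈ cube d, ∀ y' ∈ cube d, (∀ k, k ≠ j → y k = y' k) →
      |y j - y' j| ≤ t.len j u → f y ≤ κ * f y') (b : Bool) :
    t.len j (b :: u) ≤ (1 - 0.9 * ρ / κ) * t.len j u := by
  set m : ℝ := (S.card : ℝ)
  set N := t.cellCount X S u
  have hN0 : 0 < N := by
    by_contra h
    push Not at h
    nlinarith
  have hchild : ∀ b', ρ * N ≤ t.cellCount X S (b' :: u) := fun b' =>
    hbal.le_card (by rw [hj]; simp) b'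
  have hpt : ∀ b', ∃ i, t.OnPath (X i) (b' :: u) := fun b' =>
    (exists_onPath_of_cellCount_pos (lt_of_lt_of_le (hK.trans_le hN) (hchild b'))).imp
      fun i hi => hi.2
  set c := t.splitThr u.reverse
  set lo : Fin d → ℝ := fun k => t.lower k u
  set hi : Fin d → ℝ := fun k => t.upper k u
  have hloc : lo j ≤ c := by
    obtain ⟨i, hi1, j', hj', hb'⟩ := hpt false
    obtain rfl : j' = j := by rw [hj] at hj'; exact (Option.some.inj hj').symm
    refine (hi1.mem_Icc (hX i) j').1.trans (not_lt.1 fun h => ?_)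
    simpa using hb'.2 h
  have hhic : c ≤ hi j := by
    obtain ⟨i, hi1, j', hj', hb'⟩ := hpt true
    obtain rfl : j' = j := by rw [hj] at hj'; exact (Option.some.inj hj').symm
    exact (hb'.1 rfl).le.trans (hi1.mem_Icc (hX i) j').2
  have hlohi : ∀ k, lo k ≤ hi k := fun k => (hxu.mem_Icc hx k).1.trans (hxu.mem_Icc hx k).2
  have hl0 : ∀ v k, 0 ≤ t.lower k v := fun v k => t.lower_nonneg k v
  have hu1 : ∀ v k, t.upper k v ≤ 1 := fun v k => t.upper_le_one k v
  -- The parent is bounded from above through its open box and the children from below through their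
  -- closed boxes, so points on the boundary need no attention.
  have hparent : m * (cubeLaw f).real (box lo hi) ≤ 1.05 * N := by
    refine ((hreg lo hi (hl0 u) hlohi (hu1 u)).2).trans ?_
    have h1 := count_openBox_le_cellCount (S := S) (X := X) hxu
    have h2 : K ≤ N := by nlinarith
    gcongr
    exact max_le h1 h2
  -- mass of the children
  have hmass : ∀ b', 0.95 * (ρ * N) ≤ m * (cubeLaw f).real
      (box (fun k => t.lower k (b' :: u)) (fun k => t.upper k (b' :: u))) := by
    intro b'
    obtain ⟨i, hi1⟩ := hpt b'
    have h1 := cellCount_le_count_box (t := t) (S := S) hX (b' :: u)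
    have h2 := hchild b'
    have h3 := (hreg (fun k => t.lower k (b' :: u)) (fun k => t.upper k (b' :: u)) (hl0 _)
      (fun k => (hi1.mem_Icc (hX i) k).1.trans (hi1.mem_Icc (hX i) k).2) (hu1 _)).1
      (hN.trans (h2.trans h1))
    linarith
  have hfκ' : ∀ y ∈ box lo hi, ∀ y' ∈ box lo hi, (∀ k, k ≠ j → y k = y' k) →
      f y ≤ κ * f y' := fun y hy y' hy' h => by
    refine hfκ y (box_subset_cube (hl0 u) (hu1 u) hy) y' (box_subset_cube (hl0 u) (hu1 u) hy') h ?_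
    have h1 := hy j; have h2 := hy' j
    rw [abs_le, len]
    constructor <;> linarith [h1.1, h1.2, h2.1, h2.2]
  have hm : 0 < m := by
    obtain ⟨i, hi, -⟩ := exists_onPath_of_cellCount_pos hN0
    exact Nat.cast_pos.2 (Finset.card_pos.2 ⟨i, hi⟩)
  -- the length of a sub-interval whose box has a large mass
  have key : ∀ a b', lo j ≤ a → a ≤ b' → b' ≤ hi j →
      0.95 * (ρ * N) ≤ m * (cubeLaw f).real
        (box (Function.update lo j a) (Function.update hi j b')) →
      0.9 * ρ / κ * (hi j - lo j) ≤ b' - a := by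
    intro a b' h1 h2 h3 h4
    have h5 := cubeLaw_box_ratio_real hf (hl0 u) (hu1 u) h1 h3 (hlohi j) h2 hκ.le hfκ'
    have h6 : (hi j - lo j) * (0.95 * (ρ * N)) ≤ κ * (b' - a) * (1.05 * N) := by
      calc (hi j - lo j) * (0.95 * (ρ * N)) ≤ (hi j - lo j) * (m * (cubeLaw f).real
            (box (Function.update lo j a) (Function.update hi j b'))) :=
            mul_le_mul_of_nonneg_left h4 (sub_nonneg.2 (hlohi j))
        _ = m * ((hi j - lo j) * (cubeLaw f).real
            (box (Function.update lo j a) (Function.update hi j b'))) := by ring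
        _ ≤ m * (κ * (b' - a) * (cubeLaw f).real (box lo hi)) :=
            mul_le_mul_of_nonneg_left h5 hm.le
        _ = κ * (b' - a) * (m * (cubeLaw f).real (box lo hi)) := by ring
        _ ≤ _ := mul_le_mul_of_nonneg_left hparent (mul_nonneg hκ.le (sub_nonneg.2 h2))
    have h7 : (hi j - lo j) * (0.95 * ρ) ≤ κ * (b' - a) * 1.05 := by
      refine le_of_mul_le_mul_right ?_ hN0
      linarith
    -- What remains is `0.9 * 1.05 ≤ 0.95`.
    rw [div_mul_eq_mul_div, div_le_iff₀ hκ]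
    have h8 : 0 ≤ (hi j - lo j) * ρ := mul_nonneg (sub_nonneg.2 (hlohi j)) hρ.le
    nlinarith
  have hlow : ∀ b' : Bool, (fun k => t.lower k (b' :: u)) =
      Function.update lo j (if b' then c else lo j) := by
    intro b'
    funext k
    by_cases hk : k = j
    · subst hk
      cases b'
      · simp [lower, lo]
      · have h : max (t.lower k u) (t.splitThr u.reverse) = c := max_eq_right hloc
        simpa [lower, hj] using h
    · have : ¬ t.splitDir u.reverse = some k := by rw [hj]; simpa using Ne.symm hk
      simp [lower, this, hk, lo]
  have hupp : ∀ b' : Bool, (fun k => t.upper k (b' :: u)) =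
      Function.update hi j (if b' then hi j else c) := by
    intro b'
    funext k
    by_cases hk : k = j
    · subst hk
      cases b'
      · have h : min (t.upper k u) (t.splitThr u.reverse) = c := min_eq_right hhic
        simpa [upper, hj] using h
      · simp [upper, hi]
    · have : ¬ t.splitDir u.reverse = some k := by rw [hj]; simpa using Ne.symm hk
      simp [upper, this, hk, hi]
  have hlen : t.len j (b :: u) = (if b then hi j else c) - (if b then c else lo j) := by
    have h1 := congrFun (hlow b) j
    have h2 := congrFun (hupp b) j
    simp only [Function.update_self] at h1 h2
    rw [len, h1, h2]
  have hlen' : t.len j u = hi j - lo j := rfl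
  rw [hlen, hlen']
  -- A child is shorter than its parent by the length of its sibling, so the lower bound on mass is
  -- applied to the sibling.
  cases b
  · have h := key c (hi j) hloc hhic le_rfl (by
      have := hmass true
      rw [hlow, hupp] at this
      simpa using this)
    simp only [Bool.false_eq_true, if_false]
    linarith
  · have h := key (lo j) c le_rfl hloc hhic (by
      have := hmass false
      rw [hlow, hupp] at this
      simpa using this)
    simp only [if_true]
    linarith

lemma len_cons_eq_of_ne {u : List Bool} {j : Fin d} (hj : t.splitDir u.reverse ≠ some j)
    (b : Bool) : t.len j (b :: u) = t.len j u := by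
  simp [len, lower, upper, hj]

/-- A weighted length on which every split along `j` acts as a contraction with a factor that does
not depend on the density. -/
noncomputable def potential (A l : ℝ) : ℝ := l * Real.exp (A * l)

lemma le_potential {A l : ℝ} (hA : 0 ≤ A) (hl : 0 ≤ l) : l ≤ potential A l := by
  have : 1 ≤ Real.exp (A * l) := Real.one_le_exp (by positivity)
  rw [potential]; nlinarith

/-- Two regimes. Along cells of length at most `ε` the density is constant up to the factor 1.1, and
`0.9 / 1.1 ≥ 0.8` contracts the length itself. Longer cells lose at least `η * ε`, where `η`
involves the global density ratio, and `A` is chosen so that `exp (-(A * (η * ε))) = 1 - 0.8 * ρ`: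
there the exponential weight alone provides the factor. -/
lemma exists_potential {f : Vec d → ℝ} (hf : ContinuousOn f (cube d)) {fmin fmax : ℝ}
    (hfmin : 0 < fmin) (hfb : ∀ y ∈ cube d, fmin ≤ f y ∧ f y ≤ fmax) {ρ : ℝ} (hρ : 0 < ρ)
    (hρ' : ρ ≤ 0.2) :
    ∃ A, 0 ≤ A ∧ ∀ (ι : Type) (t : SplitTree d) (X : ι → Vec d) (S : Finset ι),
      IsProbabilityMeasure (cubeLaw f) → ∀ K : ℝ, 0 < K →
      RegularSample f S K X → (∀ i, X i ∈ cube d) → t.Balanced ρ X S →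
      ∀ x ∈ cube d, ∀ u, t.OnPath x u → ∀ j, t.splitDir u.reverse = some j →
      K ≤ ρ * t.cellCount X S u → ∀ b,
        potential A (t.len j (b :: u)) ≤ (1 - 0.8 * ρ) * potential A (t.len j u) := by
  have hunif := isCompact_cube.uniformContinuousOn_of_continuous hf
  rw [Metric.uniformContinuousOn_iff_le] at hunif
  obtain ⟨ε, hε, hunif⟩ := hunif (0.1 * fmin) (by positivity)
  set κ : ℝ := max (fmax / fmin) 1
  have hκ : 0 < κ := lt_of_lt_of_le one_pos (le_max_right _ _)
  have hglob : ∀ y ∈ cube d, ∀ y' ∈ cube d, f y ≤ κ * f y' := by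
    intro y hy y' hy'
    calc f y ≤ fmax := (hfb y hy).2
      _ = fmax / fmin * fmin := by field_simp
      _ ≤ κ * fmin := mul_le_mul_of_nonneg_right (le_max_left _ _) hfmin.le
      _ ≤ κ * f y' := mul_le_mul_of_nonneg_left (hfb y' hy').1 hκ.le
  have hloc : ∀ j, ∀ y ∈ cube d, ∀ y' ∈ cube d, (∀ k, k ≠ j → y k = y' k) → |y j - y' j| ≤ ε →
      f y ≤ 1.1 * f y' := by
    intro j y hy y' hy' h h'
    have hd : dist y y' ≤ ε := by
      rw [EuclideanSpace.dist_eq, Finset.sum_eq_single j]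
      · rw [Real.sqrt_sq dist_nonneg, Real.dist_eq]; exact h'
      · intro k _ hk; simp [h k hk]
      · simp
    have := hunif y hy y' hy' hd
    rw [Real.dist_eq, abs_le] at this
    linarith [(hfb y' hy').1]
  set η := 0.9 * ρ / κ with hη
  have hη0 : 0 < η := by positivity
  have h8 : 0 < 1 - 0.8 * ρ := by linarith
  set A := -Real.log (1 - 0.8 * ρ) / (η * ε) with hAdef
  have hlog : Real.log (1 - 0.8 * ρ) ≤ 0 := Real.log_nonpos h8.le (by linarith)
  have hA : 0 ≤ A := div_nonneg (by linarith) (by positivity)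
  refine ⟨A, hA, ?_⟩
  intro ι t X S hprob K hK hreg hX hbal x hx u hxu j hj hN b
  have hl : 0 ≤ t.len j u :=
    sub_nonneg.2 ((hxu.mem_Icc hx j).1.trans (hxu.mem_Icc hx j).2)
  have h1 := len_cons_le hf hK hρ hreg hX hbal hx hxu hj hN (by linarith) hκ
    (fun y hy y' hy' _ _ => hglob y hy y' hy') b
  set l := t.len j u
  set l' := t.len j (b :: u)
  rw [← hη] at h1
  unfold potential
  rcases le_or_gt l ε with hle | hgt
  · have h2 := len_cons_le hf hK hρ hreg hX hbal hx hxu hj hN (by linarith) (κ := 1.1) (by norm_num)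
      (fun y hy y' hy' h h' => hloc j y hy y' hy' h (h'.trans hle)) b
    have h3 : l' ≤ (1 - 0.8 * ρ) * l := by
      refine h2.trans (mul_le_mul_of_nonneg_right ?_ hl)
      rw [sub_le_sub_iff_left, le_div_iff₀ (by norm_num)]
      linarith
    have h4 : l' ≤ l := h3.trans (by nlinarith)
    have h5 : Real.exp (A * l') ≤ Real.exp (A * l) :=
      Real.exp_le_exp.2 (mul_le_mul_of_nonneg_left h4 hA)
    calc l' * Real.exp (A * l') ≤ ((1 - 0.8 * ρ) * l) * Real.exp (A * l') :=
          mul_le_mul_of_nonneg_right h3 (Real.exp_pos _).le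
      _ ≤ ((1 - 0.8 * ρ) * l) * Real.exp (A * l) :=
          mul_le_mul_of_nonneg_left h5 (by positivity)
      _ = _ := by ring
  · have h4 : l' ≤ l - η * ε := by nlinarith
    have h6 : l' ≤ l := by nlinarith [mul_pos hη0 hε]
    have h5 : Real.exp (A * l') ≤ (1 - 0.8 * ρ) * Real.exp (A * l) := by
      nth_rewrite 1 [← Real.exp_log h8]
      rw [← Real.exp_add, Real.exp_le_exp]
      have : A * (η * ε) = -Real.log (1 - 0.8 * ρ) := by
        rw [hAdef]; field_simp
      nlinarith [mul_le_mul_of_nonneg_left h4 hA]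
    calc l' * Real.exp (A * l') ≤ l * Real.exp (A * l') :=
          mul_le_mul_of_nonneg_right h6 (Real.exp_pos _).le
      _ ≤ l * ((1 - 0.8 * ρ) * Real.exp (A * l)) := mul_le_mul_of_nonneg_left h5 hl
      _ = _ := by ring

lemma Balanced.pow_mul_le_cellCount {ρ : ℝ} (hρ : 0 ≤ ρ) (h : t.Balanced ρ X S) {x : Vec d}
    {u : List Bool} (hx : t.OnPath x u) :
    ρ ^ u.length * S.card ≤ t.cellCount X S u := by
  induction u with
  | nil =>
    have : t.cellCount X S [] = S.card := by
      classical
      exact congrArg (fun s => ((Finset.card s : ℕ) : ℝ)) (Finset.filter_true_of_mem fun _ _ => trivial)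
    simp [this]
  | cons b u ih =>
    obtain ⟨hu, j, hj, -⟩ := hx
    refine le_trans ?_ (h.le_card (u := u) (by rw [hj]; simp) b)
    rw [List.length_cons, pow_succ, mul_comm _ ρ, mul_assoc]
    exact mul_le_mul_of_nonneg_left (ih hu) hρ

/-! The expected length of the leaf -/

open Classical in
/-- The potential of the cell with reversed address `u`, if `x` belongs to it. -/
noncomputable def cellPot (A : ℝ) (x : Vec d) (j : Fin d) (u : List Bool) (t : SplitTree d) :
    ENNReal :=
  if t.OnPath x u then ENNReal.ofReal (potential A (t.len j u)) else 0

/-- The total potential of the descendants, `n` generations below, of the cell with reversed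
address `u`. -/
noncomputable def descPot (A : ℝ) (x : Vec d) (j : Fin d) : ℕ → List Bool → SplitTree d → ENNReal
  | 0, u, t => cellPot A x j u t
  | n + 1, u, t => descPot A x j n (true :: u) t + descPot A x j n (false :: u) t

lemma measurable_cellPot (A : ℝ) (x : Vec d) (j : Fin d) (u : List Bool) :
    Measurable[historySigma u.reverse] (cellPot A x j u) := by
  classical
  unfold cellPot
  refine Measurable.ite (measurableSet_onPath x u) ?_ measurable_const
  have : Measurable[historySigma u.reverse] fun t : SplitTree d => t.len j u :=
    (measurable_upper j u).sub (measurable_lower j u)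
  unfold potential
  exact ((this.mul ((this.const_mul A).exp)).ennreal_ofReal)

lemma measurable_descPot (A : ℝ) (x : Vec d) (j : Fin d) (n : ℕ) (u : List Bool) :
    Measurable (descPot A x j n u) := by
  induction n generalizing u with
  | zero => exact (measurable_cellPot A x j u).mono (historySigma_le _) le_rfl
  | succ n ih => exact (ih _).add (ih _)

/-- The leaf lies in every cell on the path of `x`, so its extent is at most the length of the cell
met `n` generations below. Summing over all descendants keeps the addresses deterministic. -/
lemma le_descPot {A : ℝ} (hA : 0 ≤ A) {x y : Vec d} (hx : x ∈ cube d) (hy : y ∈ cube d)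
    (hyx : y ∈ t.leafOf x) (j : Fin d) {c₀ : ℕ}
    (hsplit : ∀ u, u.length < c₀ → t.OnPath x u → t.splitDir u.reverse ≠ none) (n : ℕ)
    {u : List Bool} (hu : t.OnPath x u) (hn : u.length + n ≤ c₀) :
    ENNReal.ofReal |y j - x j| ≤ descPot A x j n u t := by
  classical
  induction n generalizing u with
  | zero =>
    rw [descPot, cellPot, if_pos hu]
    have h1 := hu.mem_Icc hx j
    have h2 := ((mem_leafOf_iff t x y).1 hyx u hu).mem_Icc hy j
    refine ENNReal.ofReal_le_ofReal (le_trans ?_ (le_potential hA ?_))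
    · rw [abs_le, len]; constructor <;> linarith [h1.1, h1.2, h2.1, h2.2]
    · exact sub_nonneg.2 (h1.1.trans h1.2)
  | succ n ih =>
    obtain ⟨i, hi⟩ := Option.ne_none_iff_exists'.1 (hsplit u (by omega) hu)
    rw [descPot]
    by_cases hc : t.splitThr u.reverse < x i
    · refine (ih (u := true :: u) ⟨hu, i, hi, by simpa using hc⟩ (by simp; omega)).trans ?_
      exact le_self_add
    · refine (ih (u := false :: u) ⟨hu, i, hi, by simpa using hc⟩ (by simp; omega)).trans ?_
      exact le_add_self

/-- At most one child is on the path of `x`. A split along another feature keeps the length, a split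
along `j` gains the factor `1 - η`. The gain is written as an added term because subtraction in
`ENNReal` is truncated. -/
lemma cellPot_children_le {A η : ℝ} (hη : 0 ≤ η) (hη1 : η ≤ 1) {x : Vec d}
    {j : Fin d} {u : List Bool} (hx : x ∈ cube d)
    (hs : t.OnPath x u → t.splitDir u.reverse = some j → ∀ b,
      potential A (t.len j (b :: u)) ≤ (1 - η) * potential A (t.len j u)) :
    cellPot A x j (true :: u) t + cellPot A x j (false :: u) t +
      ENNReal.ofReal η * ({t | t.splitDir u.reverse = some j}.indicator (cellPot A x j u) t) ≤
      cellPot A x j u t := by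
  classical
  by_cases hu : t.OnPath x u
  swap
  · simp [cellPot, OnPath, hu, Set.indicator_apply]
  have hl : 0 ≤ t.len j u :=
    sub_nonneg.2 ((hu.mem_Icc hx j).1.trans (hu.mem_Icc hx j).2)
  have hp0 : 0 ≤ potential A (t.len j u) := mul_nonneg hl (Real.exp_pos _).le
  have hone : ∀ p : ENNReal, (∀ b, t.OnPath x (b :: u) →
      ENNReal.ofReal (potential A (t.len j (b :: u))) ≤ p) →
      cellPot A x j (true :: u) t + cellPot A x j (false :: u) t ≤ p := by
    intro p hp
    by_cases h1 : t.OnPath x (true :: u)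
    · have h2 : ¬ t.OnPath x (false :: u) := by
        rintro ⟨-, i, hi, h⟩
        obtain ⟨-, i', hi', h'⟩ := h1
        obtain rfl : i = i' := by rw [hi] at hi'; exact Option.some.inj hi'
        simp at h h'
        linarith
      simpa [cellPot, h1, h2] using hp true h1
    · by_cases h2 : t.OnPath x (false :: u)
      · simpa [cellPot, h1, h2] using hp false h2
      · simp [cellPot, h1, h2]
  by_cases hj : t.splitDir u.reverse = some j
  · rw [Set.indicator_of_mem (by exact hj)]
    have h2 : cellPot A x j u t = ENNReal.ofReal (1 - η) * cellPot A x j u t +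
        ENNReal.ofReal η * cellPot A x j u t := by
      rw [← add_mul, ← ENNReal.ofReal_add (by linarith) hη]; simp
    conv_rhs => rw [h2]
    gcongr
    refine hone _ fun b _ => ?_
    rw [cellPot, if_pos hu, ← ENNReal.ofReal_mul (by linarith)]
    exact ENNReal.ofReal_le_ofReal (hs hu hj b)
  · rw [Set.indicator_of_notMem (by exact hj), mul_zero, add_zero]
    refine hone _ fun b _ => ?_
    rw [cellPot, if_pos hu, len_cons_eq_of_ne hj]

section RandomTree

variable {Ωt : Type*} [MeasurableSpace Ωt] {ν : Measure Ωt} [IsProbabilityMeasure ν]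
  {T : Ωt → SplitTree d}

/-- The random split property compares two measures on the history σ-algebra, and the comparison
passes to integrals of history-measurable functions. -/
lemma lintegral_splitDir_ge (hT : Measurable T) {q : ℝ} (hq : 0 ≤ q) {v : List Bool} {j : Fin d}
    (h : ∀ A : Set (SplitTree d), MeasurableSet[historySigma v] A →
      q * ν.real {ω | T ω ∈ A ∧ (T ω).splitDir v ≠ none} ≤
        ν.real {ω | T ω ∈ A ∧ (T ω).splitDir v = some j})
    {g : SplitTree d → ENNReal} (hg : Measurable[historySigma v] g) :
    ENNReal.ofReal q * ∫⁻ ω in {ω | (T ω).splitDir v ≠ none}, g (T ω) ∂ν ≤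
      ∫⁻ ω in {ω | (T ω).splitDir v = some j}, g (T ω) ∂ν := by
  have hT' : Measurable[_, historySigma v] T := hT.mono le_rfl (historySigma_le v)
  rw [← @lintegral_map _ _ _ (historySigma v) _ _ _ hg hT',
    ← @lintegral_map _ _ _ (historySigma v) _ _ _ hg hT', ← smul_eq_mul, ← lintegral_smul_measure]
  refine lintegral_mono' (Measure.le_iff.2 fun A hA => ?_) le_rfl
  have hA' : MeasurableSet (T ⁻¹' A) := hT' hA
  rw [Measure.smul_apply, @Measure.map_apply _ _ _ (historySigma v) _ _ hT' _ hA,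
    @Measure.map_apply _ _ _ (historySigma v) _ _ hT' _ hA, Measure.restrict_apply hA',
    Measure.restrict_apply hA', smul_eq_mul]
  have := h A hA
  have h2 := ENNReal.ofReal_le_ofReal this
  rw [ENNReal.ofReal_mul hq, ofReal_measureReal, ofReal_measureReal] at h2
  exact h2

/-- One generation is peeled off at the top. The potential of the cell at `u` depends only on the
history of `u`, so at least the share `q` of its expectation falls on splits along `j`, where the
fraction `η` is lost. -/
lemma lintegral_descPot_le (hT : Measurable T) {q : ℝ} (hq : 0 ≤ q) (hq1 : q ≤ 1) {A η : ℝ}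
    (hη : 0 ≤ η) (hη1 : η ≤ 1) {x : Vec d} (hx : x ∈ cube d) {j : Fin d} {c₀ : ℕ}
    (hrs : ∀ v, ∀ A : Set (SplitTree d), MeasurableSet[historySigma v] A →
      q * ν.real {ω | T ω ∈ A ∧ (T ω).splitDir v ≠ none} ≤
        ν.real {ω | T ω ∈ A ∧ (T ω).splitDir v = some j})
    (hsplit : ∀ᵐ ω ∂ν, ∀ u, u.length < c₀ → (T ω).OnPath x u → (T ω).splitDir u.reverse ≠ none)
    (hs : ∀ᵐ ω ∂ν, ∀ u, u.length < c₀ → (T ω).OnPath x u → (T ω).splitDir u.reverse = some j →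
      ∀ b, potential A ((T ω).len j (b :: u)) ≤ (1 - η) * potential A ((T ω).len j u))
    (hA : 0 ≤ A) (n : ℕ) (u : List Bool) (hn : u.length + n ≤ c₀) :
    ∫⁻ ω, descPot A x j n u (T ω) ∂ν ≤
      ENNReal.ofReal (1 - q * η) ^ n * ∫⁻ ω, cellPot A x j u (T ω) ∂ν := by
  induction n generalizing u with
  | zero => simp [descPot]
  | succ n ih =>
    have hmC : ∀ u, Measurable fun ω => cellPot A x j u (T ω) := fun u =>
      ((measurable_cellPot A x j u).mono (historySigma_le _) le_rfl).comp hT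
    simp only [descPot]
    have hmD : Measurable fun ω => descPot A x j n (true :: u) (T ω) :=
      (measurable_descPot A x j n _).comp hT
    rw [lintegral_add_left hmD]
    refine (add_le_add (ih (true :: u) (by simp; omega)) (ih (false :: u) (by simp; omega))).trans ?_
    rw [← mul_add, pow_succ, mul_assoc]
    gcongr
    -- Finiteness permits the final cancellation in `ENNReal`.
    have hfin : ∫⁻ ω, cellPot A x j u (T ω) ∂ν ≠ ⊤ := by
      refine ne_top_of_le_ne_top (b := ∫⁻ _, ENNReal.ofReal (Real.exp A) ∂ν) (by simp) ?_
      refine lintegral_mono fun ω => ?_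
      rw [cellPot]
      split_ifs with h
      · refine ENNReal.ofReal_le_ofReal ?_
        have h0 := (T ω).lower_nonneg j u
        have h1 := (T ω).upper_le_one j u
        have h3 : (T ω).len j u ≤ 1 := by rw [len]; linarith
        have h2 : 0 ≤ (T ω).len j u :=
          sub_nonneg.2 ((h.mem_Icc hx j).1.trans (h.mem_Icc hx j).2)
        rw [potential]
        calc (T ω).len j u * Real.exp (A * (T ω).len j u) ≤ 1 * Real.exp (A * 1) := by gcongr
          _ = Real.exp A := by simp
      · exact zero_le
    have hmj : MeasurableSet {ω | (T ω).splitDir u.reverse = some j} :=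
      hT (nodeSigma_le _ _ (measurableSet_splitDir u.reverse {some j}))
    have h1 : ∫⁻ ω, (cellPot A x j (true :: u) (T ω) + cellPot A x j (false :: u) (T ω) +
        ENNReal.ofReal η * ({t | t.splitDir u.reverse = some j}.indicator (cellPot A x j u) (T ω)))
        ∂ν ≤ ∫⁻ ω, cellPot A x j u (T ω) ∂ν := by
      refine lintegral_mono_ae ?_
      filter_upwards [hs] with ω hω
      exact cellPot_children_le hη hη1 hx (hω u (by omega))
    have hind : ∀ ω, {t : SplitTree d | t.splitDir u.reverse = some j}.indicator
        (cellPot A x j u) (T ω) = {ω | (T ω).splitDir u.reverse = some j}.indicator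
        (fun ω => cellPot A x j u (T ω)) ω := fun ω => rfl
    simp_rw [hind] at h1
    have hmCC : Measurable fun ω => cellPot A x j (true :: u) (T ω) +
        cellPot A x j (false :: u) (T ω) := (hmC _).add (hmC _)
    rw [lintegral_add_left hmCC, lintegral_add_left (hmC _),
      lintegral_const_mul _ ((hmC u).indicator hmj), lintegral_indicator hmj] at h1
    have h2 := lintegral_splitDir_ge hT hq (hrs u.reverse) (measurable_cellPot A x j u)
    have hmn : MeasurableSet {ω | (T ω).splitDir u.reverse ≠ none} :=
      hT (nodeSigma_le _ _ (measurableSet_splitDir u.reverse {none}ᶜ))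
    -- Almost surely a cell on the path at this depth is split, so the restriction to split nodes
    -- loses nothing.
    have h3 : ∫⁻ ω in {ω | (T ω).splitDir u.reverse ≠ none}, cellPot A x j u (T ω) ∂ν =
        ∫⁻ ω, cellPot A x j u (T ω) ∂ν := by
      rw [← lintegral_indicator hmn]
      refine lintegral_congr_ae ?_
      filter_upwards [hsplit] with ω hω
      by_cases h : (T ω).OnPath x u
      · rw [Set.indicator_of_mem]; exact hω u (by omega) h
      · have : cellPot A x j u (T ω) = 0 := by rw [cellPot, if_neg h]
        rw [Set.indicator_apply, this, ite_self]
    rw [h3] at h2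
    set I := ∫⁻ ω, cellPot A x j u (T ω) ∂ν
    have h4 : (∫⁻ ω, cellPot A x j (true :: u) (T ω) ∂ν +
        ∫⁻ ω, cellPot A x j (false :: u) (T ω) ∂ν) + ENNReal.ofReal (q * η) * I ≤ I := by
      refine le_trans (add_le_add le_rfl ?_) h1
      rw [mul_comm q, ENNReal.ofReal_mul hη, mul_assoc]
      exact mul_le_mul_right h2 _
    have hqη : q * η ≤ 1 := mul_le_one₀ hq1 hη hη1
    have h5 : I = ENNReal.ofReal (1 - q * η) * I + ENNReal.ofReal (q * η) * I := by
      rw [← add_mul, ← ENNReal.ofReal_add (by linarith) (by positivity)]; simp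
    have h6 : ENNReal.ofReal (q * η) * I ≠ ⊤ := ENNReal.mul_ne_top ENNReal.ofReal_ne_top hfin
    refine (ENNReal.add_le_add_iff_right h6).1 (h4.trans ?_)
    exact h5.le

end RandomTree

/-! Weights -/

section Weight

variable {n : ℕ} {Y : Fin n → Vec d} {S2 : Finset (Fin n)}

lemma weight_nonneg (t : SplitTree d) (x : Vec d) (Y : Fin n → Vec d) (S2 : Finset (Fin n))
    (i : Fin n) : 0 ≤ t.weight x Y S2 i := by
  rw [weight]; split_ifs <;> positivity

lemma sum_weight_eq (t : SplitTree d) (x : Vec d) (Y : Fin n → Vec d) (S2 : Finset (Fin n)) :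
    open Classical in
    ∑ i, t.weight x Y S2 i = if (S2.filter fun i' => Y i' ∈ t.leafOf x).card = 0 then 0 else 1 := by
  classical
  simp only [weight]
  rw [← Finset.sum_filter, Finset.sum_const]
  have : (Finset.univ.filter fun i => i ∈ S2 ∧ Y i ∈ t.leafOf x) =
      S2.filter fun i' => Y i' ∈ t.leafOf x := by ext; simp
  rw [this, nsmul_eq_mul]
  split_ifs with h
  · simp [h]
  · field_simp

lemma sum_weight_le_one (t : SplitTree d) (x : Vec d) (Y : Fin n → Vec d)
    (S2 : Finset (Fin n)) : ∑ i, t.weight x Y S2 i ≤ 1 := by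
  rw [sum_weight_eq]; split_ifs <;> simp

lemma LeafSize.sum_weight {r : ℕ} (hr : 1 ≤ r) (h : t.LeafSize r Y S2) (x : Vec d) :
    ∑ i, t.weight x Y S2 i = 1 := by
  rw [sum_weight_eq, if_neg]
  have := h.le_card_leafOf x
  omega

lemma ofReal_sum_weight_le {A : ℝ} (hA : 0 ≤ A) {x : Vec d} (hx : x ∈ cube d)
    (hY : ∀ i, Y i ∈ cube d) (j : Fin d) {c₀ : ℕ}
    (hsplit : ∀ u, u.length < c₀ → t.OnPath x u → t.splitDir u.reverse ≠ none) :
    ENNReal.ofReal (∑ i, t.weight x Y S2 i * |Y i j - x j|) ≤ descPot A x j c₀ [] t := by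
  have h0 := weight_nonneg t x Y S2
  rw [ENNReal.ofReal_sum_of_nonneg fun i _ => mul_nonneg (h0 i) (abs_nonneg _)]
  have h1 : ∀ i ∈ Finset.univ, ENNReal.ofReal (t.weight x Y S2 i * |Y i j - x j|) ≤
      ENNReal.ofReal (t.weight x Y S2 i) * descPot A x j c₀ [] t := by
    intro i _
    by_cases h : Y i ∈ t.leafOf x
    · rw [ENNReal.ofReal_mul (h0 i)]
      gcongr
      exact le_descPot hA hx (hY i) h j hsplit c₀ trivial (by simp)
    · have : t.weight x Y S2 i = 0 := by rw [weight, if_neg]; tauto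
      simp [this]
  refine (Finset.sum_le_sum h1).trans ?_
  rw [← Finset.sum_mul, ← ENNReal.ofReal_sum_of_nonneg fun i _ => h0 i]
  refine mul_le_of_le_one_left zero_le ?_
  exact ENNReal.ofReal_le_one.2 (sum_weight_le_one t x Y S2)

end Weight

end SplitTree

end ORF

/-! ### Disintegration of the law of an observation -/

namespace ORF

namespace MomentModel

variable {d p l k : ℕ} {𝒵 : Type*} [MeasurableSpace 𝒵] (M : MomentModel d p l k 𝒵)

instance : IsMarkovKernel M.condLaw := by unfold condLaw; infer_instance

instance : IsProbabilityMeasure M.law := by unfold law; infer_instance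

lemma ae_condLaw_of_ae_ae {x : Vec d} {p : 𝒵 → Prop} (hp : MeasurableSet {z | p z})
    (h : ∀ᵐ w ∂(M.confKernel x), ∀ᵐ z ∂(M.obsKernel (x, w)), p z) :
    ∀ᵐ z ∂(M.condLaw x), p z := by
  rw [condLaw, Kernel.snd_apply, ae_map_iff measurable_snd.aemeasurable hp]
  exact Kernel.ae_compProd_of_ae_ae (measurable_snd hp) h

lemma ae_condLaw {x : Vec d} (hx : x ∈ cube d) :
    ∀ᵐ z ∂(M.condLaw x), M.feat z = x := by
  refine M.ae_condLaw_of_ae_ae (M.measurable_feat (measurableSet_singleton x)) ?_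
  filter_upwards [M.consistent x hx] with w hw
  filter_upwards [hw] with z hz using hz.1

lemma integral_condLaw {E : Type*} [NormedAddCommGroup E] [NormedSpace ℝ E]
    {x : Vec d} {g : 𝒵 → E} (hg : Integrable g (M.condLaw x)) :
    ∫ z, g z ∂(M.condLaw x) = ∫ w, ∫ z, g z ∂(M.obsKernel (x, w)) ∂(M.confKernel x) := by
  have hg' := hg
  rw [condLaw, Kernel.snd_apply] at hg' ⊢
  rw [integral_map measurable_snd.aemeasurable hg'.aestronglyMeasurable,
    ProbabilityTheory.integral_compProd]
  exact (integrable_map_measure hg'.aestronglyMeasurable measurable_snd.aemeasurable).1 hg'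

lemma lintegral_condLaw {x : Vec d} {g : 𝒵 → ENNReal} (hg : Measurable g) :
    ∫⁻ z, g z ∂(M.condLaw x) = ∫⁻ w, ∫⁻ z, g z ∂(M.obsKernel (x, w)) ∂(M.confKernel x) := by
  rw [condLaw, Kernel.snd_apply, lintegral_map hg measurable_snd]
  exact Kernel.lintegral_compProd _ _ _ (hg.comp measurable_snd)

variable {f : Vec d → ℝ}

lemma ae_featLaw_mem_cube (hden : M.featLaw = cubeLaw f) : ∀ᵐ y ∂M.featLaw, y ∈ cube d := by
  have : IsProbabilityMeasure (cubeLaw f) := hden ▸ M.isProb_featLaw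
  rw [hden]
  refine (prob_compl_eq_zero_iff measurableSet_cube).2 ?_
  have := cubeLaw_cube f
  rwa [Measure.real, ENNReal.toReal_eq_one_iff] at this

/-- By consistency, for every `y` in the cube the conditional law at `y` is carried by `{z | feat z
= y}`, and the cube has full mass. -/
lemma map_feat_law (hden : M.featLaw = cubeLaw f) : M.law.map M.feat = cubeLaw f := by
  refine Measure.ext fun A hA => ?_
  rw [Measure.map_apply M.measurable_feat hA, law,
    Measure.bind_apply (M.measurable_feat hA) M.condLaw.measurable.aemeasurable]
  have h : ∀ᵐ y ∂M.featLaw, M.condLaw y (M.feat ⁻¹' A) = A.indicator 1 y := by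
    filter_upwards [M.ae_featLaw_mem_cube hden] with y hy
    by_cases hyA : y ∈ A
    · rw [Set.indicator_of_mem hyA, Pi.one_apply,
        ← mem_ae_iff_prob_eq_one (M.measurable_feat hA)]
      filter_upwards [M.ae_condLaw hy] with z hz
      rwa [Set.mem_preimage, hz]
    · rw [Set.indicator_of_notMem hyA]
      have h0 : ∀ᵐ z ∂(M.condLaw y), z ∉ M.feat ⁻¹' A := by
        filter_upwards [M.ae_condLaw hy] with z hz
        rwa [Set.mem_preimage, hz]
      simpa using measure_eq_zero_iff_ae_notMem.2 h0
  rw [lintegral_congr_ae h, lintegral_indicator_one hA, hden]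

end MomentModel

/-! ### The rate at which leaves shrink -/

/-- The exponent of the rate at which the leaves shrink. -/
noncomputable def rateExp (d : ℕ) (ρ π : ℝ) : ℝ := 1 / (2 * kernelAlpha ρ π * d)

lemma rateExp_eq {d : ℕ} {ρ π : ℝ} :
    rateExp d ρ π = π / d * Real.log (1 - ρ)⁻¹ / (2 * Real.log ρ⁻¹) := by
  rw [rateExp, kernelAlpha]
  by_cases h : Real.log ρ⁻¹ = 0
  · simp [h]
  rw [one_div, mul_div_assoc', div_mul_eq_mul_div, inv_div]
  rw [div_mul_eq_mul_div, div_div]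
  congr 1
  ring

/-- `log (1 - ρ)⁻¹ ≤ ρ / (1 - ρ)`, which is at most `1.25 * ρ` because `ρ ≤ 0.2`. -/
lemma log_inv_bounds {ρ : ℝ} (hρ : 0 < ρ) (hρ' : ρ ≤ 0.2) :
    0 < Real.log (1 - ρ)⁻¹ ∧ Real.log (1 - ρ)⁻¹ ≤ 1.25 * ρ ∧
      Real.log (1 - ρ)⁻¹ ≤ Real.log ρ⁻¹ := by
  have h1 : 0 < 1 - ρ := by linarith
  refine ⟨Real.log_pos (one_lt_inv₀ h1 |>.2 (by linarith)), ?_, ?_⟩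
  · refine (Real.log_le_sub_one_of_pos (inv_pos.2 h1)).trans ?_
    rw [sub_le_iff_le_add, inv_le_iff_one_le_mul₀ h1]
    nlinarith
  · exact Real.log_le_log (inv_pos.2 h1) (inv_anti₀ hρ (by linarith))

lemma rateExp_pos {d : ℕ} (hd : 0 < d) {ρ π : ℝ} (hρ : 0 < ρ) (hρ' : ρ ≤ 0.2) (hπ : 0 < π) :
    0 < rateExp d ρ π := by
  obtain ⟨h1, h2, h3⟩ := log_inv_bounds hρ hρ'
  rw [rateExp_eq]
  have : 0 < Real.log ρ⁻¹ := h1.trans_le h3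
  positivity

/-- Needed so that errors of order `1 / m` are dominated by the rate. -/
lemma rateExp_le_one {d : ℕ} (hd : 0 < d) {ρ π : ℝ} (hρ : 0 < ρ) (hρ' : ρ ≤ 0.2) (hπ : 0 < π)
    (hπ' : π ≤ 1) : rateExp d ρ π ≤ 1 := by
  obtain ⟨h1, h2, h3⟩ := log_inv_bounds hρ hρ'
  have h4 : 0 < Real.log ρ⁻¹ := h1.trans_le h3
  have hd' : (1 : ℝ) ≤ d := Nat.one_le_cast.2 hd
  rw [rateExp_eq, div_le_one (by positivity)]
  have : π / d ≤ 1 := (div_le_one (by positivity)).2 (by linarith)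
  have : 0 ≤ π / d := by positivity
  nlinarith

lemma measurable_weight {α : Type*} [MeasurableSpace α] {d n : ℕ} {τ : α → SplitTree d}
    {Y : α → Fin n → Vec d} (hτ : Measurable τ) (hY : ∀ i, Measurable fun a => Y a i) (x : Vec d)
    (S2 : Finset (Fin n)) (i : Fin n) :
    Measurable fun a => (τ a).weight x (Y a) S2 i := by
  classical
  have hm : ∀ i, MeasurableSet {a | Y a i ∈ (τ a).leafOf x} := fun i =>
    (hτ.prodMk (hY i)) (SplitTree.measurableSet_mem_leafOf x)
  unfold SplitTree.weight
  refine Measurable.ite ?_ ?_ measurable_const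
  · by_cases h : i ∈ S2
    · simpa [h] using hm i
    · simp [h]
  · refine measurable_const.div ?_
    have : ∀ a, ((S2.filter fun i' => Y a i' ∈ (τ a).leafOf x).card : ℝ) =
        ∑ i' ∈ S2, if Y a i' ∈ (τ a).leafOf x then (1 : ℝ) else 0 := fun a => by
      rw [Finset.card_filter]; push_cast; rfl
    simp_rw [this]
    exact Finset.measurable_sum _ fun i' _ =>
      Measurable.ite (hm i') measurable_const measurable_const

section Shrink

variable {d : ℕ} {Ωt : Type*} [MeasurableSpace Ωt] {ν : Measure Ωt} [IsProbabilityMeasure ν]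
  {T : Ωt → SplitTree d}

/-- The number of splits that are certainly made before the cells of a sample of size `m` become
small. -/
noncomputable def safeDepth (ρ : ℝ) (m : ℕ) : ℕ := ⌊0.8 * Real.log m / Real.log ρ⁻¹⌋₊

/-- Each split keeps at least the fraction `ρ`, so this depth costs at most the factor `m ^ (-0.8)`;
the remaining `m ^ 0.2` points suffice for the tail bounds. -/
lemma rpow_le_pow_safeDepth_mul {ρ : ℝ} (hρ : 0 < ρ) (hρ' : ρ ≤ 0.2) {m : ℕ} (hm : 0 < m) :
    (m : ℝ) ^ (0.2 : ℝ) ≤ ρ ^ safeDepth ρ m * m := by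
  obtain ⟨h1, h2, h3⟩ := log_inv_bounds hρ hρ'
  have h4 : 0 < Real.log ρ⁻¹ := h1.trans_le h3
  have hm' : (0 : ℝ) < m := Nat.cast_pos.2 hm
  have hlogm : 0 ≤ Real.log m := Real.log_natCast_nonneg m
  have h5 : (safeDepth ρ m : ℝ) * Real.log ρ⁻¹ ≤ 0.8 * Real.log m :=
    (le_div_iff₀ h4).1 (Nat.floor_le (by positivity))
  have e1 : ρ ^ safeDepth ρ m * m = Real.exp (Real.log ρ * safeDepth ρ m + Real.log m) := by
    rw [Real.exp_add, Real.exp_log hm', ← Real.rpow_natCast, Real.rpow_def_of_pos hρ]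
  rw [e1, Real.rpow_def_of_pos hm', Real.exp_le_exp]
  rw [Real.log_inv] at h5
  linarith

/-- The exponent is reached since `log (1 - ρ)⁻¹ / 2 ≤ 0.625 * ρ ≤ 0.8 * 0.8 * ρ`. The factor `exp
1` pays for the floor in the depth. -/
lemma pow_safeDepth_le {d : ℕ} (hd : 0 < d) {ρ π : ℝ} (hρ : 0 < ρ) (hρ' : ρ ≤ 0.2)
    (hπ : 0 < π) (hπ' : π ≤ 1) {m : ℕ} (hm : 0 < m) :
    (1 - π / d * (0.8 * ρ)) ^ safeDepth ρ m ≤ Real.exp 1 * (m : ℝ) ^ (-rateExp d ρ π) := by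
  obtain ⟨h1, h2, h3⟩ := log_inv_bounds hρ hρ'
  have h4 : 0 < Real.log ρ⁻¹ := h1.trans_le h3
  have hm' : (0 : ℝ) < m := Nat.cast_pos.2 hm
  have hlogm : 0 ≤ Real.log m := Real.log_natCast_nonneg m
  have hd' : (1 : ℝ) ≤ d := Nat.one_le_cast.2 hd
  set q := π / d with hq
  have hq1 : q ≤ 1 := (div_le_one (by positivity)).2 (by linarith)
  have hq0 : 0 < q := by positivity
  have h5 : 0.8 * Real.log m / Real.log ρ⁻¹ - 1 ≤ (safeDepth ρ m : ℝ) := by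
    have := Nat.lt_floor_add_one (0.8 * Real.log m / Real.log ρ⁻¹)
    rw [safeDepth]; linarith
  have h6 : 0 ≤ 1 - q * (0.8 * ρ) := by nlinarith
  have h7 : 1 - q * (0.8 * ρ) ≤ Real.exp (-(q * (0.8 * ρ))) := by
    linarith [Real.add_one_le_exp (-(q * (0.8 * ρ)))]
  refine (pow_le_pow_left₀ h6 h7 _).trans ?_
  rw [← Real.exp_nat_mul]
  rw [Real.rpow_def_of_pos hm', ← Real.exp_add, Real.exp_le_exp, rateExp_eq, ← hq]
  have h8 : q * Real.log (1 - ρ)⁻¹ / (2 * Real.log ρ⁻¹) * Real.log m ≤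
      q * (0.8 * ρ) * (0.8 * Real.log m / Real.log ρ⁻¹) := by
    have e1 : q * Real.log (1 - ρ)⁻¹ / (2 * Real.log ρ⁻¹) * Real.log m =
      (q * Real.log m / Real.log ρ⁻¹) * (Real.log (1 - ρ)⁻¹ / 2) := by field_simp
    have e2 : q * (0.8 * ρ) * (0.8 * Real.log m / Real.log ρ⁻¹) =
      (q * Real.log m / Real.log ρ⁻¹) * (0.64 * ρ) := by ring
    rw [e1, e2]
    refine mul_le_mul_of_nonneg_left ?_ (by positivity)
    linarith
  have h9 : q * (0.8 * ρ) ≤ 1 := by nlinarith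
  have h10 : q * (0.8 * ρ) * (0.8 * Real.log m / Real.log ρ⁻¹ - 1) ≤
      q * (0.8 * ρ) * safeDepth ρ m := mul_le_mul_of_nonneg_left h5 (by positivity)
  nlinarith

open SplitTree in
/-- For a regular sample, the expected extent of the leaf is small. -/
lemma lintegral_spread_le {s : ℕ} {S : Finset (Fin s)} (hS : S.Nonempty) {X : Fin s → Vec d}
    (hX : ∀ i, X i ∈ cube d) {f : Vec d → ℝ} [IsProbabilityMeasure (cubeLaw f)] {ρ q A : ℝ}
    (hρ : 0 < ρ) (hρ' : ρ ≤ 0.2) (hq : 0 ≤ q) (hq1 : q ≤ 1) (hA : 0 ≤ A)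
    (hpot : ∀ (t : SplitTree d) (X : Fin s → Vec d), ∀ K : ℝ, 0 < K →
      RegularSample f S K X → (∀ i, X i ∈ cube d) → t.Balanced ρ X S →
      ∀ x ∈ cube d, ∀ u, t.OnPath x u → ∀ j, t.splitDir u.reverse = some j →
      K ≤ ρ * t.cellCount X S u → ∀ b,
        potential A (t.len j (b :: u)) ≤ (1 - 0.8 * ρ) * potential A (t.len j u))
    (hreg : RegularSample f S ((S.card : ℝ) ^ (0.2 : ℝ)) X) {x : Vec d} (hx : x ∈ cube d)
    {r : ℕ} (hr : 2 * r ≤ (S.card : ℝ) ^ (0.2 : ℝ)) (hT : Measurable T)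
    (hbal : ∀ᵐ ω ∂ν, (T ω).Balanced ρ X S) (hleaf : ∀ᵐ ω ∂ν, (T ω).LeafSize r X S) (j : Fin d)
    (hrs : ∀ v, ∀ A : Set (SplitTree d), MeasurableSet[historySigma v] A →
      q * ν.real {ω | T ω ∈ A ∧ (T ω).splitDir v ≠ none} ≤
        ν.real {ω | T ω ∈ A ∧ (T ω).splitDir v = some j}) :
    ∫⁻ ω, ENNReal.ofReal (∑ i, (T ω).weight x X S i * |X i j - x j|) ∂ν ≤
      ENNReal.ofReal ((1 - q * (0.8 * ρ)) ^ safeDepth ρ S.card * Real.exp A) := by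
  set m := S.card
  set K : ℝ := (m : ℝ) ^ (0.2 : ℝ)
  set c₀ := safeDepth ρ m
  have hm : 0 < m := hS.card_pos
  have hK : 0 < K := Real.rpow_pos_of_pos (Nat.cast_pos.2 hm) _
  -- As `u.length + 1 ≤ c₀`, there is room for one more split: both children still hold at least `K`
  -- points.
  have hcount : ∀ {t : SplitTree d}, t.Balanced ρ X S → ∀ u, u.length < c₀ → t.OnPath x u →
      K ≤ ρ * t.cellCount X S u := by
    intro t ht u hu hxu
    calc K ≤ ρ ^ c₀ * m := rpow_le_pow_safeDepth_mul hρ hρ' hm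
      _ ≤ ρ ^ (u.length + 1) * m := by
          gcongr ?_ * _
          exact pow_le_pow_of_le_one hρ.le (by linarith) hu
      _ = ρ * (ρ ^ u.length * m) := by ring
      _ ≤ _ := mul_le_mul_of_nonneg_left (ht.pow_mul_le_cellCount hρ.le hxu) hρ.le
  -- A leaf has fewer than `2 * r ≤ K` points, a cell on the path at this depth at least `K / ρ`.
  have hsplit : ∀ᵐ ω ∂ν, ∀ u, u.length < c₀ → (T ω).OnPath x u →
      (T ω).splitDir u.reverse ≠ none := by
    filter_upwards [hbal, hleaf] with ω hb hl u hu hxu h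
    have h1 := hl.card_lt hxu h
    have h2 := hcount hb u hu hxu
    have h3 : (T ω).cellCount X S u < 2 * r := by
      rw [cellCount]; exact_mod_cast h1
    have : 0 ≤ (T ω).cellCount X S u := by rw [cellCount]; positivity
    nlinarith
  have hs : ∀ᵐ ω ∂ν, ∀ u, u.length < c₀ → (T ω).OnPath x u → (T ω).splitDir u.reverse = some j →
      ∀ b, potential A ((T ω).len j (b :: u)) ≤ (1 - 0.8 * ρ) * potential A ((T ω).len j u) := by
    filter_upwards [hbal] with ω hb u hu hxu hj b
    exact hpot (T ω) X K hK hreg hX hb x hx u hxu j hj (hcount hb u hu hxu) b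
  have h1 := lintegral_descPot_le hT hq hq1 (by positivity) (by linarith) hx hrs hsplit hs hA c₀ []
    (by simp)
  calc ∫⁻ ω, ENNReal.ofReal (∑ i, (T ω).weight x X S i * |X i j - x j|) ∂ν ≤
        ∫⁻ ω, descPot A x j c₀ [] (T ω) ∂ν := by
        refine lintegral_mono_ae ?_
        filter_upwards [hsplit] with ω hω
        exact ofReal_sum_weight_le hA hx hX j hω
    _ ≤ _ := h1
    _ = _ := by
        have : ∀ t : SplitTree d, cellPot A x j [] t = ENNReal.ofReal (Real.exp A) := fun t => by
          simp [cellPot, OnPath, potential, len, upper, lower]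
        have h0 : 0 ≤ 1 - q * (0.8 * ρ) := by nlinarith
        simp only [this, lintegral_const, measure_univ, mul_one]
        rw [ENNReal.ofReal_mul (by positivity), ENNReal.ofReal_pow h0]

lemma card_estPositions {s s₂ : ℕ} (h : s₂ ≤ s) : (estPositions s s₂).card = s₂ := by
  rw [estPositions, Fin.card_filter_val_lt, min_eq_right h]

/-- The exponential beats every power: for `y = m ^ 0.2` and `k = 5 * (2 * d + 1)` one has `y ^ k =
m ^ (2 * d + 1)`, which covers the number of grid boxes and one more power of `m`. -/
lemma exists_tail_bound (d : ℕ) : ∃ C : ℝ, 0 ≤ C ∧ ∀ m : ℕ, 0 < m →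
    2 * ((m + 2 : ℕ) : ℝ) ^ (2 * d) * Real.exp (-((m : ℝ) ^ (0.2 : ℝ) / 5000)) ≤ C / m := by
  set k := 5 * (2 * d + 1)
  refine ⟨2 * 3 ^ (2 * d) * (k.factorial * 5000 ^ k), by positivity, fun m hm => ?_⟩
  have hm' : (1 : ℝ) ≤ m := Nat.one_le_cast.2 hm
  set y : ℝ := (m : ℝ) ^ (0.2 : ℝ)
  have hy : 0 ≤ y := by positivity
  have hym : y ^ 5 = m := by
    rw [← Real.rpow_natCast, ← Real.rpow_mul (by positivity)]; norm_num
  have h1 : (y / 5000) ^ k / k.factorial ≤ Real.exp (y / 5000) :=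
    Real.pow_div_factorial_le_exp _ (by positivity) k
  have h2 : y ^ k * Real.exp (-(y / 5000)) ≤ k.factorial * 5000 ^ k := by
    rw [Real.exp_neg, ← div_eq_mul_inv, div_le_iff₀ (Real.exp_pos _)]
    rw [div_pow, div_div, div_le_iff₀ (by positivity)] at h1
    linarith
  have h3 : y ^ k = (m : ℝ) ^ (2 * d) * m := by
    rw [pow_mul, hym, pow_succ]
  rw [le_div_iff₀ (by positivity)]
  have h4 : ((m + 2 : ℕ) : ℝ) ^ (2 * d) ≤ (3 * (m : ℝ)) ^ (2 * d) := by
    push_cast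
    gcongr
    linarith
  calc 2 * ((m + 2 : ℕ) : ℝ) ^ (2 * d) * Real.exp (-(y / 5000)) * m
      ≤ 2 * (3 * (m : ℝ)) ^ (2 * d) * Real.exp (-(y / 5000)) * m := by gcongr
    _ = 2 * 3 ^ (2 * d) * (y ^ k * Real.exp (-(y / 5000))) := by rw [h3, mul_pow]; ring
    _ ≤ _ := by gcongr

end Shrink

/-- **Shrinkage of the leaves.** The expected weighted distance between the target and the
observations in its leaf decays polynomially in the subsample size. -/
lemma exists_shrinkage {d : ℕ} (hd : 0 < d) {f : Vec d → ℝ} (hf : ContinuousOn f (cube d))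
    {fmin fmax : ℝ} (hfmin : 0 < fmin) (hfb : ∀ y ∈ cube d, fmin ≤ f y ∧ f y ≤ fmax)
    {ρ π γ : ℝ} (hρ : 0 < ρ) (hρ' : ρ ≤ 0.2) (hπ : 0 < π) (hπ' : π ≤ 1) (hγ : 0 < γ)
    (r : ℕ) :
    ∃ C : ℝ, 0 ≤ C ∧ ∀ {p l k : ℕ} {𝒵 : Type*} [MeasurableSpace 𝒵] (M : MomentModel d p l k 𝒵)
      (_ : M.featLaw = cubeLaw f) (x : Vec d) (_ : x ∈ cube d) (s s₂ : ℕ) (_ : 1 ≤ s)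
      (_ : s₂ ≤ s) (_ : γ * s ≤ s₂) {Ωt : Type*} [MeasurableSpace Ωt] (ν : Measure Ωt)
      [IsProbabilityMeasure ν] (T : (Fin s → 𝒵) → Ωt → SplitTree d)
      (_ : IsForestLearner M ρ π r s s₂ ν T),
      ∫ q : (Fin s → 𝒵) × Ωt, ∑ t, (T q.1 q.2).weight x (fun t => M.feat (q.1 t))
        (estPositions s s₂) t * ‖M.feat (q.1 t) - x‖ ∂((Measure.pi fun _ => M.law).prod ν)
      ≤ C * (s : ℝ) ^ (-rateExp d ρ π) := by
  obtain ⟨A, hA, hpot⟩ := SplitTree.exists_potential hf hfmin hfb hρ hρ'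
  obtain ⟨C₁, hC₁, htail⟩ := exists_tail_bound d
  set κ : ℝ := max (fmax / fmin) 1
  have hκ : 0 < κ := lt_of_lt_of_le one_pos (le_max_right _ _)
  have hglob : ∀ y ∈ cube d, ∀ y' ∈ cube d, f y ≤ κ * f y' := by
    intro y hy y' hy'
    calc f y ≤ fmax := (hfb y hy).2
      _ = fmax / fmin * fmin := by field_simp
      _ ≤ κ * fmin := mul_le_mul_of_nonneg_right (le_max_left _ _) hfmin.le
      _ ≤ κ * f y' := mul_le_mul_of_nonneg_left (hfb y' hy').1 hκ.le
  set e := rateExp d ρ π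
  have he : 0 < e := rateExp_pos hd hρ hρ' hπ
  have he1 : e ≤ 1 := rateExp_le_one hd hρ hρ' hπ hπ'
  -- From this size on, `m ^ 0.2` dominates the leaf size `2 * r` and the rounding cost `100 * d *
  -- κ`; smaller samples are paid for by the constant.
  set m₀ : ℝ := (max (2 * (r : ℝ)) (100 * d * κ)) ^ (5 : ℕ)
  have hm₀ : 0 ≤ m₀ := by positivity
  set C₂ : ℝ := Real.exp 1 * Real.exp A + C₁ + m₀
  have hC₂ : 0 ≤ C₂ := by positivity
  refine ⟨d * C₂ * γ ^ (-e), by positivity, ?_⟩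
  intro p l k 𝒵 _ M hden x hx s s₂ hs hs₂ hγs Ωt _ ν _ T hT
  have hprob : IsProbabilityMeasure (cubeLaw f) := hden ▸ M.isProb_featLaw
  have hs' : (1 : ℝ) ≤ s := Nat.one_le_cast.2 hs
  have hs₂0 : 0 < s₂ := by
    have : (0 : ℝ) < s₂ := lt_of_lt_of_le (by positivity) hγs
    exact_mod_cast this
  have hs₂1 : (1 : ℝ) ≤ s₂ := Nat.one_le_cast.2 hs₂0
  set S := estPositions s s₂
  have hcard : S.card = s₂ := card_estPositions hs₂
  have hSne : S.Nonempty := by rw [← Finset.card_pos, hcard]; exact hs₂0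
  set P := Measure.pi fun _ : Fin s => M.law
  set w : (Fin s → 𝒵) × Ωt → Fin s → ℝ := fun q t =>
    (T q.1 q.2).weight x (fun t => M.feat (q.1 t)) S t
  have hwm : ∀ t, Measurable fun q => w q t := fun t =>
    measurable_weight hT.measurable (fun i => M.measurable_feat.comp
      ((measurable_pi_apply i).comp measurable_fst)) x S t
  set g : Fin d → (Fin s → 𝒵) × Ωt → ℝ := fun j q => ∑ t, w q t * |M.feat (q.1 t) j - x j|
  have hgm : ∀ j, Measurable (g j) := fun j => by
    refine Finset.measurable_sum _ fun t _ => (hwm t).mul ?_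
    have h1 : Measurable fun q : (Fin s → 𝒵) × Ωt => M.feat (q.1 t) :=
      M.measurable_feat.comp ((measurable_pi_apply t).comp measurable_fst)
    have h2 : Measurable fun q : (Fin s → 𝒵) × Ωt => M.feat (q.1 t) j - x j := by fun_prop
    simpa using h2.norm
  have hw0 : ∀ q t, 0 ≤ w q t := fun q t => SplitTree.weight_nonneg ..
  have hw1 : ∀ q, ∑ t, w q t ≤ 1 := fun q => SplitTree.sum_weight_le_one ..
  have habs : ∀ y ∈ cube d, ∀ j, |y j - x j| ≤ 1 := fun y hy j => by
    rw [abs_le]; constructor <;> linarith [(hy j).1, (hy j).2, (hx j).1, (hx j).2]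
  have hg0 : ∀ j q, 0 ≤ g j q := fun j q =>
    Finset.sum_nonneg fun t _ => mul_nonneg (hw0 q t) (abs_nonneg _)
  have hg1 : ∀ j q, g j q ≤ 1 := fun j q =>
    (Finset.sum_le_sum fun t _ => mul_le_of_le_one_right (hw0 q t)
      (habs _ (M.feat_mem _) j)).trans (hw1 q)
  have hgi : ∀ j, Integrable (g j) (P.prod ν) := fun j =>
    Integrable.of_bound (C := 1) (hgm j).aestronglyMeasurable
      (Filter.Eventually.of_forall fun q => by
        rw [Real.norm_eq_abs, abs_of_nonneg (hg0 j q)]; exact hg1 j q)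
  have hmain : ∀ j, ∫ q, g j q ∂(P.prod ν) ≤ C₂ * (s₂ : ℝ) ^ (-e) := by
    intro j
    have hpow1 : (s₂ : ℝ) ^ (-(1 : ℝ)) ≤ (s₂ : ℝ) ^ (-e) :=
      Real.rpow_le_rpow_of_exponent_le hs₂1 (by linarith)
    have hpow0 : 0 < (s₂ : ℝ) ^ (-e) := Real.rpow_pos_of_pos (by linarith) _
    rw [Real.rpow_neg_one] at hpow1
    rcases lt_or_ge (s₂ : ℝ) m₀ with hlt | hge
    · have h1 : ∫ q, g j q ∂(P.prod ν) ≤ 1 := by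
        refine (integral_mono (hgi j) (integrable_const 1) (hg1 j)).trans ?_
        simp
      refine h1.trans ?_
      calc (1 : ℝ) = s₂ * (s₂ : ℝ)⁻¹ := by field_simp
        _ ≤ m₀ * (s₂ : ℝ) ^ (-e) := by gcongr
        _ ≤ _ := by
          gcongr
          have : 0 ≤ Real.exp 1 * Real.exp A := by positivity
          simp only [C₂]; linarith
    · set K : ℝ := (s₂ : ℝ) ^ (0.2 : ℝ)
      have hKm : max (2 * (r : ℝ)) (100 * d * κ) ≤ K := by
        refine le_of_pow_le_pow_left₀ (n := 5) (by norm_num) (by positivity) ?_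
        have : K ^ 5 = s₂ := by
          rw [← Real.rpow_natCast, ← Real.rpow_mul (by positivity)]; norm_num
        rw [this]; exact hge
      obtain ⟨Bad, hBm, hBP, hB⟩ := exists_regularSample (ι := Fin s) M.law M.measurable_feat
        (M.map_feat_law hden) hf hκ.le hglob hSne (K := K)
        (by have := (le_max_right _ _).trans hKm; linarith)
      rw [hcard] at hBP
      have hBP' := hBP.trans (htail s₂ hs₂0)
      set b₁ : ℝ := (1 - π / d * (0.8 * ρ)) ^ safeDepth ρ S.card * Real.exp A
      have hq0 : 0 ≤ π / d := by positivity
      have hq1 : π / d ≤ 1 := by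
        have : (1 : ℝ) ≤ d := Nat.one_le_cast.2 hd
        exact (div_le_one (by positivity)).2 (by linarith)
      have hb₁ : 0 ≤ b₁ := by
        have : 0 ≤ 1 - π / d * (0.8 * ρ) := by nlinarith
        positivity
      -- The sample is frozen, since the random split property is conditional on it, and only the
      -- tree randomness is integrated. On `Bad` the trivial bound by one is used.
      have hfix : ∀ᵐ z ∂P, ∫⁻ ω, ENNReal.ofReal (g j (z, ω)) ∂ν ≤
          ENNReal.ofReal b₁ + Bad.indicator 1 z := by
        filter_upwards [Measure.ae_ae_of_ae_prod hT.balanced, Measure.ae_ae_of_ae_prod hT.leafSize,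
          hT.randomSplit] with z hz1 hz2 hz3
        by_cases hz : z ∈ Bad
        · rw [Set.indicator_of_mem hz]
          refine le_add_left ?_
          refine (lintegral_mono fun ω => ENNReal.ofReal_le_one.2 (hg1 j (z, ω))).trans ?_
          simp
        · rw [Set.indicator_of_notMem hz, add_zero]
          refine lintegral_spread_le hSne (fun i => M.feat_mem _) hρ hρ' hq0 hq1 hA
            (fun t X => hpot (Fin s) t X S hprob) (by rw [hcard]; exact hB z hz) hx
            (r := r) (by rw [hcard]; exact (le_max_left _ _).trans hKm)
            (hT.measurable.comp measurable_prodMk_left) hz1 hz2 j (fun v A hA => hz3 v j A hA)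
      have h2 : ∫⁻ q, ENNReal.ofReal (g j q) ∂(P.prod ν) ≤
          ENNReal.ofReal (b₁ + P.real Bad) := by
        rw [lintegral_prod _ (hgm j).ennreal_ofReal.aemeasurable]
        refine (lintegral_mono_ae hfix).trans ?_
        rw [lintegral_add_left measurable_const, lintegral_indicator_one hBm, lintegral_const,
          measure_univ, mul_one, ENNReal.ofReal_add hb₁ measureReal_nonneg, ofReal_measureReal]
      have h3 : ∫ q, g j q ∂(P.prod ν) ≤ b₁ + P.real Bad := by
        rw [integral_eq_lintegral_of_nonneg_ae (Filter.Eventually.of_forall (hg0 j))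
          (hgm j).aestronglyMeasurable]
        exact ENNReal.toReal_le_of_le_ofReal (by positivity) h2
      refine h3.trans ?_
      have h4 : b₁ ≤ Real.exp 1 * (s₂ : ℝ) ^ (-e) * Real.exp A := by
        have := pow_safeDepth_le hd hρ hρ' hπ hπ' hs₂0
        simp only [b₁, hcard]
        gcongr
      have h5 : P.real Bad ≤ C₁ * (s₂ : ℝ) ^ (-e) := by
        refine hBP'.trans ?_
        rw [div_eq_mul_inv]
        gcongr
      have h6 : 0 ≤ m₀ * (s₂ : ℝ) ^ (-e) := by positivity
      calc b₁ + P.real Bad ≤ Real.exp 1 * (s₂ : ℝ) ^ (-e) * Real.exp A + C₁ * (s₂ : ℝ) ^ (-e) +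
            m₀ * (s₂ : ℝ) ^ (-e) := by linarith
        _ = _ := by simp only [C₂]; ring
  have hnorm : ∀ q : (Fin s → 𝒵) × Ωt, ∑ t, w q t * ‖M.feat (q.1 t) - x‖ ≤ ∑ j, g j q := by
    intro q
    simp only [g]
    rw [Finset.sum_comm]
    refine Finset.sum_le_sum fun t _ => ?_
    rw [← Finset.mul_sum]
    refine mul_le_mul_of_nonneg_left ?_ (hw0 q t)
    rw [EuclideanSpace.norm_eq]
    refine Real.sqrt_le_iff.2 ⟨by positivity, ?_⟩
    simpa using Finset.sum_sq_le_sq_sum_of_nonneg (s := Finset.univ)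
      (f := fun j => |M.feat (q.1 t) j - x j|) fun i _ => abs_nonneg _
  calc ∫ q, ∑ t, w q t * ‖M.feat (q.1 t) - x‖ ∂(P.prod ν) ≤ ∫ q, ∑ j, g j q ∂(P.prod ν) := by
        refine integral_mono_of_nonneg (Filter.Eventually.of_forall fun q => ?_)
          (integrable_finsetSum _ fun j _ => hgi j) (Filter.Eventually.of_forall hnorm)
        exact Finset.sum_nonneg fun t _ => mul_nonneg (hw0 q t) (norm_nonneg _)
    _ = ∑ j, ∫ q, g j q ∂(P.prod ν) := integral_finsetSum _ fun j _ => hgi j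
    _ ≤ ∑ _ : Fin d, C₂ * (s₂ : ℝ) ^ (-e) := Finset.sum_le_sum fun j _ => hmain j
    _ = d * C₂ * (s₂ : ℝ) ^ (-e) := by simp; ring
    _ ≤ d * C₂ * (γ * s) ^ (-e) := by
        refine mul_le_mul_of_nonneg_left ?_ (by positivity)
        exact Real.rpow_le_rpow_of_nonpos (by positivity) hγs (by linarith)
    _ = _ := by rw [Real.mul_rpow hγ.le (by positivity)]; ring

end ORF

/-! ### Concentration of incomplete U-statistics -/

namespace ORF

section Hoeffding

variable {𝒵 : Type*} [MeasurableSpace 𝒵] (μ : Measure 𝒵) [IsProbabilityMeasure μ]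

/-- Distinct coordinates of an i.i.d. sample are i.i.d.; this is used for permutations of the sample
and for disjoint blocks. -/
lemma map_pi_comp_injective {ι κ : Type*} [Fintype ι] [Fintype κ] {φ : κ → ι}
    (hφ : Function.Injective φ) :
    (Measure.pi fun _ : ι => μ).map (fun D k => D (φ k)) = Measure.pi fun _ : κ => μ := by
  classical
  refine (Measure.pi_eq fun A hA => ?_).symm
  rw [Measure.map_apply (by fun_prop) (MeasurableSet.univ_pi hA)]
  have : (fun (D : ι → 𝒵) k => D (φ k)) ⁻¹' Set.univ.pi A =
      Set.univ.pi (Function.extend φ A fun _ => Set.univ) := by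
    ext D
    simp only [Set.mem_preimage, Set.mem_univ_pi]
    constructor
    · intro h i
      by_cases hi : ∃ k, φ k = i
      · obtain ⟨k, rfl⟩ := hi
        rw [hφ.extend_apply]; exact h k
      · rw [Function.extend_apply' _ _ _ hi]; trivial
    · intro h k
      simpa [hφ.extend_apply] using h (φ k)
  rw [this, Measure.pi_pi]
  refine (Fintype.prod_of_injective φ hφ _ _ (fun i hi => ?_) fun k => ?_).symm
  · rw [Function.extend_apply' _ _ _ (by simpa using hi)]; simp
  · rw [hφ.extend_apply]

lemma map_pi_blocks {n m s : ℕ} (φ : Fin m × Fin s ↪ Fin n) :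
    (Measure.pi fun _ : Fin n => μ).map (fun D k t => D (φ (k, t))) =
      Measure.pi fun _ : Fin m => Measure.pi fun _ : Fin s => μ := by
  have h := Measure.infinitePi_map_curry (ι := Fin m) (κ := Fin s) (X := 𝒵) (fun _ _ => μ)
  simp only [Measure.infinitePi_eq_pi] at h
  rw [← h, ← map_pi_comp_injective μ φ.injective, Measure.map_map]
  · rfl
  · exact (MeasurableEquiv.curry (Fin m) (Fin s) 𝒵).measurable
  · fun_prop

/-- Hoeffding's lemma on `[-c, c]`, with variance proxy `(2 * c / 2) ^ 2`, for a variable that is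
not centred. -/
lemma integral_exp_le_of_abs_le {Ω : Type*} [MeasurableSpace Ω] (P : Measure Ω)
    [IsProbabilityMeasure P] {X : Ω → ℝ} (hX : Measurable X) {c : ℝ} (hc : ∀ ω, |X ω| ≤ c)
    (a : ℝ) : ∫ ω, Real.exp (a * X ω) ∂P ≤ Real.exp (a * ∫ ω, X ω ∂P + c ^ 2 * a ^ 2 / 2) := by
  have h := hasSubgaussianMGF_of_mem_Icc (μ := P) (a := -c) (b := c) hX.aemeasurable
    (Filter.Eventually.of_forall fun ω => abs_le.1 (hc ω))
  have h2 := h.mgf_le a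
  have hcc : (((‖c - -c‖₊ / 2) ^ 2 : NNReal) : ℝ) = c ^ 2 := by
    push_cast
    rw [show c - -c = 2 * c by ring, norm_mul]
    simp
  rw [mgf, hcc] at h2
  have h3 : ∀ ω, Real.exp (a * X ω) =
      Real.exp (a * ∫ ω, X ω ∂P) * Real.exp (a * (X ω - ∫ ω, X ω ∂P)) := fun ω => by
    rw [← Real.exp_add]; congr 1; ring
  simp_rw [h3]
  rw [integral_const_mul, Real.exp_add]
  exact mul_le_mul_of_nonneg_left h2 (Real.exp_pos _).le

lemma integrable_exp_of_abs_le {Ω : Type*} [MeasurableSpace Ω] (P : Measure Ω)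
    [IsProbabilityMeasure P] {X : Ω → ℝ} (hX : Measurable X) {c : ℝ} (hc : ∀ ω, |X ω| ≤ c)
    (a : ℝ) : Integrable (fun ω => Real.exp (a * X ω)) P := by
  refine Integrable.of_bound (C := Real.exp (|a| * c)) (hX.const_mul a).exp.aestronglyMeasurable
    (Filter.Eventually.of_forall fun ω => ?_)
  rw [Real.norm_eq_abs, Real.abs_exp, Real.exp_le_exp]
  refine (le_abs_self _).trans ?_
  rw [abs_mul]
  exact mul_le_mul_of_nonneg_left (hc ω) (abs_nonneg a)

/-- Permutations of `Fin n` act transitively on injections, so averaging the images of one injection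
over permutations is averaging over all injections. -/
lemma sum_perm_embedding {n s : ℕ} (F : (Fin s ↪ Fin n) → ℝ) (β : Fin s ↪ Fin n) :
    (Fintype.card (Equiv.Perm (Fin n)) : ℝ) * ∑ S, F S =
      Fintype.card (Fin s ↪ Fin n) * ∑ τ : Equiv.Perm (Fin n), F (β.trans τ.toEmbedding) := by
  have h1 : ∀ τ : Equiv.Perm (Fin n), ∑ S : Fin s ↪ Fin n, F (S.trans τ.toEmbedding) = ∑ S, F S :=
    fun τ => by
      refine Equiv.sum_comp (Equiv.embeddingCongr (Equiv.refl (Fin s)) τ) F |>.symm ▸ ?_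
      refine Finset.sum_congr rfl fun S _ => congrArg F ?_
      ext; rfl
  have h2 : ∀ S : Fin s ↪ Fin n, ∑ τ : Equiv.Perm (Fin n), F (S.trans τ.toEmbedding) =
      ∑ τ : Equiv.Perm (Fin n), F (β.trans τ.toEmbedding) := fun S => by
    have htr := Equiv.Perm.isMultiplyPretransitive (Fin n) s
    obtain ⟨σ, hσ⟩ := htr.exists_smul_eq β S
    rw [← Equiv.sum_comp (Equiv.mulRight σ) fun τ => F (β.trans τ.toEmbedding)]
    refine Finset.sum_congr rfl fun τ _ => congrArg F ?_
    subst hσ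
    ext; rfl
  calc (Fintype.card (Equiv.Perm (Fin n)) : ℝ) * ∑ S, F S
      = ∑ τ : Equiv.Perm (Fin n), ∑ S : Fin s ↪ Fin n, F (S.trans τ.toEmbedding) := by
        simp [h1]
    _ = ∑ S : Fin s ↪ Fin n, ∑ τ : Equiv.Perm (Fin n), F (S.trans τ.toEmbedding) :=
        Finset.sum_comm
    _ = _ := by simp [h2]

instance isProbabilityMeasure_uniformOn_embedding {s n : ℕ} [Nonempty (Fin s ↪ Fin n)] :
    IsProbabilityMeasure (uniformOn (Set.univ : Set (Fin s ↪ Fin n))) :=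
  isProbabilityMeasure_uniformOn Set.finite_univ Set.univ_nonempty

lemma nonempty_embedding {s n : ℕ} (h : s ≤ n) : Nonempty (Fin s ↪ Fin n) :=
  ⟨Fin.castLEEmb h⟩

lemma integral_uniformOn_embedding {s n : ℕ} [Nonempty (Fin s ↪ Fin n)]
    (F : (Fin s ↪ Fin n) → ℝ) :
    ∫ S, F S ∂(uniformOn (Set.univ : Set (Fin s ↪ Fin n))) =
      (Fintype.card (Fin s ↪ Fin n) : ℝ)⁻¹ * ∑ S, F S := by
  rw [integral_fintype (.of_finite), Finset.mul_sum]
  refine Finset.sum_congr rfl fun S _ => ?_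
  rw [smul_eq_mul, Measure.real, uniformOn_univ, Measure.count_singleton]
  simp

/-- Exponential moments of a complete U-statistic with a bounded kernel. -/
lemma integral_exp_uStat_le {n s : ℕ} (hs : 1 ≤ s) (hsn : s ≤ n) {g : (Fin s → 𝒵) → ℝ}
    (hg : Measurable g) {c : ℝ} (hc : ∀ z, |g z| ≤ c) (a : ℝ) :
    ∫ D : Fin n → 𝒵, Real.exp (a * ((Fintype.card (Fin s ↪ Fin n) : ℝ)⁻¹ *
        ∑ S : Fin s ↪ Fin n, g fun t => D (S t))) ∂(Measure.pi fun _ => μ) ≤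
      Real.exp (a * ∫ z, g z ∂(Measure.pi fun _ : Fin s => μ) +
        c ^ 2 * a ^ 2 / 2 / ((n / s : ℕ) : ℝ)) := by
  have := nonempty_embedding hsn
  set m := n / s
  have hm : 0 < m := Nat.div_pos hsn hs
  have hm' : (0 : ℝ) < m := Nat.cast_pos.2 hm
  set P := Measure.pi fun _ : Fin n => μ
  set φ : Fin m × Fin s ↪ Fin n :=
    finProdFinEquiv.toEmbedding.trans (Fin.castLEEmb (Nat.div_mul_le_self n s))
  set β : Fin m → (Fin s ↪ Fin n) := fun k => ⟨fun t => φ (k, t), fun t t' h => by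
    simpa using φ.injective h⟩
  -- `V` sums the kernel over `m` disjoint blocks, hence over independent terms. The U-statistic is
  -- the average of `V / m` over the permutations of the sample.
  set V : (Fin n → 𝒵) → ℝ := fun D => ∑ k, g fun t => D (β k t)
  set N : ℝ := ((Fintype.card (Equiv.Perm (Fin n)) : ℕ) : ℝ)
  have hN : 0 < N := Nat.cast_pos.2 Fintype.card_pos
  set E : ℝ := ((Fintype.card (Fin s ↪ Fin n) : ℕ) : ℝ)
  have hE : 0 < E := Nat.cast_pos.2 Fintype.card_pos
  have hVm : Measurable V := Finset.measurable_sum _ fun k _ => hg.comp (by fun_prop)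
  have hVc : ∀ D, |V D| ≤ m * c := fun D => by
    refine (Finset.abs_sum_le_sum_abs _ _).trans ?_
    refine (Finset.sum_le_sum fun k _ => hc _).trans ?_
    simp
  have hU : ∀ D : Fin n → 𝒵, E⁻¹ * ∑ S : Fin s ↪ Fin n, g (fun t => D (S t)) =
      ∑ τ : Equiv.Perm (Fin n), N⁻¹ * ((m : ℝ)⁻¹ * V fun i => D (τ i)) := by
    intro D
    have h1 : ∀ k, ∑ τ : Equiv.Perm (Fin n), g (fun t => D (τ (β k t))) =
        N / E * ∑ S : Fin s ↪ Fin n, g fun t => D (S t) := fun k => by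
      have := sum_perm_embedding (fun S : Fin s ↪ Fin n => g fun t => D (S t)) (β k)
      rw [div_mul_eq_mul_div, eq_div_iff hE.ne', this, mul_comm]
      rfl
    rw [← Finset.mul_sum, ← Finset.mul_sum]
    simp only [V]
    rw [Finset.sum_comm, Finset.sum_congr rfl fun k _ => h1 k]
    simp only [Finset.sum_const, Finset.card_univ, Fintype.card_fin, nsmul_eq_mul]
    field_simp
  -- Jensen's inequality takes the average over permutations out of the exponential, so the
  -- dependence between its terms does not matter.
  have hJ : ∀ D : Fin n → 𝒵, Real.exp (a * (E⁻¹ * ∑ S : Fin s ↪ Fin n, g fun t => D (S t))) ≤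
      ∑ τ : Equiv.Perm (Fin n), N⁻¹ * Real.exp (a / m * V fun i => D (τ i)) := by
    intro D
    rw [hU, Finset.mul_sum]
    have := convexOn_exp.map_sum_le (t := Finset.univ) (w := fun _ : Equiv.Perm (Fin n) => N⁻¹)
      (p := fun τ => a / m * V fun i => D (τ i)) (fun _ _ => by positivity)
      (by simp [N]) (fun _ _ => trivial)
    simp only [smul_eq_mul] at this
    refine le_trans (le_of_eq ?_) this
    congr 1
    refine Finset.sum_congr rfl fun τ _ => ?_
    field_simp
  have hτm : ∀ τ : Equiv.Perm (Fin n), Measurable fun (D : Fin n → 𝒵) i => D (τ i) := fun τ => by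
    fun_prop
  have hmp : ∀ τ : Equiv.Perm (Fin n), ∫ D, Real.exp (a / m * V fun i => D (τ i)) ∂P =
      ∫ D, Real.exp (a / m * V D) ∂P := fun τ => by
    have h : P.map (fun D k => D (τ k)) = P := map_pi_comp_injective μ τ.injective
    conv_rhs => rw [← h]
    rw [integral_map (hτm τ).aemeasurable (hVm.const_mul _).exp.aestronglyMeasurable]
  have hV : ∫ D, Real.exp (a / m * V D) ∂P ≤
      Real.exp (a * ∫ z, g z ∂(Measure.pi fun _ : Fin s => μ) + c ^ 2 * a ^ 2 / 2 / m) := by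
    set W : (Fin m → Fin s → 𝒵) → ℝ := fun e => ∏ k, Real.exp (a / m * g (e k))
    have hWm : Measurable W := Finset.measurable_prod _ fun k _ =>
      ((hg.comp (measurable_pi_apply k)).const_mul _).exp
    have h1 : ∀ D, Real.exp (a / m * V D) = W fun k t => D (φ (k, t)) := fun D => by
      simp only [V, W]
      rw [Finset.mul_sum, Real.exp_sum]
      rfl
    simp_rw [h1]
    have hφm : Measurable fun (D : Fin n → 𝒵) k t => D (φ (k, t)) := by fun_prop
    rw [← integral_map (f := W) hφm.aemeasurable hWm.aestronglyMeasurable, map_pi_blocks]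
    simp only [W]
    rw [integral_fintype_prod_eq_pow (ι := Fin m) (𝕜 := ℝ) fun z => Real.exp (a / m * g z),
      Fintype.card_fin]
    refine (pow_le_pow_left₀ (integral_nonneg fun _ => (Real.exp_pos _).le)
      (integral_exp_le_of_abs_le _ hg hc (a / m)) m).trans (le_of_eq ?_)
    rw [← Real.exp_nat_mul]
    congr 1
    field_simp
  have hint : ∀ τ : Equiv.Perm (Fin n),
      Integrable (fun D : Fin n → 𝒵 => N⁻¹ * Real.exp (a / m * V fun i => D (τ i))) P := fun τ =>
    (integrable_exp_of_abs_le P (c := m * c) (hVm.comp (hτm τ)) (fun D => hVc fun i => D (τ i)) _).const_mul _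
  calc ∫ D : Fin n → 𝒵, Real.exp (a * (E⁻¹ * ∑ S : Fin s ↪ Fin n, g fun t => D (S t))) ∂P
      ≤ ∫ D, ∑ τ : Equiv.Perm (Fin n), N⁻¹ * Real.exp (a / m * V fun i => D (τ i)) ∂P :=
        integral_mono_of_nonneg (Filter.Eventually.of_forall fun _ => (Real.exp_pos _).le)
          (integrable_finsetSum _ fun τ _ => hint τ) (Filter.Eventually.of_forall hJ)
    _ = ∑ τ : Equiv.Perm (Fin n), N⁻¹ * ∫ D, Real.exp (a / m * V D) ∂P := by
        rw [integral_finsetSum _ fun τ _ => hint τ]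
        simp_rw [integral_const_mul, hmp]
    _ = ∫ D, Real.exp (a / m * V D) ∂P := by
        rw [Finset.sum_const, Finset.card_univ, nsmul_eq_mul]
        change N * _ = _
        field_simp
    _ ≤ _ := hV

variable {Ωt : Type*} [MeasurableSpace Ωt] (ν : Measure Ωt) [IsProbabilityMeasure ν]

/-- The law of the data and of the draws of the forest. -/
noncomputable def dataLaw (n s B : ℕ) :
    Measure ((Fin n → 𝒵) × (Fin B → (Fin s ↪ Fin n) × Ωt)) :=
  (Measure.pi fun _ => μ).prod
    (Measure.pi fun _ => (uniformOn (Set.univ : Set (Fin s ↪ Fin n))).prod ν)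

/-- The average over the forest of the statistic `g` of the subsample and the tree randomness. -/
noncomputable def forestMean {n s B : ℕ} (g : (Fin s → 𝒵) × Ωt → ℝ)
    (q : (Fin n → 𝒵) × (Fin B → (Fin s ↪ Fin n) × Ωt)) : ℝ :=
  (B : ℝ)⁻¹ * ∑ b, g (fun t => q.1 ((q.2 b).1 t), (q.2 b).2)

omit [MeasurableSpace 𝒵] [MeasurableSpace Ωt] in
lemma abs_forestMean_le {n s B : ℕ} {g : (Fin s → 𝒵) × Ωt → ℝ} {c : ℝ} (hB : 0 < B)
    (hc : ∀ z, |g z| ≤ c) (q : (Fin n → 𝒵) × (Fin B → (Fin s ↪ Fin n) × Ωt)) :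
    |forestMean g q| ≤ c := by
  have hB' : (0 : ℝ) < B := Nat.cast_pos.2 hB
  rw [forestMean, abs_mul, abs_inv, Nat.abs_cast, inv_mul_le_iff₀ hB']
  refine (Finset.abs_sum_le_sum_abs _ _).trans ((Finset.sum_le_sum fun k _ => hc _).trans ?_)
  simp

lemma measurable_subsample {n s : ℕ} : Measurable fun q : (Fin n → 𝒵) × (Fin s ↪ Fin n) × Ωt =>
    ((fun t => q.1 (q.2.1 t), q.2.2) : (Fin s → 𝒵) × Ωt) := by
  refine Measurable.prodMk (measurable_pi_lambda _ fun t => ?_) measurable_snd.snd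
  have h : Measurable fun q : (Fin s ↪ Fin n) × (Fin n → 𝒵) => q.2 (q.1 t) :=
    measurable_from_prod_countable_right fun S => measurable_pi_apply (S t)
  exact h.comp ((measurable_snd.fst).prodMk measurable_fst)

lemma measurable_forestMean {n s B : ℕ} {g : (Fin s → 𝒵) × Ωt → ℝ} (hg : Measurable g) :
    Measurable (forestMean g : (Fin n → 𝒵) × (Fin B → (Fin s ↪ Fin n) × Ωt) → ℝ) := by
  refine (Finset.measurable_sum _ fun b _ => ?_).const_mul _
  exact hg.comp (measurable_subsample.comp
    (measurable_fst.prodMk ((measurable_pi_apply b).comp measurable_snd)))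

/-- Exponential moments of an incomplete U-statistic with random subsamples. -/
lemma integral_exp_forestMean_le {n s B : ℕ} (hs : 1 ≤ s) (hsn : s ≤ n) (hB : 0 < B)
    {g : (Fin s → 𝒵) × Ωt → ℝ} (hg : Measurable g) {c : ℝ} (hc : ∀ z, |g z| ≤ c) (a : ℝ) :
    ∫ q, Real.exp (a * forestMean g q) ∂(dataLaw μ ν n s B) ≤
      Real.exp (a * ∫ z, g z ∂((Measure.pi fun _ : Fin s => μ).prod ν) +
        c ^ 2 * a ^ 2 / 2 * ((B : ℝ)⁻¹ + ((n / s : ℕ) : ℝ)⁻¹)) := by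
  have := nonempty_embedding hsn
  have hB' : (0 : ℝ) < B := Nat.cast_pos.2 hB
  set U := (uniformOn (Set.univ : Set (Fin s ↪ Fin n))).prod ν
  set P := Measure.pi fun _ : Fin n => μ
  have hgb : Measurable fun z : Fin s → 𝒵 => ∫ ω, g (z, ω) ∂ν :=
    (hg.stronglyMeasurable.integral_prod_right' (ν := ν)).measurable
  have hgbc : ∀ z : Fin s → 𝒵, |∫ ω, g (z, ω) ∂ν| ≤ c := fun z => by
    refine (norm_integral_le_of_norm_le_const (C := c) (f := fun ω => g (z, ω))
      (Filter.Eventually.of_forall fun ω => hc (z, ω))).trans ?_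
    simp
  have hgi : Integrable g ((Measure.pi fun _ : Fin s => μ).prod ν) :=
    Integrable.of_bound (C := c) hg.aestronglyMeasurable (Filter.Eventually.of_forall hc)
  have hgD : ∀ D : Fin n → 𝒵, Measurable fun v : (Fin s ↪ Fin n) × Ωt =>
      g (fun t => D (v.1 t), v.2) := fun D =>
    hg.comp (measurable_subsample.comp measurable_prodMk_left)
  have hU : ∀ D : Fin n → 𝒵, ∫ v, g (fun t => D (v.1 t), v.2) ∂U =
      (Fintype.card (Fin s ↪ Fin n) : ℝ)⁻¹ * ∑ S : Fin s ↪ Fin n,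
        ∫ ω, g (fun t => D (S t), ω) ∂ν := by
    intro D
    rw [integral_prod _ (Integrable.of_bound (C := c) (hgD D).aestronglyMeasurable
      (Filter.Eventually.of_forall fun v => hc _)), integral_uniformOn_embedding]
  have hexp_int : Integrable (fun q => Real.exp (a * forestMean g q)) (dataLaw μ ν n s B) := by
    have : IsProbabilityMeasure (dataLaw μ ν n s B) := by unfold dataLaw; infer_instance
    exact integrable_exp_of_abs_le _ (measurable_forestMean hg) (abs_forestMean_le hB hc) a
  rw [dataLaw, integral_prod _ hexp_int]
  -- Given the data the `B` draws are i.i.d., and their mean is the complete U-statistic of the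
  -- kernel averaged over the tree randomness.
  have hinner : ∀ D : Fin n → 𝒵,
      ∫ G : Fin B → (Fin s ↪ Fin n) × Ωt, Real.exp (a * forestMean g (D, G)) ∂(Measure.pi fun _ => U)
      ≤ Real.exp (c ^ 2 * a ^ 2 / 2 * (B : ℝ)⁻¹) *
        Real.exp (a * ((Fintype.card (Fin s ↪ Fin n) : ℝ)⁻¹ * ∑ S : Fin s ↪ Fin n,
          ∫ ω, g (fun t => D (S t), ω) ∂ν)) := by
    intro D
    have h1 : ∀ G : Fin B → (Fin s ↪ Fin n) × Ωt, Real.exp (a * forestMean g (D, G)) =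
        ∏ b, Real.exp (a / B * g (fun t => D ((G b).1 t), (G b).2)) := fun G => by
      rw [← Real.exp_sum, ← Finset.mul_sum, forestMean]
      congr 1
      field_simp
    simp_rw [h1]
    rw [integral_fintype_prod_eq_pow (ι := Fin B) (𝕜 := ℝ)
      fun v : (Fin s ↪ Fin n) × Ωt => Real.exp (a / B * g (fun t => D (v.1 t), v.2)),
      Fintype.card_fin]
    refine (pow_le_pow_left₀ (integral_nonneg fun _ => (Real.exp_pos _).le)
      (integral_exp_le_of_abs_le U (hgD D) (fun v => hc _) (a / B)) B).trans (le_of_eq ?_)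
    rw [← Real.exp_nat_mul, ← Real.exp_add, hU]
    congr 1
    field_simp
    ring
  have hE : 0 < (Fintype.card (Fin s ↪ Fin n) : ℝ) := Nat.cast_pos.2 Fintype.card_pos
  refine (integral_mono_of_nonneg
    (Filter.Eventually.of_forall fun D => integral_nonneg fun _ => (Real.exp_pos _).le)
    ((integrable_exp_of_abs_le P (c := c) ?_ ?_ a).const_mul _)
    (Filter.Eventually.of_forall hinner)).trans ?_
  · exact (Finset.measurable_sum _ fun S _ => hgb.comp (by fun_prop)).const_mul _
  · intro D
    rw [abs_mul, abs_inv, Nat.abs_cast, inv_mul_le_iff₀ hE]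
    refine (Finset.abs_sum_le_sum_abs _ _).trans ((Finset.sum_le_sum fun k _ => hgbc _).trans ?_)
    simp
  · rw [integral_const_mul]
    refine (mul_le_mul_of_nonneg_left (integral_exp_uStat_le μ hs hsn hgb hgbc a)
      (Real.exp_pos _).le).trans (le_of_eq ?_)
    rw [← Real.exp_add, integral_prod _ hgi]
    congr 1
    ring

/-- Concentration of an incomplete U-statistic with random subsamples. -/
lemma measureReal_forestMean_le {n s B : ℕ} (hs : 1 ≤ s) (hsn : s ≤ n) (hB : (n : ℝ) / s ≤ B)
    {g : (Fin s → 𝒵) × Ωt → ℝ} (hg : Measurable g) {c : ℝ} (hc0 : 0 < c) (hc : ∀ z, |g z| ≤ c)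
    {u : ℝ} (hu : 0 ≤ u) :
    (dataLaw μ ν n s B).real {q | u ≤ |forestMean g q -
      ∫ z, g z ∂((Measure.pi fun _ : Fin s => μ).prod ν)|} ≤
      2 * Real.exp (-(u ^ 2 * n / (6 * c ^ 2 * s))) := by
  have := nonempty_embedding hsn
  have hs' : (0 : ℝ) < s := Nat.cast_pos.2 hs
  have hn' : (0 : ℝ) < n := Nat.cast_pos.2 (hs.trans hsn)
  have hBpos : (0 : ℝ) < B := (div_pos hn' hs').trans_le hB
  have hB0 : 0 < B := Nat.cast_pos.1 hBpos
  set Q := dataLaw μ ν n s B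
  have : IsProbabilityMeasure Q := by unfold Q dataLaw; infer_instance
  set e := ∫ z, g z ∂((Measure.pi fun _ : Fin s => μ).prod ν)
  have hm : 0 < n / s := Nat.div_pos hsn hs
  have hm' : (0 : ℝ) < ((n / s : ℕ) : ℝ) := Nat.cast_pos.2 hm
  -- `B ≥ n / s` bounds the first summand, and `⌊n / s⌋ ≥ n / (2 * s)` the second.
  have hsum : (B : ℝ)⁻¹ + ((n / s : ℕ) : ℝ)⁻¹ ≤ 3 * s / n := by
    have h1 : (B : ℝ)⁻¹ ≤ s / n := by
      rw [← inv_div]; exact inv_anti₀ (div_pos hn' hs') hB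
    have h2 : ((n / s : ℕ) : ℝ)⁻¹ ≤ 2 * (s : ℝ) / n := by
      rw [inv_le_iff_one_le_mul₀ hm', div_mul_eq_mul_div, le_div_iff₀ hn', one_mul]
      have h3 : n < (n / s + 1) * s := by
        have := Nat.lt_div_mul_add (a := n) hs
        linarith [this]
      have h4 : n ≤ 2 * s * (n / s) := by nlinarith
      exact_mod_cast h4
    calc (B : ℝ)⁻¹ + ((n / s : ℕ) : ℝ)⁻¹ ≤ s / n + 2 * (s : ℝ) / n := add_le_add h1 h2
      _ = 3 * s / (n : ℝ) := by ring
  -- The sign `ε` treats both tails at once.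
  have key : ∀ ε : ℝ, ε ^ 2 = 1 → Q.real {q | u ≤ ε * (forestMean g q - e)} ≤
      Real.exp (-(u ^ 2 * n / (6 * c ^ 2 * s))) := by
    intro ε hε
    -- The minimizer of `c ^ 2 * a ^ 2 / 2 * (3 * s / n) - a * u`.
    set a : ℝ := u * n / (3 * c ^ 2 * s)
    have ha : 0 ≤ a := by positivity
    have h1 := integral_exp_forestMean_le μ ν hs hsn hB0 hg hc (a * ε)
    have hint := integrable_exp_of_abs_le Q (measurable_forestMean hg) (abs_forestMean_le hB0 hc)
      (a * ε)
    have h2 := mul_meas_ge_le_integral_of_nonneg (μ := Q)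
      (Filter.Eventually.of_forall fun q => (Real.exp_pos _).le) hint
      (Real.exp (a * ε * e + a * u))
    have h3 : Q.real {q | u ≤ ε * (forestMean g q - e)} ≤
        Q.real {q | Real.exp (a * ε * e + a * u) ≤ Real.exp (a * ε * forestMean g q)} := by
      refine measureReal_mono fun q hq => ?_
      have hq' : u ≤ ε * (forestMean g q - e) := hq
      simp only [Set.mem_ofPred_eq, Real.exp_le_exp]
      nlinarith [mul_le_mul_of_nonneg_left hq' ha]
    have h4 : c ^ 2 * (a * ε) ^ 2 / 2 * ((B : ℝ)⁻¹ + ((n / s : ℕ) : ℝ)⁻¹) ≤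
        c ^ 2 * a ^ 2 / 2 * (3 * s / n) := by
      rw [mul_pow, hε, mul_one]
      exact mul_le_mul_of_nonneg_left hsum (by positivity)
    have h5 : a * ε * e + c ^ 2 * (a * ε) ^ 2 / 2 * ((B : ℝ)⁻¹ + ((n / s : ℕ) : ℝ)⁻¹) ≤
        (a * ε * e + a * u) + -(u ^ 2 * n / (6 * c ^ 2 * s)) := by
      have : c ^ 2 * a ^ 2 / 2 * (3 * s / n) - a * u = -(u ^ 2 * n / (6 * c ^ 2 * s)) := by
        simp only [a]
        field_simp
        ring
      linarith
    refine h3.trans ?_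
    have h6 := h2.trans (h1.trans (Real.exp_le_exp.2 h5))
    rw [Real.exp_add (a * ε * e + a * u)] at h6
    exact le_of_mul_le_mul_left h6 (Real.exp_pos _)
  have hsub : {q : (Fin n → 𝒵) × (Fin B → (Fin s ↪ Fin n) × Ωt) | u ≤ |forestMean g q - e|} ⊆
      {q | u ≤ 1 * (forestMean g q - e)} ∪ {q | u ≤ (-1) * (forestMean g q - e)} := by
    intro q hq
    rcases le_abs.1 (show u ≤ |forestMean g q - e| from hq) with h | h
    · left; simpa using h
    · right; simpa using h
  refine (measureReal_mono hsub).trans ((measureReal_union_le _ _).trans ?_)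
  linarith [key 1 (by norm_num), key (-1) (by norm_num)]

end Hoeffding

end ORF

/-! ### Honesty: scores replaced by conditional means -/

namespace ORF

section Honesty

variable {d p l k : ℕ} {𝒵 : Type*} [MeasurableSpace 𝒵] (M : MomentModel d p l k 𝒵)

namespace MomentModel

/-- The conditional expectation `E[g(Z) | X = y]`. -/
noncomputable def condMean (g : 𝒵 → ℝ) (y : Vec d) : ℝ := ∫ z, g z ∂(M.condLaw y)

lemma measurable_condMean {g : 𝒵 → ℝ} (hg : Measurable g) : Measurable (M.condMean g) :=
  (hg.stronglyMeasurable.integral_kernel (κ := M.condLaw)).measurable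

lemma abs_condMean_le {g : 𝒵 → ℝ} {c : ℝ} (hc : ∀ z, |g z| ≤ c) (y : Vec d) :
    |M.condMean g y| ≤ c := by
  refine (norm_integral_le_of_norm_le_const (f := g) (C := c) (Filter.Eventually.of_forall hc)).trans ?_
  simp

lemma integral_law {g : 𝒵 → ℝ} (hg : Measurable g) {c : ℝ} (hc : ∀ z, |g z| ≤ c) :
    ∫ z, g z ∂M.law = ∫ y, M.condMean g y ∂M.featLaw := by
  have h : M.law = (M.featLaw ⊗ₘ M.condLaw).map Prod.snd := (Measure.snd_compProd _ _).symm
  rw [h, integral_map measurable_snd.aemeasurable hg.aestronglyMeasurable,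
    Measure.integral_compProd]
  · rfl
  · exact Integrable.of_bound (C := c) (hg.comp measurable_snd).aestronglyMeasurable
      (Filter.Eventually.of_forall fun z => hc _)

/-- Given the feature, `w` is constant and can be pulled out of the conditional expectation. -/
lemma integral_mul_condMean {f : Vec d → ℝ} (hden : M.featLaw = cubeLaw f) {w g : 𝒵 → ℝ}
    (hw : Measurable w) (hg : Measurable g) {c : ℝ} (hw1 : ∀ z, |w z| ≤ 1) (hc : ∀ z, |g z| ≤ c)
    (hfib : ∀ z z', M.feat z = M.feat z' → w z = w z') :
    ∫ z, w z * g z ∂M.law = ∫ z, w z * M.condMean g (M.feat z) ∂M.law := by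
  have hmul : ∀ {g : 𝒵 → ℝ}, (∀ z, |g z| ≤ c) → ∀ z, |w z * g z| ≤ c := fun {g} hc z => by
    rw [abs_mul]
    exact (mul_le_of_le_one_left (abs_nonneg _) (hw1 z)).trans (hc z)
  have hgm := M.measurable_condMean hg
  have hgc := fun z => M.abs_condMean_le hc (M.feat z)
  have hm1 : Measurable fun z => w z * g z := hw.mul hg
  have hm2 : Measurable fun z => w z * M.condMean g (M.feat z) :=
    hw.mul (hgm.comp M.measurable_feat)
  rw [M.integral_law hm1 (hmul hc), M.integral_law hm2 (hmul hgc)]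
  refine integral_congr_ae ?_
  filter_upwards [M.ae_featLaw_mem_cube hden] with y hy
  have hae := M.ae_condLaw hy
  obtain ⟨z₀, hz₀⟩ := hae.exists
  rw [condMean, condMean]
  have h1 : ∀ᵐ z ∂(M.condLaw y), w z * g z = w z₀ * g z := by
    filter_upwards [hae] with z hz
    rw [hfib z z₀ (hz.trans hz₀.symm)]
  have h2 : ∀ᵐ z ∂(M.condLaw y), w z * M.condMean g (M.feat z) = w z₀ * M.condMean g y := by
    filter_upwards [hae] with z hz
    rw [hfib z z₀ (hz.trans hz₀.symm), hz]
  rw [integral_congr_ae h1, integral_congr_ae h2, integral_const_mul, integral_const]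
  simp [condMean]

end MomentModel

/-- Resampling one coordinate preserves the product law. This isolates the observation `t` while the
others are held fixed. -/
lemma map_update_pi {s : ℕ} (μ : Measure 𝒵) [IsProbabilityMeasure μ] (t : Fin s) :
    ((Measure.pi fun _ : Fin s => μ).prod μ).map (fun q => Function.update q.1 t q.2) =
      Measure.pi fun _ : Fin s => μ := by
  classical
  have hm : Measurable fun q : (Fin s → 𝒵) × 𝒵 => Function.update q.1 t q.2 := by
    refine measurable_pi_lambda _ fun i => ?_
    by_cases h : i = t
    · subst h; simpa using measurable_snd
    · simp only [Function.update_of_ne h]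
      exact (measurable_pi_apply i).comp measurable_fst
  refine (Measure.pi_eq fun A hA => ?_).symm
  rw [Measure.map_apply hm (MeasurableSet.univ_pi hA)]
  have : (fun q : (Fin s → 𝒵) × 𝒵 => Function.update q.1 t q.2) ⁻¹' Set.univ.pi A =
      (Set.univ.pi (Function.update A t Set.univ)) ×ˢ A t := by
    ext q
    simp only [Set.mem_preimage, Set.mem_univ_pi, Set.mem_prod]
    constructor
    · intro h
      refine ⟨fun i => ?_, by simpa using h t⟩
      by_cases hi : i = t
      · subst hi; simp
      · simpa [hi] using h i
    · rintro ⟨h1, h2⟩ i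
      by_cases hi : i = t
      · subst hi; simpa using h2
      · simpa [hi] using h1 i
  rw [this, Measure.prod_prod, Measure.pi_pi,
    ← Finset.prod_erase_mul _ _ (Finset.mem_univ t),
    ← Finset.prod_erase_mul (a := t) Finset.univ (fun i => μ (A i)) (Finset.mem_univ t)]
  simp only [Function.update_self, measure_univ, mul_one]
  congr 1
  refine Finset.prod_congr rfl fun i hi => ?_
  rw [Function.update_of_ne (Finset.ne_of_mem_erase hi)]

lemma integral_pi_mul_condMean {f : Vec d → ℝ} (hden : M.featLaw = cubeLaw f) {s : ℕ} (t : Fin s)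
    {w : (Fin s → 𝒵) → ℝ} {g : 𝒵 → ℝ} (hw : Measurable w) (hg : Measurable g) {c : ℝ}
    (hw1 : ∀ z, |w z| ≤ 1) (hc : ∀ z, |g z| ≤ c)
    (hfib : ∀ z y y', M.feat y = M.feat y' → w (Function.update z t y) = w (Function.update z t y')) :
    ∫ z, w z * g (z t) ∂(Measure.pi fun _ : Fin s => M.law) =
      ∫ z, w z * M.condMean g (M.feat (z t)) ∂(Measure.pi fun _ : Fin s => M.law) := by
  classical
  have hm : Measurable fun q : (Fin s → 𝒵) × 𝒵 => Function.update q.1 t q.2 := by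
    refine measurable_pi_lambda _ fun i => ?_
    by_cases h : i = t
    · subst h; simpa using measurable_snd
    · simp only [Function.update_of_ne h]
      exact (measurable_pi_apply i).comp measurable_fst
  have key : ∀ {g : 𝒵 → ℝ}, Measurable g → (∀ z, |g z| ≤ c) →
      ∫ z, w z * g (z t) ∂(Measure.pi fun _ : Fin s => M.law) =
        ∫ z, ∫ y, w (Function.update z t y) * g y ∂M.law ∂(Measure.pi fun _ : Fin s => M.law) := by
    intro g hg hc
    have hF : Measurable fun z : Fin s → 𝒵 => w z * g (z t) :=
      hw.mul (hg.comp (measurable_pi_apply t))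
    conv_lhs => rw [← map_update_pi M.law t]
    rw [integral_map hm.aemeasurable hF.aestronglyMeasurable, integral_prod]
    · simp
    · refine Integrable.of_bound (C := c) (hF.comp hm).aestronglyMeasurable
        (Filter.Eventually.of_forall fun q => ?_)
      rw [Real.norm_eq_abs, abs_mul]
      exact (mul_le_of_le_one_left (abs_nonneg _) (hw1 _)).trans (hc _)
  rw [key hg hc, key (g := fun z => M.condMean g (M.feat z))
    ((M.measurable_condMean hg).comp M.measurable_feat) fun z => M.abs_condMean_le hc _]
  refine integral_congr_ae (Filter.Eventually.of_forall fun z => ?_)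
  exact M.integral_mul_condMean hden (hw.comp (hm.comp measurable_prodMk_left)) hg
    (fun y => hw1 _) hc (hfib z)

end Honesty

/-! ### Bias of one tree and the weighted score as a forest average -/

section TreeStat

variable {d p l k : ℕ} {𝒵 : Type*} [MeasurableSpace 𝒵] (M : MomentModel d p l k 𝒵)
variable {Ωt : Type*} [MeasurableSpace Ωt] {s : ℕ}

/-- The weighted average of `g` over the leaf of the target in one tree. -/
noncomputable def treeStat (s₂ : ℕ) (T : (Fin s → 𝒵) → Ωt → SplitTree d) (x : Vec d) (g : 𝒵 → ℝ)
    (q : (Fin s → 𝒵) × Ωt) : ℝ :=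
  ∑ t, (T q.1 q.2).weight x (fun t => M.feat (q.1 t)) (estPositions s s₂) t * g (q.1 t)

variable {s₂ : ℕ} {T : (Fin s → 𝒵) → Ωt → SplitTree d} {x : Vec d} {g : 𝒵 → ℝ}

lemma measurable_treeWeight (hT : Measurable fun q : (Fin s → 𝒵) × Ωt => T q.1 q.2) (t : Fin s) :
    Measurable fun q : (Fin s → 𝒵) × Ωt =>
      (T q.1 q.2).weight x (fun t => M.feat (q.1 t)) (estPositions s s₂) t :=
  measurable_weight hT (fun i => M.measurable_feat.comp
    ((measurable_pi_apply i).comp measurable_fst)) x _ t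

lemma measurable_treeStat (hT : Measurable fun q : (Fin s → 𝒵) × Ωt => T q.1 q.2)
    (hg : Measurable g) : Measurable (treeStat M s₂ T x g) :=
  Finset.measurable_sum _ fun t _ => (measurable_treeWeight M hT t).mul
    (hg.comp ((measurable_pi_apply t).comp measurable_fst))

omit [MeasurableSpace Ωt] in
lemma abs_treeStat_le {c : ℝ} (hc0 : 0 ≤ c) (hc : ∀ z, |g z| ≤ c) (q : (Fin s → 𝒵) × Ωt) :
    |treeStat M s₂ T x g q| ≤ c := by
  have h0 := SplitTree.weight_nonneg (T q.1 q.2) x (fun t => M.feat (q.1 t)) (estPositions s s₂)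
  calc |treeStat M s₂ T x g q| ≤ ∑ t, (T q.1 q.2).weight x (fun t => M.feat (q.1 t))
        (estPositions s s₂) t * c := by
        refine (Finset.abs_sum_le_sum_abs _ _).trans (Finset.sum_le_sum fun t _ => ?_)
        rw [abs_mul, abs_of_nonneg (h0 t)]
        exact mul_le_mul_of_nonneg_left (hc _) (h0 t)
    _ ≤ c := by
        rw [← Finset.sum_mul]
        exact mul_le_of_le_one_left hc0 (SplitTree.sum_weight_le_one ..)

/-- By honesty, the expectation of the weighted average is close to the conditional mean at the
target. -/
lemma abs_integral_treeStat_sub_le {f : Vec d → ℝ} (hden : M.featLaw = cubeLaw f) {ρ π : ℝ} {r : ℕ}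
    (hr : 1 ≤ r) {ν : Measure Ωt} [IsProbabilityMeasure ν]
    (hT : IsForestLearner M ρ π r s s₂ ν T) (hg : Measurable g) {c L : ℝ}
    (hc : ∀ z, |g z| ≤ c)
    (hL : ∀ z, |M.condMean g (M.feat z) - M.condMean g x| ≤ L * ‖M.feat z - x‖) (hx : x ∈ cube d) :
    |∫ q, treeStat M s₂ T x g q ∂((Measure.pi fun _ => M.law).prod ν) - M.condMean g x| ≤
      L * ∫ q : (Fin s → 𝒵) × Ωt, ∑ t, (T q.1 q.2).weight x (fun t => M.feat (q.1 t))
        (estPositions s s₂) t * ‖M.feat (q.1 t) - x‖ ∂((Measure.pi fun _ => M.law).prod ν) := by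
  set P := (Measure.pi fun _ : Fin s => M.law).prod ν
  set w : Fin s → (Fin s → 𝒵) × Ωt → ℝ := fun t q =>
    (T q.1 q.2).weight x (fun t => M.feat (q.1 t)) (estPositions s s₂) t
  have hwm : ∀ t, Measurable (w t) := measurable_treeWeight M hT.measurable
  have hw0 : ∀ t q, 0 ≤ w t q := fun t q => SplitTree.weight_nonneg ..
  have hws : ∀ q, ∑ t, w t q ≤ 1 := fun q => SplitTree.sum_weight_le_one ..
  have hw1 : ∀ t q, |w t q| ≤ 1 := fun t q => by
    rw [abs_of_nonneg (hw0 t q)]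
    exact (Finset.single_le_sum (f := fun t => w t q) (fun i _ => hw0 i q)
      (Finset.mem_univ t)).trans (hws q)
  have hint : ∀ {G : 𝒵 → ℝ} {c : ℝ}, Measurable G → (∀ z, |G z| ≤ c) → ∀ t,
      Integrable (fun q : (Fin s → 𝒵) × Ωt => w t q * G (q.1 t)) P := fun {G c} hG hc t => by
    refine Integrable.of_bound (C := c) ((hwm t).mul
      (hG.comp ((measurable_pi_apply t).comp measurable_fst))).aestronglyMeasurable
      (Filter.Eventually.of_forall fun q => ?_)
    rw [Real.norm_eq_abs, abs_mul]
    exact (mul_le_of_le_one_left (abs_nonneg _) (hw1 _ _)).trans (hc _)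
  set m : 𝒵 → ℝ := fun z => M.condMean g (M.feat z)
  have hmm : Measurable m := (M.measurable_condMean hg).comp M.measurable_feat
  have hmc : ∀ z, |m z| ≤ c := fun z => M.abs_condMean_le hc _
  have hterm : ∀ t, ∫ q, w t q * g (q.1 t) ∂P = ∫ q, w t q * m (q.1 t) ∂P := by
    intro t
    rw [integral_prod_symm _ (hint hg hc t), integral_prod_symm _ (hint hmm hmc t)]
    refine integral_congr_ae (Filter.Eventually.of_forall fun ω => ?_)
    -- In the estimation half, the weight sees the observation `t` only through its feature: the
    -- tree by honesty, membership in the leaf by definition. Elsewhere the weight is zero.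
    by_cases ht : t ∈ estPositions s s₂
    · refine integral_pi_mul_condMean M hden t (w := fun z => w t (z, ω))
        ((hwm t).comp measurable_prodMk_right) hg (fun z => hw1 _ _) hc fun z y y' hyy => ?_
      have hfeat : (fun i => M.feat (Function.update z t y i)) =
          fun i => M.feat (Function.update z t y' i) := by
        funext i
        by_cases hi : i = t
        · subst hi; simpa using hyy
        · simp [hi]
      have htree : T (Function.update z t y) ω = T (Function.update z t y') ω := by
        refine hT.honest _ _ _ (fun i hi => ?_) fun i _ => congrFun hfeat i
        have : i ≠ t := fun h => hi (h ▸ ht)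
        simp [this]
      simp only [w]
      rw [htree, hfeat]
    · have : ∀ q, w t q = 0 := fun q => by
        simp only [w, SplitTree.weight]
        rw [if_neg]; tauto
      simp [this]
  have h1 : ∫ q, treeStat M s₂ T x g q ∂P = ∫ q, ∑ t, w t q * m (q.1 t) ∂P := by
    simp only [treeStat]
    rw [integral_finsetSum _ fun t _ => hint hg hc t,
      integral_finsetSum _ fun t _ => hint hmm hmc t]
    exact Finset.sum_congr rfl fun t _ => hterm t
  -- Leaves are nonempty because `r ≥ 1`; as the weights sum to exactly one, the constant
  -- `M.condMean g x` may be moved into the sum.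
  have hone : ∀ᵐ q ∂P, ∑ t, w t q = 1 := by
    filter_upwards [hT.leafSize] with q hq
    exact hq.sum_weight hr x
  have h2 : M.condMean g x = ∫ q, ∑ t, w t q * M.condMean g x ∂P := by
    have : ∀ᵐ q ∂P, ∑ t, w t q * M.condMean g x = M.condMean g x := by
      filter_upwards [hone] with q hq
      rw [← Finset.sum_mul, hq, one_mul]
    rw [integral_congr_ae this]; simp
  have hxn : ∀ z, |‖M.feat z - x‖| ≤ Metric.diam (cube d) := fun z => by
    rw [abs_norm, ← dist_eq_norm]
    exact Metric.dist_le_diam_of_mem isCompact_cube.isBounded (M.feat_mem z) hx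
  have hxm : Measurable fun z => ‖M.feat z - x‖ := (M.measurable_feat.sub_const x).norm
  rw [h1, h2, ← integral_sub (integrable_finsetSum _ fun t _ => hint hmm hmc t)
    (integrable_finsetSum _ fun t _ => hint measurable_const (fun _ => M.abs_condMean_le hc x) t),
    ← integral_const_mul]
  refine (abs_integral_le_integral_abs).trans ?_
  refine integral_mono_of_nonneg (Filter.Eventually.of_forall fun q => abs_nonneg _)
    ((integrable_finsetSum _ fun t _ => hint hxm hxn t).const_mul L)
    (Filter.Eventually.of_forall fun q => ?_)
  beta_reduce
  rw [← Finset.sum_sub_distrib, Finset.mul_sum]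
  refine (Finset.abs_sum_le_sum_abs _ _).trans (Finset.sum_le_sum fun t _ => ?_)
  rw [← mul_sub, abs_mul, abs_of_nonneg (hw0 t q)]
  calc w t q * |m (q.1 t) - M.condMean g x| ≤ w t q * (L * ‖M.feat (q.1 t) - x‖) :=
        mul_le_mul_of_nonneg_left (hL _) (hw0 t q)
    _ = _ := by ring

variable {n B : ℕ}

omit [MeasurableSpace Ωt] in
lemma sum_weight_map (t : SplitTree d) (D : Fin n → 𝒵) (S : Fin s ↪ Fin n) (E : Finset (Fin s))
    (G : 𝒵 → ℝ) :
    ∑ i, t.weight x (fun i' => M.feat (D i')) (E.map S) i * G (D i) =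
      ∑ i, t.weight x (fun i' => M.feat (D (S i'))) E i * G (D (S i)) := by
  classical
  have hcard : ((E.map S).filter fun i' => M.feat (D i') ∈ t.leafOf x).card =
      (E.filter fun i' => M.feat (D (S i')) ∈ t.leafOf x).card := by
    rw [Finset.filter_map, Finset.card_map]
    rfl
  have h1 : ∑ i, t.weight x (fun i' => M.feat (D i')) (E.map S) i * G (D i) =
      ∑ i ∈ Finset.univ.map S, t.weight x (fun i' => M.feat (D i')) (E.map S) i * G (D i) := by
    refine (Finset.sum_subset (Finset.subset_univ _) fun i _ hi => ?_).symm
    rw [SplitTree.weight, if_neg, zero_mul]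
    rintro ⟨h, -⟩
    obtain ⟨j, -, hj⟩ := Finset.mem_map.1 h
    exact hi (Finset.mem_map.2 ⟨j, Finset.mem_univ j, hj⟩)
  rw [h1, Finset.sum_map]
  refine Finset.sum_congr rfl fun i _ => ?_
  congr 1
  rw [SplitTree.weight, SplitTree.weight, hcard]
  simp

-- Brings each coordinate of the weighted score into the form to which the concentration of
-- incomplete U-statistics applies.
omit [MeasurableSpace Ωt] in
lemma weightedScore_apply (T : (Fin s → 𝒵) → Ωt → SplitTree d) (D : Fin n → 𝒵)
    (draws : Fin B → (Fin s ↪ Fin n) × Ωt) (θ : Vec p) (h : Vec d → Vec k → Vec l) (j : Fin p) :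
    weightedScore M s₂ T x D draws θ h j =
      forestMean (treeStat M s₂ T x fun z => M.plugIn θ h z j) (D, draws) := by
  have h1 : weightedScore M s₂ T x D draws θ h j =
      ∑ i, forestWeight M s₂ T x D draws i * M.plugIn θ h (D i) j := by
    rw [weightedScore, WithLp.ofLp_sum, Finset.sum_apply]
    rfl
  rw [h1, forestMean]
  simp only [forestWeight, one_div]
  simp_rw [mul_assoc, Finset.sum_mul]
  rw [← Finset.mul_sum, Finset.sum_comm]
  congr 1
  refine Finset.sum_congr rfl fun b _ => ?_
  exact sum_weight_map M _ D _ _ fun z => M.plugIn θ h z j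

omit [MeasurableSpace Ωt] in
lemma forestWeight_nonneg (D : Fin n → 𝒵) (draws : Fin B → (Fin s ↪ Fin n) × Ωt) (i : Fin n) :
    0 ≤ forestWeight M s₂ T x D draws i :=
  mul_nonneg (by positivity) (Finset.sum_nonneg fun b _ => SplitTree.weight_nonneg ..)

omit [MeasurableSpace Ωt] in
lemma sum_forestWeight_le_one (D : Fin n → 𝒵) (draws : Fin B → (Fin s ↪ Fin n) × Ωt) :
    ∑ i, forestWeight M s₂ T x D draws i ≤ 1 := by
  simp only [forestWeight]
  rw [← Finset.mul_sum, Finset.sum_comm]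
  have : ∑ b : Fin B, ∑ i, (T (fun t => D ((draws b).1 t)) (draws b).2).weight x
      (fun i' => M.feat (D i')) ((estPositions s s₂).map (draws b).1) i ≤ ∑ _b : Fin B, (1 : ℝ) :=
    Finset.sum_le_sum fun b _ => SplitTree.sum_weight_le_one ..
  rcases Nat.eq_zero_or_pos B with rfl | hB
  · simp
  · have hB' : (0 : ℝ) < B := Nat.cast_pos.2 hB
    rw [one_div, inv_mul_le_iff₀ hB']
    simpa using this

end TreeStat

/-! ### A finite net of the parameter set -/

section Net

/-- A finite net of a bounded set of parameters. -/
lemma exists_net {p : ℕ} {Θ : Set (Vec p)} {θ₀ : Vec p} {R ε : ℝ} (hθ₀ : θ₀ ∈ Θ)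
    (hR : ∀ θ ∈ Θ, ‖θ - θ₀‖ ≤ R) (hε : 0 < ε) :
    ∃ F : Finset (Vec p), (↑F : Set (Vec p)) ⊆ Θ ∧ (F.card : ℝ) ≤ (2 * R / ε + 5) ^ p ∧
      ∀ θ ∈ Θ, ∃ θ' ∈ F, ‖θ - θ'‖ ≤ p * ε := by
  classical
  have hR0 : 0 ≤ R := (norm_nonneg _).trans (hR θ₀ hθ₀)
  set N : ℕ := ⌈R / ε⌉₊ + 1
  have hN : R / ε + 1 ≤ N := by push_cast [N]; linarith [Nat.le_ceil (R / ε)]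
  have hN' : (N : ℝ) ≤ R / ε + 2 := by
    push_cast [N]; linarith [(Nat.ceil_lt_add_one (div_nonneg hR0 hε.le)).le]
  -- Parameters are sorted into cubes of side `ε`, and a representative is chosen from each occupied
  -- cube. It has to lie in `Θ`, where the score is assumed to be bounded.
  set cell : Vec p → Fin p → ℤ := fun θ i => ⌊(θ i - θ₀ i) / ε⌋
  have hcell : ∀ θ ∈ Θ, cell θ ∈ Fintype.piFinset fun _ : Fin p => Finset.Icc (-(N : ℤ)) N := by
    intro θ hθ
    rw [Fintype.mem_piFinset]
    intro i
    have h1 : |(θ i - θ₀ i) / ε| ≤ R / ε := by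
      rw [abs_div, abs_of_pos hε]
      gcongr
      exact (PiLp.norm_apply_le (θ - θ₀) i).trans (hR θ hθ)
    rw [abs_le] at h1
    rw [Finset.mem_Icc]
    constructor
    · rw [Int.le_floor]; push_cast; linarith
    · rw [← Int.lt_add_one_iff, Int.floor_lt]; push_cast; linarith
  set cells := (Fintype.piFinset fun _ : Fin p => Finset.Icc (-(N : ℤ)) N).filter
    fun c => ∃ θ ∈ Θ, cell θ = c
  have hrep : ∀ c ∈ cells, ∃ θ ∈ Θ, cell θ = c := fun c hc => (Finset.mem_filter.1 hc).2
  choose! rep hrep1 hrep2 using hrep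
  refine ⟨cells.image rep, ?_, ?_, ?_⟩
  · intro θ hθ
    obtain ⟨c, hc, rfl⟩ := Finset.mem_image.1 (Finset.mem_coe.1 hθ)
    exact hrep1 c hc
  · have h1 : (cells.image rep).card ≤ (2 * N + 1) ^ p := by
      refine Finset.card_image_le.trans ((Finset.card_filter_le _ _).trans ?_)
      rw [Fintype.card_piFinset]
      simp only [Int.card_Icc, Finset.prod_const, Finset.card_univ, Fintype.card_fin]
      refine Nat.pow_le_pow_left ?_ p
      omega
    calc ((cells.image rep).card : ℝ) ≤ ((2 * N + 1 : ℕ) : ℝ) ^ p := by exact_mod_cast h1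
      _ ≤ (2 * R / ε + 5) ^ p := by
        refine pow_le_pow_left₀ (by positivity) ?_ p
        push_cast
        rw [mul_div_assoc]
        linarith
  · intro θ hθ
    have hc : cell θ ∈ cells := Finset.mem_filter.2 ⟨hcell θ hθ, θ, hθ, rfl⟩
    refine ⟨rep (cell θ), Finset.mem_image_of_mem _ hc, ?_⟩
    have h2 : ∀ i, |θ i - rep (cell θ) i| ≤ ε := by
      intro i
      have h3 : ⌊(θ i - θ₀ i) / ε⌋ = ⌊(rep (cell θ) i - θ₀ i) / ε⌋ :=
        (congrFun (hrep2 _ hc) i).symm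
      have h4 := (Int.abs_sub_lt_one_of_floor_eq_floor h3).le
      rw [← sub_div, abs_div, abs_of_pos hε, div_le_one hε] at h4
      simpa using h4
    rw [EuclideanSpace.norm_eq]
    refine Real.sqrt_le_iff.2 ⟨by positivity, ?_⟩
    calc ∑ i, ‖(θ - rep (cell θ)) i‖ ^ 2 ≤ ∑ _i : Fin p, ε ^ 2 := by
          refine Finset.sum_le_sum fun i _ => ?_
          rw [Real.norm_eq_abs]
          exact pow_le_pow_left₀ (abs_nonneg _) (h2 i) 2
      _ = p * ε ^ 2 := by simp
      _ ≤ (p * ε) ^ 2 := by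
          rcases Nat.eq_zero_or_pos p with rfl | hp
          · simp
          · have : (1 : ℝ) ≤ p := Nat.one_le_cast.2 hp
            nlinarith [sq_nonneg ε, mul_nonneg (sub_nonneg.2 this) (by positivity : 0 ≤ (p : ℝ) * ε ^ 2)]

end Net

end ORF

/-! ### Uniform concentration over the parameter set -/

namespace ORF

section Concentration

variable {d p l k : ℕ} {𝒵 : Type*} [MeasurableSpace 𝒵] (M : MomentModel d p l k 𝒵)

namespace MomentModel

variable {M} {f : Vec d → ℝ} {L R σ₀ : ℝ} {x : Vec d} {θ₀ : Vec p}

lemma Regular.moment_apply (hM : M.Regular f L R σ₀ x θ₀) {y : Vec d} (hy : y ∈ cube d)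
    {θ : Vec p} (hθ : θ ∈ M.Θ) {h : Vec d → Vec k → Vec l} (hh : h ∈ M.H) (j : Fin p) :
    M.moment y θ h j = M.condMean (fun z => M.plugIn θ h z j) y :=
  ((EuclideanSpace.proj (𝕜 := ℝ) j).integral_comp_comm (hM.integrable y hy θ hθ h hh)).symm

lemma norm_plugIn_sub_le (hM : M.Regular f L R σ₀ x θ₀) {θ θ' : Vec p} (hθ : θ ∈ M.Θ)
    (hθ' : θ' ∈ M.Θ) {h : Vec d → Vec k → Vec l} (hh : h ∈ M.H) (z : 𝒵) :
    ‖M.plugIn θ h z - M.plugIn θ' h z‖ ≤ L * ‖θ - θ'‖ :=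
  hM.lipschitz_θ z _ (M.maps_of_mem h hh _ (M.feat_mem z) _) θ (M.Θ_subset hθ) θ' (M.Θ_subset hθ')

lemma Regular.norm_moment_sub_le (hM : M.Regular f L R σ₀ x θ₀) {y : Vec d} (hy : y ∈ cube d)
    {θ θ' : Vec p} (hθ : θ ∈ M.Θ) (hθ' : θ' ∈ M.Θ) {h : Vec d → Vec k → Vec l} (hh : h ∈ M.H) :
    ‖M.moment y θ h - M.moment y θ' h‖ ≤ L * ‖θ - θ'‖ := by
  rw [moment, moment, ← integral_sub (hM.integrable y hy θ hθ h hh)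
    (hM.integrable y hy θ' hθ' h hh)]
  refine (norm_integral_le_of_norm_le_const (C := L * ‖θ - θ'‖)
    (Filter.Eventually.of_forall fun z => norm_plugIn_sub_le hM hθ hθ' hh z)).trans ?_
  simp

lemma measurable_plugIn {h : Vec d → Vec k → Vec l} (hh : h ∈ M.H) (θ : Vec p) (j : Fin p) :
    Measurable fun z => M.plugIn θ h z j := by
  have h1 : Measurable fun z => M.plugIn θ h z :=
    M.measurable_score.comp (measurable_id.prodMk (measurable_const.prodMk
      ((M.measurable_of_mem h hh).comp (M.measurable_feat.prodMk M.measurable_conf))))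
  exact (EuclideanSpace.proj (𝕜 := ℝ) j).continuous.measurable.comp h1

end MomentModel

lemma norm_le_card_mul {p : ℕ} {v : Vec p} {c : ℝ} (hc : ∀ j, |v j| ≤ c) : ‖v‖ ≤ p * c := by
  calc ‖v‖ = ‖∑ j, v j • EuclideanSpace.single j (1 : ℝ)‖ := by
        congr 1
        ext i
        simp [Finset.sum_apply, Pi.single_apply]
    _ ≤ ∑ j, ‖v j • EuclideanSpace.single j (1 : ℝ)‖ := norm_sum_le _ _
    _ ≤ ∑ _j : Fin p, c := Finset.sum_le_sum fun j _ => by simpa [norm_smul] using hc j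
    _ = p * c := by simp

variable {Ωt : Type*} [MeasurableSpace Ωt] {n s s₂ B : ℕ}
  {T : (Fin s → 𝒵) → Ωt → SplitTree d} {x : Vec d}
  {f : Vec d → ℝ} {L R σ₀ : ℝ} {θ₀ : Vec p}

omit [MeasurableSpace Ωt] in
lemma norm_weightedScore_sub_le (hM : M.Regular f L R σ₀ x θ₀) (hL : 0 ≤ L)
    {θ θ' : Vec p} (hθ : θ ∈ M.Θ)
    (hθ' : θ' ∈ M.Θ) {h : Vec d → Vec k → Vec l} (hh : h ∈ M.H) (D : Fin n → 𝒵)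
    (draws : Fin B → (Fin s ↪ Fin n) × Ωt) :
    ‖weightedScore M s₂ T x D draws θ h - weightedScore M s₂ T x D draws θ' h‖ ≤
      L * ‖θ - θ'‖ := by
  have h0 := forestWeight_nonneg (s₂ := s₂) (T := T) (x := x) M D draws
  rw [weightedScore, weightedScore, ← Finset.sum_sub_distrib]
  calc _ ≤ ∑ i, forestWeight M s₂ T x D draws i * (L * ‖θ - θ'‖) := by
        refine (norm_sum_le _ _).trans (Finset.sum_le_sum fun i _ => ?_)
        rw [← smul_sub, norm_smul, Real.norm_eq_abs, abs_of_nonneg (h0 i)]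
        exact mul_le_mul_of_nonneg_left (MomentModel.norm_plugIn_sub_le hM hθ hθ' hh _) (h0 i)
    _ ≤ _ := by
        rw [← Finset.sum_mul]
        exact mul_le_of_le_one_left (by positivity) (sum_forestWeight_le_one M D draws)

lemma measurable_forestMean_param {E : Type*} [MeasurableSpace E]
    {G : E × (Fin s → 𝒵) × Ωt → ℝ} (hG : Measurable G) :
    Measurable fun q : E × (Fin n → 𝒵) × (Fin B → (Fin s ↪ Fin n) × Ωt) =>
      forestMean (fun y => G (q.1, y)) q.2 := by
  refine (Finset.measurable_sum _ fun b _ => ?_).const_mul _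
  exact hG.comp (measurable_fst.prodMk (measurable_subsample.comp
    (measurable_snd.fst.prodMk ((measurable_pi_apply b).comp measurable_snd.snd))))

/-- The sample law, rearranged into the first stage data and the forest data. -/
lemma measurePreserving_sampleLaw {Ωa : Type*} [MeasurableSpace Ωa] (α : Measure Ωa)
    [IsProbabilityMeasure α] (ν : Measure Ωt) [IsProbabilityMeasure ν] (hsn : s ≤ n) :
    MeasurePreserving (fun q : (Fin n → 𝒵) × (Fin n → 𝒵) × Ωa × (Fin B → (Fin s ↪ Fin n) × Ωt) =>
      ((q.2.1, q.2.2.1), (q.1, q.2.2.2))) (sampleLaw M n s B α ν)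
      (((Measure.pi fun _ : Fin n => M.law).prod α).prod (dataLaw M.law ν n s B)) := by
  have := nonempty_embedding hsn
  set μ := Measure.pi fun _ : Fin n => M.law
  set U := Measure.pi fun _ : Fin B => (uniformOn (Set.univ : Set (Fin s ↪ Fin n))).prod ν
  have h1 := (MeasurePreserving.id μ).prod (measurePreserving_prodAssoc μ α U).symm
  have h2 := (measurePreserving_prodAssoc μ (μ.prod α) U).symm
  have h3 := (Measure.measurePreserving_swap (μ := μ) (ν := μ.prod α)).prod (MeasurePreserving.id U)
  have h4 := measurePreserving_prodAssoc (μ.prod α) μ U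
  exact h4.comp (h3.comp (h2.comp h1))

/-- Uniform concentration of the weighted score around the moment, with explicit resolution `ε` of
the net and deviation `u`. -/
lemma measure_weightedScore_le (hM : M.Regular f L R σ₀ x θ₀) (hx : x ∈ cube d) (hL : 0 ≤ L)
    {ρ π : ℝ} {r : ℕ} (hr : 1 ≤ r) (hs : 1 ≤ s) (hsn : s ≤ n) (hB : (n : ℝ) / s ≤ B)
    (ν : Measure Ωt) [IsProbabilityMeasure ν] (hT : IsForestLearner M ρ π r s s₂ ν T)
    {Ωa : Type*} [MeasurableSpace Ωa] (α : Measure Ωa) [IsProbabilityMeasure α]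
    (hhat : (Fin n → 𝒵) → Ωa → Vec d → Vec k → Vec l)
    (hhm : Measurable fun q : ((Fin n → 𝒵) × Ωa) × Vec d × Vec k => hhat q.1.1 q.1.2 q.2.1 q.2.2)
    {c : ℝ} (hc0 : 0 < c)
    (hgood : ∀ᵐ q ∂((Measure.pi fun _ : Fin n => M.law).prod α), hhat q.1 q.2 ∈ M.H ∧
      ∀ z, ∀ θ ∈ M.Θ, ∀ j, |M.plugIn θ (hhat q.1 q.2) z j| ≤ c)
    {b : ℝ} (hb : ∫ q : (Fin s → 𝒵) × Ωt, ∑ t, (T q.1 q.2).weight x (fun t => M.feat (q.1 t))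
        (estPositions s s₂) t * ‖M.feat (q.1 t) - x‖ ∂((Measure.pi fun _ => M.law).prod ν) ≤ b)
    {Ω : Type*} [MeasurableSpace Ω] (P : Measure Ω)
    (D₁ D₂ : Ω → Fin n → 𝒵) (a : Ω → Ωa) (G : Ω → Fin B → (Fin s ↪ Fin n) × Ωt)
    (hlaw : HasLaw (fun ω => (D₁ ω, D₂ ω, a ω, G ω)) (sampleLaw M n s B α ν) P)
    {ε u : ℝ} (hε : 0 < ε) (hu : 0 ≤ u) :
    P {ω | ¬ (hhat (D₂ ω) (a ω) ∈ M.H ∧ ∀ θ ∈ M.Θ,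
        ‖weightedScore M s₂ T x (D₁ ω) (G ω) θ (hhat (D₂ ω) (a ω)) -
        M.moment x θ (hhat (D₂ ω) (a ω))‖ ≤ 2 * L * (p * ε) + p * (u + L * b))} ≤
      ENNReal.ofReal ((2 * R / ε + 5) ^ p *
        (p * (2 * Real.exp (-(u ^ 2 * n / (6 * c ^ 2 * s)))))) := by
  classical
  obtain ⟨F, hFΘ, hFc, hFn⟩ := exists_net hM.θ₀_mem (fun θ hθ => hM.diam_le θ hθ θ₀ hM.θ₀_mem) hε
  set E := (Measure.pi fun _ : Fin n => M.law).prod α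
  set Q := dataLaw M.law ν n s B
  have hQ : IsProbabilityMeasure Q := by
    have := nonempty_embedding hsn
    unfold Q dataLaw; infer_instance
  set μs := (Measure.pi fun _ : Fin s => M.law).prod ν
  set stat : Vec p → Fin p → ((Fin n → 𝒵) × Ωa) × (Fin s → 𝒵) × Ωt → ℝ := fun θ j q =>
    treeStat M s₂ T x (fun z => M.plugIn θ (hhat q.1.1 q.1.2) z j) q.2
  have hstat : ∀ θ j, Measurable (stat θ j) := by
    intro θ j
    refine Finset.measurable_sum _ fun t _ => ((measurable_treeWeight M hT.measurable t).comp
      measurable_snd).mul ?_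
    have hz : Measurable fun q : ((Fin n → 𝒵) × Ωa) × (Fin s → 𝒵) × Ωt => q.2.1 t :=
      (measurable_pi_apply t).comp measurable_snd.fst
    have h1 : Measurable fun q : ((Fin n → 𝒵) × Ωa) × (Fin s → 𝒵) × Ωt =>
        M.plugIn θ (hhat q.1.1 q.1.2) (q.2.1 t) :=
      M.measurable_score.comp (hz.prodMk (measurable_const.prodMk (hhm.comp
        (measurable_fst.prodMk ((M.measurable_feat.comp hz).prodMk (M.measurable_conf.comp hz))))))
    exact (EuclideanSpace.proj (𝕜 := ℝ) j).continuous.measurable.comp h1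
  set dev : Vec p → Fin p → Set (((Fin n → 𝒵) × Ωa) ×
      (Fin n → 𝒵) × (Fin B → (Fin s ↪ Fin n) × Ωt)) := fun θ j =>
    {q | u ≤ |forestMean (fun y => stat θ j (q.1, y)) q.2 - ∫ y, stat θ j (q.1, y) ∂μs|}
  have hdev : ∀ θ j, MeasurableSet (dev θ j) := by
    intro θ j
    refine measurableSet_le measurable_const (Measurable.abs (Measurable.sub
      (measurable_forestMean_param (hstat θ j)) ?_))
    exact ((hstat θ j).stronglyMeasurable.integral_prod_right' (ν := μs)).measurable.comp
      measurable_fst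
  have hdevle : ∀ θ ∈ F, ∀ j, (E.prod Q) (dev θ j) ≤
      ENNReal.ofReal (2 * Real.exp (-(u ^ 2 * n / (6 * c ^ 2 * s)))) := by
    intro θ hθ j
    -- Fubini: once the first stage `e` is fixed, the nuisance is a fixed function, independent of
    -- the forest data.
    rw [Measure.prod_apply (hdev θ j)]
    calc _ ≤ ∫⁻ _e, ENNReal.ofReal (2 * Real.exp (-(u ^ 2 * n / (6 * c ^ 2 * s)))) ∂E := by
          refine lintegral_mono_ae ?_
          filter_upwards [hgood] with e he
          have hg := MomentModel.measurable_plugIn he.1 θ j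
          have h1 := measureReal_forestMean_le (μ := M.law) (ν := ν) hs hsn hB
            (g := treeStat M s₂ T x fun z => M.plugIn θ (hhat e.1 e.2) z j)
            (measurable_treeStat M hT.measurable hg) hc0
            (abs_treeStat_le M hc0.le fun z => he.2 z θ (hFΘ hθ) j) hu
          rw [← ofReal_measureReal (measure_ne_top _ _)]
          exact ENNReal.ofReal_le_ofReal h1
      _ = _ := by simp
  set N := ⋃ θ ∈ F, ⋃ j, dev θ j
  have hN : MeasurableSet N := F.measurableSet_biUnion fun θ _ => MeasurableSet.iUnion fun j =>
    hdev θ j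
  have hNle : (E.prod Q) N ≤ ENNReal.ofReal ((2 * R / ε + 5) ^ p *
        (p * (2 * Real.exp (-(u ^ 2 * n / (6 * c ^ 2 * s)))))) := by
    have h2 : ∀ θ ∈ F, (E.prod Q) (⋃ j, dev θ j) ≤
        ENNReal.ofReal (p * (2 * Real.exp (-(u ^ 2 * n / (6 * c ^ 2 * s))))) := by
      intro θ hθ
      refine (measure_iUnion_fintype_le _ _).trans
        ((Finset.sum_le_sum fun j _ => hdevle θ hθ j).trans ?_)
      rw [Finset.sum_const, Finset.card_univ, Fintype.card_fin,
        ENNReal.ofReal_mul (Nat.cast_nonneg p), nsmul_eq_mul, ENNReal.ofReal_natCast]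
    refine (measure_biUnion_finset_le _ _).trans ((Finset.sum_le_sum h2).trans ?_)
    rw [Finset.sum_const, nsmul_eq_mul, ← ENNReal.ofReal_natCast,
      ← ENNReal.ofReal_mul (Nat.cast_nonneg _)]
    exact ENNReal.ofReal_le_ofReal (mul_le_mul_of_nonneg_right hFc (by positivity))
  -- The exceptional set quantifies over all `z` and `θ` and need not be measurable; it is enlarged
  -- to a measurable null set.
  have hbad : MeasurableSet (toMeasurable E
      {e | ¬ (hhat e.1 e.2 ∈ M.H ∧ ∀ z, ∀ θ ∈ M.Θ, ∀ j, |M.plugIn θ (hhat e.1 e.2) z j| ≤ c)}) :=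
    measurableSet_toMeasurable _ _
  set bad := toMeasurable E
      {e | ¬ (hhat e.1 e.2 ∈ M.H ∧ ∀ z, ∀ θ ∈ M.Θ, ∀ j, |M.plugIn θ (hhat e.1 e.2) z j| ≤ c)}
  have hbad0 : E bad = 0 := by rw [measure_toMeasurable]; exact hgood
  have hpres := (measurePreserving_sampleLaw M α ν (B := B) hsn)
  set Φ := fun q : (Fin n → 𝒵) × (Fin n → 𝒵) × Ωa × (Fin B → (Fin s ↪ Fin n) × Ωt) =>
      ((q.2.1, q.2.2.1), (q.1, q.2.2.2))
  have hV : MeasurableSet (N ∪ bad ×ˢ Set.univ) := hN.union (hbad.prod MeasurableSet.univ)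
  have hPV : P ((fun ω => (D₁ ω, D₂ ω, a ω, G ω)) ⁻¹' (Φ ⁻¹' (N ∪ bad ×ˢ Set.univ))) =
      (E.prod Q) (N ∪ bad ×ˢ Set.univ) := by
    rw [← Measure.map_apply_of_aemeasurable hlaw.aemeasurable (hpres.measurable hV), hlaw.map_eq,
      hpres.measure_preimage hV.nullMeasurableSet]
  refine (measure_mono ?_).trans (hPV.le.trans ((measure_union_le _ _).trans ?_))
  · intro ω hω
    rw [Set.mem_ofPred_eq] at hω
    by_contra hnot
    apply hω
    set h := hhat (D₂ ω) (a ω)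
    have hnN : ((D₂ ω, a ω), (D₁ ω, G ω)) ∉ N := fun h => hnot (Or.inl h)
    have hnb : (D₂ ω, a ω) ∉ bad := fun h => hnot (Or.inr ⟨h, trivial⟩)
    obtain ⟨hH, hbd⟩ : h ∈ M.H ∧ ∀ z, ∀ θ ∈ M.Θ, ∀ j, |M.plugIn θ h z j| ≤ c := by
      by_contra hcon
      exact hnb (subset_toMeasurable E _ hcon)
    refine ⟨hH, fun θ hθ => ?_⟩
    obtain ⟨θ', hθ'F, hθθ'⟩ := hFn θ hθ
    have hθ' := hFΘ hθ'F
    -- At a point of the net the error is a deviation `u` plus the bias `L * b` in each coordinate.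
    have hmid : ‖weightedScore M s₂ T x (D₁ ω) (G ω) θ' h - M.moment x θ' h‖ ≤
        p * (u + L * b) := by
      refine norm_le_card_mul fun j => ?_
      have hd1 : |forestMean (treeStat M s₂ T x fun z => M.plugIn θ' h z j) (D₁ ω, G ω) -
          ∫ y, treeStat M s₂ T x (fun z => M.plugIn θ' h z j) y ∂μs| ≤ u := by
        by_contra hcon
        refine hnN (Set.mem_iUnion₂.2 ⟨θ', hθ'F, Set.mem_iUnion.2 ⟨j, ?_⟩⟩)
        exact (not_le.1 hcon).le
      have hd2 := abs_integral_treeStat_sub_le M (s₂ := s₂) (L := L) hM.density hr hT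
        (MomentModel.measurable_plugIn hH θ' j) (fun z => hbd z θ' hθ' j) (fun z => by
          rw [← hM.moment_apply (M.feat_mem z) hθ' hH, ← hM.moment_apply hx hθ' hH]
          exact (PiLp.norm_apply_le (M.moment (M.feat z) θ' h - M.moment x θ' h) j).trans
            (hM.smooth_signal θ' hθ' h hH _ (M.feat_mem z) _ hx)) hx
      rw [PiLp.sub_apply, weightedScore_apply, hM.moment_apply hx hθ' hH]
      calc _ ≤ |forestMean (treeStat M s₂ T x fun z => M.plugIn θ' h z j) (D₁ ω, G ω) -
          ∫ y, treeStat M s₂ T x (fun z => M.plugIn θ' h z j) y ∂μs| +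
          |∫ y, treeStat M s₂ T x (fun z => M.plugIn θ' h z j) y ∂μs -
            M.condMean (fun z => M.plugIn θ' h z j) x| := abs_sub_le _ _ _
        _ ≤ u + L * b := add_le_add hd1 (hd2.trans (mul_le_mul_of_nonneg_left hb hL))
    -- Going from the net to `θ` costs one Lipschitz term for the score and one for the moment.
    have h1 := norm_weightedScore_sub_le (s₂ := s₂) (T := T) M hM hL hθ hθ' hH (D₁ ω) (G ω)
    have h2 := hM.norm_moment_sub_le hx hθ' hθ hH
    rw [norm_sub_rev θ' θ] at h2
    have h3 : L * ‖θ - θ'‖ ≤ L * (p * ε) := mul_le_mul_of_nonneg_left hθθ' hL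
    calc _ = ‖(weightedScore M s₂ T x (D₁ ω) (G ω) θ h - weightedScore M s₂ T x (D₁ ω) (G ω) θ' h)
          + (weightedScore M s₂ T x (D₁ ω) (G ω) θ' h - M.moment x θ' h) +
          (M.moment x θ' h - M.moment x θ h)‖ := by congr 1; abel
      _ ≤ _ := norm_add₃_le
      _ ≤ 2 * L * (p * ε) + p * (u + L * b) := by linarith
  · rw [Measure.prod_prod, hbad0, zero_mul, add_zero]
    exact hNle

end Concentration

end ORF

/-! ### Choice of the mesh and of the deviation -/

namespace ORF

section UniformConcentration

/-- With `y = n / (s * δ)` and mesh `s / n`, the net has at most `((2 * R + 5) * y) ^ p` points, and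
the exponential is `y ^ (-κ)`. Of the terms of `κ`, `p` pays for the net, `1` leaves `y⁻¹ ≤ δ`, and
`log A / log 2` absorbs the constant `A`; the last uses `y ≥ 2`, hence `δ ≤ 1 / 2`. -/
lemma exists_deviation_constant (p : ℕ) {R c : ℝ} (hR : 0 ≤ R) (hc : 0 < c) :
    ∃ K : ℝ, 0 ≤ K ∧ ∀ n s δ : ℝ, 0 < s → s ≤ n → 0 < δ → δ ≤ 1 / 2 →
      (2 * R / (s / n) + 5) ^ p * (p * (2 * Real.exp
        (-((K * √(s * Real.log (n / (s * δ)) / n)) ^ 2 * n / (6 * c ^ 2 * s))))) ≤ δ := by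
  set A : ℝ := 2 * p * (2 * R + 5) ^ p + 1
  have hA : 1 ≤ A := by
    have : 0 ≤ 2 * p * (2 * R + 5) ^ p := by positivity
    simp only [A]; linarith
  have hlA : 0 ≤ Real.log A := Real.log_nonneg hA
  have hl2 : 0 < Real.log 2 := Real.log_pos one_lt_two
  set κ : ℝ := p + 1 + Real.log A / Real.log 2
  have hκ : 0 ≤ κ := by positivity
  refine ⟨√(6 * c ^ 2 * κ), Real.sqrt_nonneg _, fun n s δ hs hsn hδ hδ2 => ?_⟩
  have hn : 0 < n := hs.trans_le hsn
  set y := n / (s * δ)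
  have hny : n / s ≤ y := by
    simp only [y]
    rw [← div_div, le_div_iff₀ hδ]
    have : 0 ≤ n / s := by positivity
    nlinarith
  have hn1 : 1 ≤ n / s := (one_le_div hs).2 hsn
  have hyδ : y⁻¹ ≤ δ := by
    simp only [y, inv_div]
    rw [div_le_iff₀ hn, mul_comm]
    exact mul_le_mul_of_nonneg_left hsn hδ.le
  have hy2 : 2 ≤ y := by
    have h1 : (1 / δ) ≤ y := by
      simp only [y]
      rw [← div_div]
      exact div_le_div_of_nonneg_right hn1 hδ.le
    have h2 : 2 ≤ 1 / δ := by rw [le_div_iff₀ hδ]; linarith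
    linarith
  have hy0 : 0 < y := by linarith
  have hΛ : Real.log 2 ≤ Real.log y := Real.log_le_log two_pos hy2
  have hΛ0 : 0 ≤ Real.log y := hl2.le.trans hΛ
  have hexp : (√(6 * c ^ 2 * κ) * √(s * Real.log y / n)) ^ 2 * n / (6 * c ^ 2 * s) =
      κ * Real.log y := by
    rw [mul_pow, Real.sq_sqrt (by positivity), Real.sq_sqrt (by positivity)]
    field_simp
  rw [hexp]
  have h1 : Real.exp (-(κ * Real.log y)) ≤ (y ^ (p + 1))⁻¹ * A⁻¹ := by
    have h3 : Real.exp (-((p + 1 : ℕ) * Real.log y)) = (y ^ (p + 1))⁻¹ := by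
      rw [Real.exp_neg, Real.exp_nat_mul, Real.exp_log hy0]
    have h4 : Real.exp (-(Real.log A)) = A⁻¹ := by
      rw [Real.exp_neg, Real.exp_log (by linarith)]
    rw [← h3, ← h4, ← Real.exp_add]
    refine Real.exp_le_exp.2 ?_
    have h5 : Real.log A ≤ Real.log A / Real.log 2 * Real.log y := by
      rw [div_mul_eq_mul_div, le_div_iff₀ hl2]
      exact mul_le_mul_of_nonneg_left hΛ hlA
    simp only [κ]
    push_cast
    linarith
  have h2 : 2 * R / (s / n) + 5 ≤ (2 * R + 5) * y := by
    have : 2 * R / (s / n) = 2 * R * (n / s) := by field_simp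
    rw [this]
    nlinarith
  calc _ ≤ ((2 * R + 5) * y) ^ p * (p * (2 * ((y ^ (p + 1))⁻¹ * A⁻¹))) := by gcongr
    _ = (2 * p * (2 * R + 5) ^ p) * A⁻¹ * y⁻¹ := by
        rw [mul_pow, pow_succ]; field_simp
    _ ≤ 1 * y⁻¹ := by
        gcongr
        rw [← div_eq_mul_inv, div_le_one (by linarith)]
        simp only [A]; linarith
    _ ≤ δ := by rwa [one_mul]

/-- Uniform concentration of the weighted score around the moment at the target. -/
lemma exists_uniform_concentration {d : ℕ} (p : ℕ) (hd : 0 < d) {f : Vec d → ℝ}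
    (hf : ContinuousOn f (cube d)) {fmin fmax : ℝ} (hfmin : 0 < fmin)
    (hfb : ∀ y ∈ cube d, fmin ≤ f y ∧ f y ≤ fmax) (L R ψmax : ℝ) (hL : 0 ≤ L) (hR : 0 ≤ R)
    {ρ π γ : ℝ} (hρ : 0 < ρ) (hρ' : ρ ≤ 0.2) (hπ : 0 < π) (hπ' : π ≤ 1) (hγ : 0 < γ)
    {r : ℕ} (hr : 1 ≤ r) :
    ∃ C : ℝ, 0 ≤ C ∧ ∀ {l k : ℕ} {𝒵 : Type*} [MeasurableSpace 𝒵] (M : MomentModel d p l k 𝒵)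
      (x : Vec d) (_ : x ∈ cube d) (σ₀ : ℝ) (θ₀ : Vec p) (_ : M.Regular f L R σ₀ x θ₀)
      (n s s₂ B : ℕ) (_ : 1 ≤ s) (_ : s ≤ n) (_ : s₂ ≤ s) (_ : γ * s ≤ s₂) (_ : (n : ℝ) / s ≤ B)
      {Ωt : Type*} [MeasurableSpace Ωt] (ν : Measure Ωt) [IsProbabilityMeasure ν]
      (T : (Fin s → 𝒵) → Ωt → SplitTree d) (_ : IsForestLearner M ρ π r s s₂ ν T)
      {Ωa : Type*} [MeasurableSpace Ωa] (α : Measure Ωa) [IsProbabilityMeasure α]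
      (hhat : (Fin n → 𝒵) → Ωa → Vec d → Vec k → Vec l)
      (_ : Measurable fun q : ((Fin n → 𝒵) × Ωa) × Vec d × Vec k =>
        hhat q.1.1 q.1.2 q.2.1 q.2.2)
      (_ : ∀ᵐ q ∂((Measure.pi fun _ : Fin n => M.law).prod α), hhat q.1 q.2 ∈ M.H ∧
        ∀ z, ∀ θ ∈ M.Θ, ∀ j, |M.plugIn θ (hhat q.1 q.2) z j| ≤ ψmax)
      {Ω : Type*} [MeasurableSpace Ω] (P : Measure Ω)
      (D₁ D₂ : Ω → Fin n → 𝒵) (a : Ω → Ωa) (G : Ω → Fin B → (Fin s ↪ Fin n) × Ωt)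
      (_ : HasLaw (fun ω => (D₁ ω, D₂ ω, a ω, G ω)) (sampleLaw M n s B α ν) P)
      (δ : ℝ) (_ : 0 < δ) (_ : δ ≤ 1 / 2),
      P {ω | ¬ (hhat (D₂ ω) (a ω) ∈ M.H ∧ ∀ θ ∈ M.Θ,
          ‖weightedScore M s₂ T x (D₁ ω) (G ω) θ (hhat (D₂ ω) (a ω)) -
          M.moment x θ (hhat (D₂ ω) (a ω))‖ ≤
          C * ((s : ℝ) ^ (-rateExp d ρ π) + √(s * Real.log (n / (s * δ)) / n)))} ≤
        ENNReal.ofReal δ := by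
  obtain ⟨A, hA, hshrink⟩ := exists_shrinkage hd hf hfmin hfb hρ hρ' hπ hπ' hγ r
  -- No sign is known for `ψmax`, and the deviation bound needs a positive one.
  have hc : 0 < |ψmax| + 1 := by positivity
  obtain ⟨K, hK, hdev⟩ := exists_deviation_constant p hR hc
  refine ⟨4 * L * p + p * K + p * L * A, by positivity, ?_⟩
  intro l k 𝒵 _ M x hx σ₀ θ₀ hM n s s₂ B hs hsn hs₂ hγs hB Ωt _ ν _ T hT Ωa _ α _ hhat hhm hgood
    Ω _ P D₁ D₂ a G hlaw δ hδ hδ2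
  have hs' : (0 : ℝ) < s := Nat.cast_pos.2 hs
  have hsn' : (s : ℝ) ≤ n := Nat.cast_le.2 hsn
  have hn' : (0 : ℝ) < n := hs'.trans_le hsn'
  set Λ := Real.log (n / (s * δ))
  set S := √(s * Λ / n)
  have hgood' : ∀ᵐ q ∂((Measure.pi fun _ : Fin n => M.law).prod α), hhat q.1 q.2 ∈ M.H ∧
      ∀ z, ∀ θ ∈ M.Θ, ∀ j, |M.plugIn θ (hhat q.1 q.2) z j| ≤ |ψmax| + 1 := by
    filter_upwards [hgood] with q hq
    exact ⟨hq.1, fun z θ hθ j => (hq.2 z θ hθ j).trans (by linarith [le_abs_self ψmax])⟩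
  have hmain := measure_weightedScore_le M hM hx hL hr hs hsn hB ν hT α hhat hhm hc hgood'
    (hshrink M hM.density x hx s s₂ hs hs₂ hγs ν T hT) P D₁ D₂ a G hlaw
    (ε := s / n) (u := K * S) (by positivity) (by positivity)
  refine le_trans (measure_mono fun ω hω => ?_)
    (hmain.trans (ENNReal.ofReal_le_ofReal (hdev n s δ hs' hsn' hδ hδ2)))
  rw [Set.mem_ofPred_eq] at hω ⊢
  refine fun hω' => hω ⟨hω'.1, fun θ hθ => (hω'.2 θ hθ).trans ?_⟩
  have hΛ : 1 / 4 ≤ Λ := by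
    have h1 : 2 ≤ n / (s * δ) := by
      rw [le_div_iff₀ (by positivity)]
      nlinarith
    have h2 := Real.log_le_log two_pos h1
    linarith [Real.log_two_gt_d9]
  -- The mesh is absorbed by the deviation: `(s / n) ^ 2 / 4 ≤ (s / n) * Λ`, because `s ≤ n` and `Λ
  -- ≥ 1 / 4`.
  have hε : (s : ℝ) / n ≤ 2 * S := by
    have h1 : (s : ℝ) / n ≤ 1 := (div_le_one hn').2 hsn'
    have h0 : 0 ≤ (s : ℝ) / n := by positivity
    have h2 : ((s : ℝ) / n / 2) ^ 2 ≤ s * Λ / n := by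
      have : (s : ℝ) * Λ / n = s / n * Λ := by ring
      rw [this]
      nlinarith
    have h3 := Real.le_sqrt_of_sq_le h2
    linarith
  have hS : 0 ≤ S := Real.sqrt_nonneg _
  have hr0 : (0 : ℝ) ≤ (s : ℝ) ^ (-rateExp d ρ π) := by positivity
  have h1 : 2 * L * (p * ((s : ℝ) / n)) ≤ 2 * L * (p * (2 * S)) := by gcongr
  have h2 : 0 ≤ (4 * L * p + p * K) * (s : ℝ) ^ (-rateExp d ρ π) := by positivity
  have h3 : 0 ≤ p * L * A * S := by positivity
  nlinarith

end UniformConcentration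

end ORF

/-! ### Quadratic forms and eigenvalues -/

namespace ORF

open scoped Topology RealInnerProductSpace

section QuadraticForms

variable {E : Type*} [NormedAddCommGroup E] [InnerProductSpace ℝ E] [FiniteDimensional ℝ E]

lemma inner_apply_self_eq_sum {A : E →ₗ[ℝ] E} (hA : A.IsSymmetric) (v : E) :
    ⟪A v, v⟫ = ∑ i, hA.eigenvalues rfl i * ⟪hA.eigenvectorBasis rfl i, v⟫ ^ 2 := by
  rw [← (hA.eigenvectorBasis rfl).sum_inner_mul_inner (A v) v]
  refine Finset.sum_congr rfl fun i _ => ?_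
  rw [hA v, hA.apply_eigenvectorBasis rfl i, inner_smul_right, real_inner_comm]
  simp only [RCLike.ofReal_real_eq_id, id]
  ring

lemma mul_norm_sq_le_inner_apply_self {A : E →ₗ[ℝ] E} (hA : A.IsSymmetric) {c : ℝ}
    (hc : ∀ e, Module.End.HasEigenvalue A e → c ≤ e) (v : E) : c * ‖v‖ ^ 2 ≤ ⟪A v, v⟫ := by
  rw [inner_apply_self_eq_sum hA, ← (hA.eigenvectorBasis rfl).sum_sq_norm_inner_right v,
    Finset.mul_sum]
  refine Finset.sum_le_sum fun i _ => ?_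
  rw [Real.norm_eq_abs, sq_abs]
  exact mul_le_mul_of_nonneg_right (hc _ (hA.hasEigenvalue_eigenvalues rfl i)) (sq_nonneg _)

lemma abs_inner_apply_self_le {A : E →ₗ[ℝ] E} (hA : A.IsSymmetric) {c : ℝ}
    (hc : ∀ e, Module.End.HasEigenvalue A e → |e| ≤ c) (v : E) : |⟪A v, v⟫| ≤ c * ‖v‖ ^ 2 := by
  rw [inner_apply_self_eq_sum hA, ← (hA.eigenvectorBasis rfl).sum_sq_norm_inner_right v,
    Finset.mul_sum]
  refine (Finset.abs_sum_le_sum_abs _ _).trans (Finset.sum_le_sum fun i _ => ?_)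
  rw [Real.norm_eq_abs, sq_abs, abs_mul, abs_of_nonneg (a := _ ^ 2) (sq_nonneg _)]
  exact mul_le_mul_of_nonneg_right (hc _ (hA.hasEigenvalue_eigenvalues rfl i)) (sq_nonneg _)

/-- The eigenvalue bound concerns `Matrix.toLin'`, on functions without an inner product. It is
carried over to the Euclidean operator, to which the spectral theorem applies. -/
lemma abs_sum_matrix_le {ι : Type*} [Fintype ι] [DecidableEq ι] {A : Matrix ι ι ℝ}
    (hA : ∀ a b, A a b = A b a) {c : ℝ}
    (hc : ∀ e, Module.End.HasEigenvalue (Matrix.toLin' A) e → |e| ≤ c) (v : ι → ℝ) :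
    |∑ a, ∑ b, v a * v b * A a b| ≤ c * ∑ a, v a ^ 2 := by
  have hH : A.IsHermitian := by
    ext a b
    simpa using hA b a
  have hS := Matrix.isSymmetric_toEuclideanLin_iff.2 hH
  have h := abs_inner_apply_self_le hS (c := c) (fun e he => hc e ?_) (WithLp.toLp 2 v)
  · rw [EuclideanSpace.norm_sq_eq] at h
    have h2 : ⟪Matrix.toEuclideanLin A (WithLp.toLp 2 v), WithLp.toLp 2 v⟫ =
        ∑ a, ∑ b, v a * v b * A a b := by
      simp only [Matrix.toLpLin_apply, PiLp.inner_apply, Matrix.mulVec, dotProduct]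
      refine Finset.sum_congr rfl fun a _ => ?_
      simp only [RCLike.inner_apply, conj_trivial, Finset.mul_sum]
      exact Finset.sum_congr rfl fun b _ => by ring
    rw [h2] at h
    simpa using h
  · obtain ⟨u, hu⟩ := he.exists_hasEigenvector
    refine Module.End.hasEigenvalue_of_hasEigenvector (x := WithLp.ofLp u) ⟨?_, ?_⟩
    · rw [Module.End.mem_eigenspace_iff]
      have := hu.apply_eq_smul
      have h3 := congrArg WithLp.ofLp this
      simpa [Matrix.toLpLin_apply] using h3
    · intro h0
      exact hu.2 (by ext i; exact congrFun h0 i)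

end QuadraticForms

/-! ### Measurability and bounds for derivatives of the score -/

section DerivMeasurable

/-- The derivative of a family of measurable functions with respect to a parameter is measurable. -/
lemma measurable_of_hasDerivAt {Z : Type*} [MeasurableSpace Z] {F : ℝ → Z → ℝ} {F' : Z → ℝ}
    {t₀ : ℝ} (hF : ∀ᶠ t in 𝓝 t₀, Measurable (F t)) (h : ∀ z, HasDerivAt (fun t => F t z) (F' z) t₀) :
    Measurable F' := by
  classical
  have h0 : Measurable (F t₀) := hF.self_of_nhds
  -- Difference quotients converge to the derivative. They are measurable only for `t` near `t₀`, so
  -- they are replaced by zero wherever measurability fails.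
  set S : ℝ → Z → ℝ := fun t z => if Measurable (F t) then slope (fun t => F t z) t₀ t else 0
  have hS : ∀ t, Measurable (S t) := by
    intro t
    by_cases ht : Measurable (F t)
    · simp only [S, if_pos ht, slope, vsub_eq_sub, smul_eq_mul]
      exact (ht.sub h0).const_mul _
    · simp only [S, if_neg ht]
      exact measurable_const
  refine measurable_of_tendsto_metrizable' (𝓝[≠] t₀) hS (tendsto_pi_nhds.2 fun z => ?_)
  refine (hasDerivAt_iff_tendsto_slope.1 (h z)).congr' ?_
  filter_upwards [hF.filter_mono nhdsWithin_le_nhds] with t ht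
  simp only [S, if_pos ht]

end DerivMeasurable

section ScoreCalculus

variable {d p l k : ℕ} {𝒵 : Type*} [MeasurableSpace 𝒵] {M : MomentModel d p l k 𝒵}
  {f : Vec d → ℝ} {L R σ₀ : ℝ} {x : Vec d} {θ₀ : Vec p}

namespace MomentModel

variable (M) in
/-- The `j`-th coordinate of the score, as a function of the parameter and the nuisance value. -/
def scoreCoord (j : Fin p) (z : 𝒵) (q : Vec p × Vec l) : ℝ := M.score z q.1 q.2 j

variable (M) in
/-- The domain on which the score is regular. -/
def dom : Set (Vec p × Vec l) := M.domθ ×ˢ M.domξ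

lemma isOpen_dom : IsOpen M.dom := M.isOpen_domθ.prod M.isOpen_domξ

lemma convex_dom : Convex ℝ M.dom := M.convex_domθ.prod M.convex_domξ

lemma measurable_scoreCoord {q : 𝒵 → Vec p × Vec l} (hq : Measurable q) (j : Fin p) :
    Measurable fun z => M.scoreCoord j z (q z) :=
  (EuclideanSpace.proj (𝕜 := ℝ) j).continuous.measurable.comp
    (M.measurable_score.comp (measurable_id.prodMk (hq.fst.prodMk hq.snd)))

lemma Regular.contDiffAt_score (hM : M.Regular f L R σ₀ x θ₀) (z : 𝒵) {q : Vec p × Vec l}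
    (hq : q ∈ M.dom) : ContDiffAt ℝ 2 (fun q : Vec p × Vec l => M.score z q.1 q.2) q :=
  (hM.contDiffOn z).contDiffAt (isOpen_dom.mem_nhds hq)

lemma Regular.contDiffAt_scoreCoord (hM : M.Regular f L R σ₀ x θ₀) (j : Fin p) (z : 𝒵)
    {q : Vec p × Vec l} (hq : q ∈ M.dom) : ContDiffAt ℝ 2 (M.scoreCoord j z) q :=
  (EuclideanSpace.proj (𝕜 := ℝ) j).contDiff.contDiffAt.comp q (hM.contDiffAt_score z hq)

lemma Regular.abs_scoreCoord_sub_le (hM : M.Regular f L R σ₀ x θ₀) (j : Fin p) (z : 𝒵)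
    {q q' : Vec p × Vec l} (hq : q ∈ M.dom) (hq' : q' ∈ M.dom) :
    |M.scoreCoord j z q' - M.scoreCoord j z q| ≤ L * (‖q'.1 - q.1‖ + ‖q'.2 - q.2‖) := by
  have h1 := hM.lipschitz_θ z q'.2 hq'.2 q'.1 hq'.1 q.1 hq.1
  have h2 := hM.lipschitz_ξ z q.1 hq.1 q'.2 hq'.2 q.2 hq.2
  calc |M.scoreCoord j z q' - M.scoreCoord j z q|
      ≤ ‖M.score z q'.1 q'.2 - M.score z q.1 q.2‖ :=
        PiLp.norm_apply_le (M.score z q'.1 q'.2 - M.score z q.1 q.2) j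
    _ = ‖(M.score z q'.1 q'.2 - M.score z q.1 q'.2) +
          (M.score z q.1 q'.2 - M.score z q.1 q.2)‖ := by congr 1; abel
    _ ≤ _ := (norm_add_le _ _).trans (by linarith)

lemma hasDerivAt_line {E F : Type*} [NormedAddCommGroup E] [NormedSpace ℝ E]
    [NormedAddCommGroup F] [NormedSpace ℝ F] {g : E → F} {q v : E} {t : ℝ}
    (hg : DifferentiableAt ℝ g (q + t • v)) :
    HasDerivAt (fun t : ℝ => g (q + t • v)) (fderiv ℝ g (q + t • v) v) t := by
  have h : HasDerivAt (fun t : ℝ => q + t • v) v t := by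
    simpa using ((hasDerivAt_id t).smul_const v).const_add q
  exact hg.hasFDerivAt.comp_hasDerivAt t h

lemma eventually_line_mem {q v : Vec p × Vec l} {t : ℝ} (h : q + t • v ∈ M.dom) :
    ∀ᶠ t' in 𝓝 t, q + t' • v ∈ M.dom :=
  ((continuous_const.add (continuous_id.smul continuous_const)).continuousAt (x := t)).eventually_mem
    (isOpen_dom.mem_nhds h)

lemma Regular.hasDerivAt_scoreCoord (hM : M.Regular f L R σ₀ x θ₀) (j : Fin p) (z : 𝒵)
    {q v : Vec p × Vec l} {t : ℝ} (hq : q + t • v ∈ M.dom) :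
    HasDerivAt (fun t : ℝ => M.scoreCoord j z (q + t • v))
      (fderiv ℝ (M.scoreCoord j z) (q + t • v) v) t :=
  hasDerivAt_line ((hM.contDiffAt_scoreCoord j z hq).differentiableAt two_ne_zero)

lemma Regular.hasDerivAt_fderiv_scoreCoord (hM : M.Regular f L R σ₀ x θ₀) (j : Fin p) (z : 𝒵)
    {q v w : Vec p × Vec l} {t : ℝ} (hq : q + t • v ∈ M.dom) :
    HasDerivAt (fun t : ℝ => fderiv ℝ (M.scoreCoord j z) (q + t • v) w)
      (M.score_fderiv2 j z (q + t • v) v w) t := by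
  have h : DifferentiableAt ℝ (fderiv ℝ (M.scoreCoord j z)) (q + t • v) :=
    ((hM.contDiffAt_scoreCoord j z hq).fderiv_right (m := 1) (by norm_num)).differentiableAt
      one_ne_zero
  exact (ContinuousLinearMap.apply ℝ ℝ w).hasFDerivAt.comp_hasDerivAt t (hasDerivAt_line h)

lemma Regular.abs_fderiv_scoreCoord_le (hM : M.Regular f L R σ₀ x θ₀) (hL : 0 ≤ L) (j : Fin p)
    (z : 𝒵) {q : Vec p × Vec l} (hq : q ∈ M.dom) (v : Vec p × Vec l) :
    |fderiv ℝ (M.scoreCoord j z) q v| ≤ L * (‖v.1‖ + ‖v.2‖) := by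
  have hq0 : q + (0 : ℝ) • v ∈ M.dom := by simpa using hq
  have h := hM.hasDerivAt_scoreCoord j z hq0
  have h2 := h.le_of_lip' (C := L * (‖v.1‖ + ‖v.2‖)) (by positivity) (by
    filter_upwards [eventually_line_mem hq0] with t ht
    refine (hM.abs_scoreCoord_sub_le j z hq0 ht).trans_eq ?_
    simp [norm_smul]
    ring)
  simpa using h2

lemma Regular.measurable_fderiv_scoreCoord (hM : M.Regular f L R σ₀ x θ₀) (j : Fin p)
    {q v : 𝒵 → Vec p × Vec l} (hq : Measurable q) (hv : Measurable v) (hdom : ∀ z, q z ∈ M.dom) :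
    Measurable fun z => fderiv ℝ (M.scoreCoord j z) (q z) (v z) := by
  refine measurable_of_hasDerivAt (F := fun t z => M.scoreCoord j z (q z + t • v z)) (t₀ := 0)
    (Filter.Eventually.of_forall fun t => measurable_scoreCoord (hq.add (hv.const_smul t)) j)
    fun z => ?_
  have h := hM.hasDerivAt_scoreCoord j z (q := q z) (v := v z) (t := 0) (by simpa using hdom z)
  simpa using h

lemma Regular.measurable_score_fderiv2 (hM : M.Regular f L R σ₀ x θ₀) (j : Fin p)
    {q : Vec p × Vec l} (hq : q ∈ M.dom) (v w : Vec p × Vec l) :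
    Measurable fun z => M.score_fderiv2 j z q v w := by
  have hq0 : q + (0 : ℝ) • v ∈ M.dom := by simpa using hq
  refine measurable_of_hasDerivAt
    (F := fun t z => fderiv ℝ (M.scoreCoord j z) (q + t • v) w) (t₀ := 0) ?_ fun z => ?_
  · filter_upwards [eventually_line_mem hq0] with t ht
    exact hM.measurable_fderiv_scoreCoord j measurable_const measurable_const fun _ => ht
  · simpa using hM.hasDerivAt_fderiv_scoreCoord j z (w := w) hq0

lemma Regular.score_fderiv2_comm (hM : M.Regular f L R σ₀ x θ₀) (j : Fin p) (z : 𝒵)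
    {q : Vec p × Vec l} (hq : q ∈ M.dom) (v w : Vec p × Vec l) :
    M.score_fderiv2 j z q v w = M.score_fderiv2 j z q w v :=
  ((hM.contDiffAt_scoreCoord j z hq).isSymmSndFDerivAt (by simp)) v w

end MomentModel

end ScoreCalculus

end ORF

/-! ### Second order expansion given the controls -/

namespace ORF

open scoped Topology RealInnerProductSpace

section CondRemainder

variable {d p l k : ℕ} {𝒵 : Type*} [MeasurableSpace 𝒵] {M : MomentModel d p l k 𝒵}
  {f : Vec d → ℝ} {L R σ₀ : ℝ} {x : Vec d} {θ₀ : Vec p}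

namespace MomentModel

variable (M) in
/-- The conditional law of `Z` given `(X, W) = (x, w)` admits the expected Hessians at `x` with the
bounds of the regularity assumptions. -/
def HessianRegular (L : ℝ) (x : Vec d) (w : Vec k) : Prop :=
  (∀ j, ∀ q ∈ M.dom, ∃ V ∈ 𝓝 q, ∃ g : 𝒵 → ℝ, Integrable g (M.obsKernel (x, w)) ∧
      ∀ᵐ z ∂(M.obsKernel (x, w)), ∀ q' ∈ V, ‖M.score_fderiv2 j z q'‖ ≤ g z) ∧
  ∀ j, ∀ q ∈ M.dom, ∀ c : ℝ,
    Module.End.HasEigenvalue (Matrix.toLin' (M.expHessian j x w q)) c → |c| ≤ L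

lemma Regular.ae_hessianRegular (hM : M.Regular f L R σ₀ x θ₀) :
    ∀ᵐ w ∂(M.confKernel x), M.HessianRegular L x w := by
  filter_upwards [hM.dominated, hM.hessian_bound] with w h1 h2 using ⟨h1, h2⟩

variable {w : Vec k}

lemma Regular.integrable_score_fderiv2 (hM : M.Regular f L R σ₀ x θ₀)
    (hw : M.HessianRegular L x w) (j : Fin p) {q : Vec p × Vec l} (hq : q ∈ M.dom)
    (v v' : Vec p × Vec l) :
    Integrable (fun z => M.score_fderiv2 j z q v v') (M.obsKernel (x, w)) := by
  obtain ⟨V, hV, g, hg, hb⟩ := hw.1 j q hq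
  refine (hg.mul_const (‖v‖ * ‖v'‖)).mono'
    (hM.measurable_score_fderiv2 j hq v v').aestronglyMeasurable ?_
  filter_upwards [hb] with z hz
  calc ‖M.score_fderiv2 j z q v v'‖ ≤ ‖M.score_fderiv2 j z q‖ * ‖v‖ * ‖v'‖ :=
        ContinuousLinearMap.le_opNorm₂ _ _ _
    _ ≤ g z * ‖v‖ * ‖v'‖ := by gcongr; exact hz q (mem_of_mem_nhds hV)
    _ = _ := by ring

lemma eq_sum_stdVec {p l : ℕ} (v : Vec p × Vec l) :
    v = ∑ a : Fin p ⊕ Fin l, Sum.elim (fun i => v.1 i) (fun i => v.2 i) a • stdVec a := by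
  rw [Fintype.sum_sum_type]
  simp only [stdVec, Sum.elim_inl, Sum.elim_inr, Prod.smul_mk, smul_zero]
  ext i
  · simp [Prod.fst_sum, Finset.sum_apply, Pi.single_apply]
  · simp [Prod.snd_sum, Finset.sum_apply, Pi.single_apply]

/-- The expected second derivative is bounded through the eigenvalues of the expected Hessian. -/
lemma Regular.abs_integral_score_fderiv2_le (hM : M.Regular f L R σ₀ x θ₀)
    (hw : M.HessianRegular L x w) (j : Fin p) {q : Vec p × Vec l} (hq : q ∈ M.dom)
    (v : Vec p × Vec l) :
    |∫ z, M.score_fderiv2 j z q v v ∂(M.obsKernel (x, w))| ≤ L * (‖v.1‖ ^ 2 + ‖v.2‖ ^ 2) := by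
  set c : Fin p ⊕ Fin l → ℝ := Sum.elim (fun i => v.1 i) (fun i => v.2 i)
  have hc : ∑ a, c a ^ 2 = ‖v.1‖ ^ 2 + ‖v.2‖ ^ 2 := by
    rw [Fintype.sum_sum_type, EuclideanSpace.norm_sq_eq, EuclideanSpace.norm_sq_eq]
    simp [c]
  have hexp : ∀ z, M.score_fderiv2 j z q v v =
      ∑ a, ∑ b, c a * c b * M.score_fderiv2 j z q (stdVec a) (stdVec b) := by
    intro z
    conv_lhs => rw [eq_sum_stdVec v]
    simp only [map_sum, map_smul, sum_apply, smul_apply,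
      smul_eq_mul, Finset.mul_sum]
    rw [Finset.sum_comm]
    refine Finset.sum_congr rfl fun a _ => Finset.sum_congr rfl fun b _ => ?_
    simp only [c]
    ring
  simp_rw [hexp]
  rw [integral_finsetSum _ fun a _ => integrable_finsetSum _ fun b _ =>
    (hM.integrable_score_fderiv2 hw j hq _ _).const_mul _]
  simp_rw [integral_finsetSum _ fun b _ =>
    (hM.integrable_score_fderiv2 hw j hq _ (stdVec b)).const_mul _, integral_const_mul]
  rw [← hc]
  refine abs_sum_matrix_le (A := M.expHessian j x w q) (fun a b => ?_) (hw.2 j q hq) c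
  simp only [expHessian, Matrix.of_apply]
  exact integral_congr_ae (Filter.Eventually.of_forall fun z => hM.score_fderiv2_comm j z hq _ _)

/-- Second order expansion of the conditionally expected score. -/
lemma Regular.abs_integral_remainder_le (hM : M.Regular f L R σ₀ x θ₀) (hL : 0 ≤ L)
    (hw : M.HessianRegular L x w) (j : Fin p) {q q' : Vec p × Vec l} (hq : q ∈ M.dom)
    (hq' : q' ∈ M.dom) :
    |∫ z, (M.scoreCoord j z q' - M.scoreCoord j z q - fderiv ℝ (M.scoreCoord j z) q (q' - q))
      ∂(M.obsKernel (x, w))| ≤ L * (‖q'.1 - q.1‖ ^ 2 + ‖q'.2 - q.2‖ ^ 2) := by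
  set O := M.obsKernel (x, w)
  set v := q' - q
  have hv1 : q + (1 : ℝ) • v = q' := by simp [v]
  have hv0 : q + (0 : ℝ) • v = q := by simp
  have hseg : ∀ t ∈ Set.Icc (0 : ℝ) 1, q + t • v ∈ M.dom := fun t ht =>
    convex_dom.add_smul_sub_mem hq hq' ht
  have hCL : 0 ≤ L * (‖v.1‖ + ‖v.2‖) := by positivity
  set D : ℝ → 𝒵 → ℝ := fun t z => fderiv ℝ (M.scoreCoord j z) (q + t • v) v
  have hDm : ∀ t, q + t • v ∈ M.dom → Measurable (D t) := fun t ht =>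
    hM.measurable_fderiv_scoreCoord j measurable_const measurable_const fun _ => ht
  have hDb : ∀ t, q + t • v ∈ M.dom → ∀ z, |D t z| ≤ L * (‖v.1‖ + ‖v.2‖) := fun t ht z =>
    hM.abs_fderiv_scoreCoord_le hL j z ht v
  have hDi : ∀ t, q + t • v ∈ M.dom → Integrable (D t) O := fun t ht =>
    Integrable.of_bound (hDm t ht).aestronglyMeasurable _ (Filter.Eventually.of_forall (hDb t ht))
  -- The Hessian is bounded only after integration, so Taylor's formula is applied to the expected
  -- remainder `r` and not pointwise.
  set r : ℝ → ℝ := fun t => ∫ z, (M.scoreCoord j z (q + t • v) - M.scoreCoord j z q - t * D 0 z) ∂O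
  have hrm : ∀ t, Measurable fun z =>
      M.scoreCoord j z (q + t • v) - M.scoreCoord j z q - t * D 0 z := fun t =>
    ((measurable_scoreCoord measurable_const j).sub (measurable_scoreCoord measurable_const j)).sub
      ((hDm 0 (hseg 0 (by simp))).const_mul t)
  have hnear : ∀ t₀ ∈ Set.Icc (0 : ℝ) 1, ∀ᶠ t in 𝓝 t₀, q + t • v ∈ M.dom := fun t₀ ht₀ =>
    eventually_line_mem (hseg t₀ ht₀)
  -- The first differentiation under the integral is dominated through the Lipschitz bound of the
  -- score, the second, in `hD'`, through the local domination of the Hessian.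
  have hr' : ∀ t ∈ Set.Icc (0 : ℝ) 1, HasDerivAt r (∫ z, (D t z - D 0 z) ∂O) t := by
    intro t₀ ht₀
    refine (hasDerivAt_integral_of_dominated_loc_of_deriv_le (hnear t₀ ht₀)
      (F' := fun t z => D t z - D 0 z) (bound := fun _ => 2 * (L * (‖v.1‖ + ‖v.2‖)))
      (Filter.Eventually.of_forall fun t => (hrm t).aestronglyMeasurable) ?_
      ((hDm t₀ (hseg t₀ ht₀)).sub (hDm 0 (hseg 0 (by simp)))).aestronglyMeasurable ?_
      (integrable_const _) ?_).2
    · refine Integrable.of_bound (C := 2 * (L * (‖v.1‖ + ‖v.2‖))) (hrm t₀).aestronglyMeasurable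
        (Filter.Eventually.of_forall fun z => ?_)
      have h1 := hM.abs_scoreCoord_sub_le j z hq (hseg t₀ ht₀)
      have h2 : |t₀ * D 0 z| ≤ L * (‖v.1‖ + ‖v.2‖) := by
        rw [abs_mul, abs_of_nonneg ht₀.1]
        exact (mul_le_of_le_one_left (abs_nonneg _) ht₀.2).trans (hDb 0 (hseg 0 (by simp)) z)
      have h3 : L * (‖(q + t₀ • v).1 - q.1‖ + ‖(q + t₀ • v).2 - q.2‖) ≤ L * (‖v.1‖ + ‖v.2‖) := by
        refine mul_le_mul_of_nonneg_left ?_ hL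
        simp only [Prod.fst_add, Prod.smul_fst, Prod.snd_add, Prod.smul_snd, add_sub_cancel_left,
          norm_smul, Real.norm_eq_abs, abs_of_nonneg ht₀.1]
        exact add_le_add (mul_le_of_le_one_left (norm_nonneg _) ht₀.2)
          (mul_le_of_le_one_left (norm_nonneg _) ht₀.2)
      refine (norm_sub_le _ _).trans ?_
      rw [Real.norm_eq_abs, Real.norm_eq_abs]
      linarith
    · refine Filter.Eventually.of_forall fun z t ht => (norm_sub_le _ _).trans ?_
      rw [Real.norm_eq_abs, Real.norm_eq_abs]
      linarith [hDb t ht z, hDb 0 (hseg 0 (by simp)) z]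
    · refine Filter.Eventually.of_forall fun z t ht => ?_
      have h1 := ((hM.hasDerivAt_scoreCoord j z ht).sub_const (M.scoreCoord j z q)).sub
        ((hasDerivAt_id t).mul_const (D 0 z))
      rw [one_mul] at h1
      exact h1
  have hD' : ∀ t ∈ Set.Icc (0 : ℝ) 1, HasDerivAt (fun t => ∫ z, D t z ∂O)
      (∫ z, M.score_fderiv2 j z (q + t • v) v v ∂O) t := by
    intro t₀ ht₀
    obtain ⟨V, hV, g, hg, hb⟩ := hw.1 j _ (hseg t₀ ht₀)
    have hVt : ∀ᶠ t in 𝓝 t₀, q + t • v ∈ V :=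
      (continuous_const.add (continuous_id.smul continuous_const)).continuousAt (x := t₀) hV
    refine (hasDerivAt_integral_of_dominated_loc_of_deriv_le ((hnear t₀ ht₀).and hVt)
      (F' := fun t z => M.score_fderiv2 j z (q + t • v) v v)
      (bound := fun z => g z * ‖v‖ * ‖v‖)
      ((hnear t₀ ht₀).mono fun t ht => (hDm t ht).aestronglyMeasurable) (hDi t₀ (hseg t₀ ht₀))
      (hM.measurable_score_fderiv2 j (hseg t₀ ht₀) v v).aestronglyMeasurable ?_
      ((hg.mul_const _).mul_const _) ?_).2
    · filter_upwards [hb] with z hz t ht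
      refine (ContinuousLinearMap.le_opNorm₂ _ _ _).trans ?_
      gcongr
      exact hz _ ht.2
    · exact Filter.Eventually.of_forall fun z t ht => hM.hasDerivAt_fderiv_scoreCoord j z ht.1
  set K := L * (‖v.1‖ ^ 2 + ‖v.2‖ ^ 2)
  have hK : 0 ≤ K := by positivity
  -- The derivative of `∫ D t` is bounded by `K`, so the increment is at most `K * t ≤ K`; the
  -- factor `1 / 2` of Taylor's formula is given away.
  have hDd : ∀ t ∈ Set.Icc (0 : ℝ) 1, |∫ z, (D t z - D 0 z) ∂O| ≤ K := by
    intro t ht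
    rw [integral_sub (hDi t (hseg t ht)) (hDi 0 (hseg 0 (by simp)))]
    have h := (convex_Icc (0 : ℝ) 1).norm_image_sub_le_of_norm_hasDerivWithin_le
      (fun s hs => (hD' s hs).hasDerivWithinAt)
      (fun s hs => hM.abs_integral_score_fderiv2_le hw j (hseg s hs) v)
      (Set.left_mem_Icc.2 zero_le_one) ht
    refine h.trans (mul_le_of_le_one_right hK ?_)
    rw [sub_zero, Real.norm_eq_abs, abs_of_nonneg ht.1]
    exact ht.2
  have hfin := norm_image_sub_le_of_norm_deriv_le_segment_01'
    (fun t ht => (hr' t ht).hasDerivWithinAt) (fun t ht => hDd t ⟨ht.1, ht.2.le⟩)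
  have hr0 : r 0 = 0 := by simp [r]
  have hr1 : r 1 = ∫ z, (M.scoreCoord j z q' - M.scoreCoord j z q -
      fderiv ℝ (M.scoreCoord j z) q (q' - q)) ∂O := by
    simp only [r, D, hv1, hv0, one_mul, v]
  rw [hr0, sub_zero, hr1] at hfin
  exact hfin

end MomentModel

end CondRemainder

end ORF

/-! ### Expansion of the moment in the parameter and the nuisance -/

namespace ORF

open scoped Topology RealInnerProductSpace

section RootMeanSquare

/-- The first moment follows from the second because the variance of `‖g‖` is nonnegative. -/
lemma integral_norm_le_of_eLpNorm_two_le {α : Type*} [MeasurableSpace α] {P : Measure α}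
    [IsProbabilityMeasure P] {l : ℕ} {g : α → Vec l} (hg : AEStronglyMeasurable g P) {χ : ℝ}
    (hχ : 0 ≤ χ) (h : eLpNorm g 2 P ≤ ENNReal.ofReal χ) :
    Integrable (fun a => ‖g a‖) P ∧ Integrable (fun a => ‖g a‖ ^ 2) P ∧
      ∫ a, ‖g a‖ ∂P ≤ χ ∧ ∫ a, ‖g a‖ ^ 2 ∂P ≤ χ ^ 2 := by
  have hm : MemLp g 2 P := ⟨hg, h.trans_lt ENNReal.ofReal_lt_top⟩
  have h1 : Integrable (fun a => ‖g a‖) P := (hm.integrable one_le_two).norm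
  have h2 : Integrable (fun a => ‖g a‖ ^ 2) P := (memLp_two_iff_integrable_sq_norm hg).1 hm
  have h3 : ∫ a, ‖g a‖ ^ 2 ∂P ≤ χ ^ 2 := by
    rw [hm.eLpNorm_eq_integral_rpow_norm two_ne_zero ENNReal.ofNat_ne_top,
      ENNReal.ofReal_le_ofReal_iff hχ] at h
    simp only [ENNReal.toReal_ofNat, Real.rpow_ofNat] at h
    rw [← one_div, ← Real.sqrt_eq_rpow] at h
    exact (Real.sqrt_le_left hχ).1 h
  refine ⟨h1, h2, ?_, h3⟩
  set m := ∫ a, ‖g a‖ ∂P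
  have h4 : 0 ≤ ∫ a, (‖g a‖ - m) ^ 2 ∂P := integral_nonneg fun a => sq_nonneg _
  have h5 : ∫ a, (‖g a‖ - m) ^ 2 ∂P = ∫ a, ‖g a‖ ^ 2 ∂P - m ^ 2 := by
    have : ∀ a, (‖g a‖ - m) ^ 2 = ‖g a‖ ^ 2 - (2 * m) * ‖g a‖ + m ^ 2 := fun a => by ring
    simp_rw [this]
    have h6 : Integrable (fun a => ‖g a‖ ^ 2 - 2 * m * ‖g a‖) P := h2.sub (h1.const_mul _)
    rw [integral_add h6 (integrable_const _), integral_sub h2 (h1.const_mul _), integral_const_mul]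
    simp only [integral_const, probReal_univ, one_smul]
    change _ - 2 * m * m + _ = _
    ring
  exact abs_le_of_sq_le_sq' (by linarith) hχ |>.2

end RootMeanSquare

section Expansion

variable {d p l k : ℕ} {𝒵 : Type*} [MeasurableSpace 𝒵] {M : MomentModel d p l k 𝒵}
  {f : Vec d → ℝ} {L R σ₀ : ℝ} {x : Vec d} {θ₀ : Vec p}

namespace MomentModel

/-- Lets the nuisance error, given through the law of the controls, be integrated against the law of
the observation. -/
lemma map_conf_condLaw (hx : x ∈ cube d) : (M.condLaw x).map M.conf = M.confKernel x := by
  ext A hA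
  rw [Measure.map_apply M.measurable_conf hA,
    ← lintegral_indicator_one (M.measurable_conf hA),
    M.lintegral_condLaw (measurable_one.indicator (M.measurable_conf hA)),
    ← lintegral_indicator_one hA]
  refine lintegral_congr_ae ?_
  filter_upwards [M.consistent x hx] with w hw
  have : ∀ᵐ z ∂(M.obsKernel (x, w)), (M.conf ⁻¹' A).indicator (1 : 𝒵 → ENNReal) z =
      A.indicator 1 w := by
    filter_upwards [hw] with z hz
    rw [← hz.2]; rfl
  rw [lintegral_congr_ae this]
  simp

variable (M) in
/-- The point at which the score is evaluated. -/
def evalPoint (θ : Vec p) (h : Vec d → Vec k → Vec l) (z : 𝒵) : Vec p × Vec l :=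
  (θ, h (M.feat z) (M.conf z))

lemma measurable_evalPoint (θ : Vec p) {h : Vec d → Vec k → Vec l} (hh : h ∈ M.H) :
    Measurable (M.evalPoint θ h) :=
  measurable_const.prodMk
    ((M.measurable_of_mem h hh).comp (M.measurable_feat.prodMk M.measurable_conf))

lemma evalPoint_mem {θ : Vec p} (hθ : θ ∈ M.domθ) {h : Vec d → Vec k → Vec l} (hh : h ∈ M.H)
    (z : 𝒵) : M.evalPoint θ h z ∈ M.dom :=
  ⟨hθ, M.maps_of_mem h hh _ (M.feat_mem z) _⟩

/-- Integrability is assumed on `Θ` only and is extended by the Lipschitz bound. The larger domain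
is needed because the inversion moves along segments, which may leave `Θ` but not the convex set
`domθ`. -/
lemma Regular.integrable_plugIn (hM : M.Regular f L R σ₀ x θ₀) (hx : x ∈ cube d) {θ : Vec p}
    (hθ : θ ∈ M.domθ) {h : Vec d → Vec k → Vec l} (hh : h ∈ M.H) :
    Integrable (M.plugIn θ h) (M.condLaw x) := by
  have hm : ∀ θ, Measurable (M.plugIn θ h) := fun θ =>
    M.measurable_score.comp (measurable_id.prodMk (measurable_evalPoint θ hh))
  have h1 := hM.integrable x hx θ₀ hM.θ₀_mem h hh
  have h2 : Integrable (fun z => M.plugIn θ h z - M.plugIn θ₀ h z) (M.condLaw x) :=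
    Integrable.of_bound (C := L * ‖θ - θ₀‖) ((hm θ).sub (hm θ₀)).aestronglyMeasurable
      (Filter.Eventually.of_forall fun z => hM.lipschitz_θ z _
        (M.maps_of_mem h hh _ (M.feat_mem z) _) θ hθ θ₀ (M.Θ_subset hM.θ₀_mem))
  exact (h2.add h1).congr (Filter.Eventually.of_forall fun z => sub_add_cancel _ _)

lemma Regular.moment_eq_integral (hM : M.Regular f L R σ₀ x θ₀) (hx : x ∈ cube d) {θ : Vec p}
    (hθ : θ ∈ M.domθ) {h : Vec d → Vec k → Vec l} (hh : h ∈ M.H) (j : Fin p) :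
    M.moment x θ h j = ∫ z, M.scoreCoord j z (M.evalPoint θ h z) ∂(M.condLaw x) :=
  ((EuclideanSpace.proj (𝕜 := ℝ) j).integral_comp_comm (hM.integrable_plugIn hx hθ hh)).symm

lemma Regular.integrable_scoreCoord (hM : M.Regular f L R σ₀ x θ₀) (hx : x ∈ cube d) {θ : Vec p}
    (hθ : θ ∈ M.domθ) {h : Vec d → Vec k → Vec l} (hh : h ∈ M.H) (j : Fin p) :
    Integrable (fun z => M.scoreCoord j z (M.evalPoint θ h z)) (M.condLaw x) :=
  (EuclideanSpace.proj (𝕜 := ℝ) j).integrable_comp (hM.integrable_plugIn hx hθ hh)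

lemma Regular.integrable_fderiv_scoreCoord (hM : M.Regular f L R σ₀ x θ₀) (hL : 0 ≤ L) {θ : Vec p}
    (hθ : θ ∈ M.domθ) {h : Vec d → Vec k → Vec l} (hh : h ∈ M.H) (j : Fin p) (v : Vec p) :
    Integrable (fun z => fderiv ℝ (M.scoreCoord j z) (M.evalPoint θ h z) (v, 0)) (M.condLaw x) :=
  Integrable.of_bound (C := L * ‖v‖) (hM.measurable_fderiv_scoreCoord j (measurable_evalPoint θ hh)
    measurable_const (evalPoint_mem hθ hh)).aestronglyMeasurable
    (Filter.Eventually.of_forall fun z => by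
      simpa using hM.abs_fderiv_scoreCoord_le hL j z (evalPoint_mem hθ hh z) (v, 0))

lemma Regular.fderiv_score_left_apply (hM : M.Regular f L R σ₀ x θ₀) (j : Fin p) (z : 𝒵)
    {q : Vec p × Vec l} (hq : q ∈ M.dom) :
    HasFDerivAt (fun θ => M.score z θ q.2) (fderiv ℝ (fun θ => M.score z θ q.2) q.1) q.1 ∧
    ∀ v, fderiv ℝ (fun θ => M.score z θ q.2) q.1 v j =
      fderiv ℝ (M.scoreCoord j z) q (v, 0) := by
  have hA := ((hM.contDiffAt_score z hq).differentiableAt two_ne_zero).hasFDerivAt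
  have h1 : HasFDerivAt (fun θ => M.score z θ q.2) _ q.1 :=
    HasFDerivAt.comp q.1 (f := fun θ => (θ, q.2)) hA (hasFDerivAt_prodMk_left q.1 q.2)
  have h2 := (EuclideanSpace.proj (𝕜 := ℝ) j).hasFDerivAt.comp q hA
  have h2' : fderiv ℝ (M.scoreCoord j z) q = _ := h2.fderiv
  refine ⟨h1.differentiableAt.hasFDerivAt, fun v => ?_⟩
  rw [h1.fderiv, h2']
  rfl

lemma Regular.fderiv_score_right_apply (hM : M.Regular f L R σ₀ x θ₀) (j : Fin p) (z : 𝒵)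
    {q : Vec p × Vec l} (hq : q ∈ M.dom) (v : Vec l) :
    fderiv ℝ (fun ξ => M.score z q.1 ξ) q.2 v j = fderiv ℝ (M.scoreCoord j z) q (0, v) := by
  have hA := ((hM.contDiffAt_score z hq).differentiableAt two_ne_zero).hasFDerivAt
  have h1 : HasFDerivAt (fun ξ => M.score z q.1 ξ) _ q.2 :=
    HasFDerivAt.comp q.2 (f := fun ξ => (q.1, ξ)) hA (hasFDerivAt_prodMk_right q.1 q.2)
  have h2 := (EuclideanSpace.proj (𝕜 := ℝ) j).hasFDerivAt.comp q hA
  have h2' : fderiv ℝ (M.scoreCoord j z) q = _ := h2.fderiv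
  rw [h1.fderiv, h2']
  rfl

/-- Second order expansion of the moment around the truth. -/
lemma Regular.abs_integral_expansion_le (hM : M.Regular f L R σ₀ x θ₀) (hL : 0 ≤ L)
    (hx : x ∈ cube d) (j : Fin p) {θ : Vec p} (hθ : θ ∈ M.domθ) {h : Vec d → Vec k → Vec l}
    (hh : h ∈ M.H) (hi1 : Integrable (fun w => ‖h x w - M.h₀ x w‖) (M.confKernel x))
    (hi2 : Integrable (fun w => ‖h x w - M.h₀ x w‖ ^ 2) (M.confKernel x)) :
    Integrable (fun z => fderiv ℝ (M.scoreCoord j z) (M.evalPoint θ₀ M.h₀ z)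
      (M.evalPoint θ h z - M.evalPoint θ₀ M.h₀ z)) (M.condLaw x) ∧
    |M.moment x θ h j - M.moment x θ₀ M.h₀ j -
      ∫ z, fderiv ℝ (M.scoreCoord j z) (M.evalPoint θ₀ M.h₀ z)
        (M.evalPoint θ h z - M.evalPoint θ₀ M.h₀ z) ∂(M.condLaw x)| ≤
      L * (‖θ - θ₀‖ ^ 2 + ∫ w, ‖h x w - M.h₀ x w‖ ^ 2 ∂(M.confKernel x)) := by
  have hθ₀ := M.Θ_subset hM.θ₀_mem
  have hae : ∀ᵐ z ∂(M.condLaw x), M.feat z = x := M.ae_condLaw hx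
  have hi1' : Integrable (fun z => ‖h x (M.conf z) - M.h₀ x (M.conf z)‖) (M.condLaw x) := by
    rw [← map_conf_condLaw hx] at hi1
    exact (integrable_map_measure hi1.aestronglyMeasurable M.measurable_conf.aemeasurable).1 hi1
  set q₀ := M.evalPoint θ₀ M.h₀
  set q := M.evalPoint θ h
  have hq₀m : Measurable q₀ := measurable_evalPoint θ₀ M.h₀_mem
  have hqm : Measurable q := measurable_evalPoint θ hh
  have hq₀ : ∀ z, q₀ z ∈ M.dom := evalPoint_mem hθ₀ M.h₀_mem
  have hq : ∀ z, q z ∈ M.dom := evalPoint_mem hθ hh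
  have hDi : Integrable (fun z => fderiv ℝ (M.scoreCoord j z) (q₀ z) (q z - q₀ z))
      (M.condLaw x) := by
    refine (((integrable_const ‖θ - θ₀‖).add hi1').const_mul L).mono'
      (hM.measurable_fderiv_scoreCoord j hq₀m (hqm.sub hq₀m) hq₀).aestronglyMeasurable ?_
    filter_upwards [hae] with z hz
    have := hM.abs_fderiv_scoreCoord_le hL j z (hq₀ z) (q z - q₀ z)
    simp only [q, q₀, evalPoint, hz] at this ⊢
    exact this
  refine ⟨hDi, ?_⟩
  have hs := hM.integrable_scoreCoord hx hθ hh j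
  have hs₀ := hM.integrable_scoreCoord hx hθ₀ M.h₀_mem j
  have hs' : Integrable (fun z => M.scoreCoord j z (q z) - M.scoreCoord j z (q₀ z))
      (M.condLaw x) := hs.sub hs₀
  have hs'' : Integrable (fun z => M.scoreCoord j z (q z) - M.scoreCoord j z (q₀ z) -
      fderiv ℝ (M.scoreCoord j z) (q₀ z) (q z - q₀ z)) (M.condLaw x) := hs'.sub hDi
  rw [hM.moment_eq_integral hx hθ hh, hM.moment_eq_integral hx hθ₀ M.h₀_mem,
    ← integral_sub hs hs₀, ← integral_sub hs' hDi, M.integral_condLaw hs'']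
  -- Given `W = w` both evaluation points are constant and the conditional expansion applies;
  -- integrating over `w` produces the mean squared nuisance error.
  have hbound : ∀ᵐ w ∂(M.confKernel x),
      ‖∫ z, (M.scoreCoord j z (q z) - M.scoreCoord j z (q₀ z) -
        fderiv ℝ (M.scoreCoord j z) (q₀ z) (q z - q₀ z)) ∂(M.obsKernel (x, w))‖ ≤
      L * (‖θ - θ₀‖ ^ 2 + ‖h x w - M.h₀ x w‖ ^ 2) := by
    filter_upwards [hM.ae_hessianRegular, M.consistent x hx] with w hw hcons
    have h1 : ∀ᵐ z ∂(M.obsKernel (x, w)), M.scoreCoord j z (q z) - M.scoreCoord j z (q₀ z) -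
        fderiv ℝ (M.scoreCoord j z) (q₀ z) (q z - q₀ z) =
        M.scoreCoord j z (θ, h x w) - M.scoreCoord j z (θ₀, M.h₀ x w) -
        fderiv ℝ (M.scoreCoord j z) (θ₀, M.h₀ x w) ((θ, h x w) - (θ₀, M.h₀ x w)) := by
      filter_upwards [hcons] with z hz
      simp only [q, q₀, evalPoint, hz.1, hz.2]
    rw [integral_congr_ae h1]
    exact hM.abs_integral_remainder_le hL hw j (q := (θ₀, M.h₀ x w)) (q' := (θ, h x w))
      ⟨hθ₀, M.maps_of_mem _ M.h₀_mem x hx w⟩ ⟨hθ, M.maps_of_mem h hh x hx w⟩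
  have hbi : Integrable (fun w => L * (‖θ - θ₀‖ ^ 2 + ‖h x w - M.h₀ x w‖ ^ 2))
      (M.confKernel x) := ((integrable_const _).add hi2).const_mul L
  refine (norm_integral_le_of_norm_le hbi hbound).trans_eq ?_
  rw [integral_const_mul, integral_add (integrable_const _) hi2]
  simp

/-- The nuisance error enters the moment at the true parameter quadratically. -/
lemma Regular.norm_moment_le_sq (hM : M.Regular f L R σ₀ x θ₀) (hL : 0 ≤ L)
    (hx : x ∈ cube d) {h : Vec d → Vec k → Vec l} (hh : h ∈ M.H) {χ : ℝ} (hχ : 0 ≤ χ)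
    (hrmse : M.rmse x h ≤ ENNReal.ofReal χ) :
    ‖M.moment x θ₀ h‖ ≤ p * (L * χ ^ 2) := by
  have hmeas : Measurable fun w => h x w - M.h₀ x w :=
    ((M.measurable_of_mem h hh).comp measurable_prodMk_left).sub
      ((M.measurable_of_mem _ M.h₀_mem).comp measurable_prodMk_left)
  obtain ⟨hi1, hi2, -, hb2⟩ :=
    integral_norm_le_of_eLpNorm_two_le hmeas.aestronglyMeasurable hχ hrmse
  have hθ₀ := M.Θ_subset hM.θ₀_mem
  have hexp := fun j => hM.abs_integral_expansion_le hL hx j hθ₀ hh hi1 hi2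
  have hcoord : ∀ j, ∀ᵐ z ∂(M.condLaw x), fderiv ℝ (M.scoreCoord j z) (M.evalPoint θ₀ M.h₀ z)
        (M.evalPoint θ₀ h z - M.evalPoint θ₀ M.h₀ z) =
      fderiv ℝ (fun ξ => M.score z θ₀ ξ) (M.h₀ x (M.conf z))
        (h x (M.conf z) - M.h₀ x (M.conf z)) j := by
    intro j
    filter_upwards [M.ae_condLaw hx] with z hz
    rw [hM.fderiv_score_right_apply j z (q := (θ₀, M.h₀ x (M.conf z)))
      ⟨hθ₀, M.maps_of_mem _ M.h₀_mem x hx _⟩]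
    simp [evalPoint, hz]
  -- Orthogonality is an identity for a vector-valued integral, and passes to coordinates only once
  -- integrability is known: otherwise that integral is zero by default.
  have horth : ∀ j, ∫ z, fderiv ℝ (M.scoreCoord j z) (M.evalPoint θ₀ M.h₀ z)
        (M.evalPoint θ₀ h z - M.evalPoint θ₀ M.h₀ z) ∂(M.condLaw x) = 0 := by
    intro j
    have hint : Integrable (fun z => fderiv ℝ (fun ξ => M.score z θ₀ ξ) (M.h₀ x (M.conf z))
        (h x (M.conf z) - M.h₀ x (M.conf z))) (M.condLaw x) :=
      Integrable.of_eval_piLp fun j => (hexp j).1.congr (hcoord j)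
    rw [integral_congr_ae (hcoord j)]
    have := (EuclideanSpace.proj (𝕜 := ℝ) j).integral_comp_comm hint
    rw [hM.orthogonal h hh] at this
    simpa using this
  refine norm_le_card_mul fun j => ?_
  have h1 := (hexp j).2
  rw [horth j, (hM.moment_eq_zero_iff θ₀ hM.θ₀_mem).2 rfl] at h1
  simp only [PiLp.zero_apply, sub_zero, sub_self, norm_zero, ne_eq, OfNat.ofNat_ne_zero,
    not_false_eq_true, zero_pow, zero_add] at h1
  exact h1.trans (mul_le_mul_of_nonneg_left hb2 hL)

/-- The nuisance error changes the increments of the moment by a Lipschitz amount. -/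
lemma Regular.norm_moment_mixed_le (hM : M.Regular f L R σ₀ x θ₀) (hL : 0 ≤ L)
    (hx : x ∈ cube d) {θ : Vec p} (hθ : θ ∈ M.domθ) {h : Vec d → Vec k → Vec l} (hh : h ∈ M.H)
    {χ : ℝ} (hχ : 0 ≤ χ) (hrmse : M.rmse x h ≤ ENNReal.ofReal χ) :
    ‖M.moment x θ h - M.moment x θ M.h₀ - M.moment x θ₀ h‖ ≤ L * χ * ‖θ - θ₀‖ := by
  have hmeas : Measurable fun w => h x w - M.h₀ x w :=
    ((M.measurable_of_mem h hh).comp measurable_prodMk_left).sub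
      ((M.measurable_of_mem _ M.h₀_mem).comp measurable_prodMk_left)
  obtain ⟨hi1, -, hb1, -⟩ :=
    integral_norm_le_of_eLpNorm_two_le hmeas.aestronglyMeasurable hχ hrmse
  have hθ₀ := M.Θ_subset hM.θ₀_mem
  have hi1' : Integrable (fun z => ‖h x (M.conf z) - M.h₀ x (M.conf z)‖) (M.condLaw x) := by
    rw [← map_conf_condLaw hx] at hi1
    exact (integrable_map_measure hi1.aestronglyMeasurable M.measurable_conf.aemeasurable).1 hi1
  have hint' : ∫ z, ‖h x (M.conf z) - M.h₀ x (M.conf z)‖ ∂(M.condLaw x) ≤ χ := by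
    rwa [← map_conf_condLaw hx, integral_map M.measurable_conf.aemeasurable
      hmeas.norm.aestronglyMeasurable] at hb1
  have h0 : M.moment x θ₀ M.h₀ = 0 := (hM.moment_eq_zero_iff θ₀ hM.θ₀_mem).2 rfl
  have e1 := hM.integrable_plugIn hx hθ hh
  have e2 := hM.integrable_plugIn hx hθ M.h₀_mem
  have e3 := hM.integrable_plugIn hx hθ₀ hh
  have e4 := hM.integrable_plugIn hx hθ₀ M.h₀_mem
  -- Because `M.moment x θ₀ M.h₀ = 0`, the left side is a mixed difference in `θ` and in the
  -- nuisance.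
  have hrew : M.moment x θ h - M.moment x θ M.h₀ - M.moment x θ₀ h =
      ∫ z, ((M.plugIn θ h z - M.plugIn θ M.h₀ z) -
        (M.plugIn θ₀ h z - M.plugIn θ₀ M.h₀ z)) ∂(M.condLaw x) := by
    have e12 : Integrable (fun z => M.plugIn θ h z - M.plugIn θ M.h₀ z) (M.condLaw x) := e1.sub e2
    have e34 : Integrable (fun z => M.plugIn θ₀ h z - M.plugIn θ₀ M.h₀ z) (M.condLaw x) :=
      e3.sub e4
    rw [integral_sub e12 e34, integral_sub e1 e2, integral_sub e3 e4]
    change _ = _ - (M.moment x θ₀ h - M.moment x θ₀ M.h₀)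
    rw [h0, sub_zero]
    rfl
  rw [hrew]
  refine (norm_integral_le_of_norm_le (hi1'.const_mul (L * ‖θ - θ₀‖)) ?_).trans ?_
  · filter_upwards [M.ae_condLaw hx] with z hz
    set ξ := h (M.feat z) (M.conf z)
    set ξ' := M.h₀ (M.feat z) (M.conf z)
    have hξ : ξ ∈ M.domξ := M.maps_of_mem h hh _ (M.feat_mem z) _
    have hξ' : ξ' ∈ M.domξ := M.maps_of_mem _ M.h₀_mem _ (M.feat_mem z) _
    have hdiff : ∀ {ξ}, ξ ∈ M.domξ → ∀ θ ∈ M.domθ,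
        DifferentiableAt ℝ (fun θ' => M.score z θ' ξ) θ := fun {ξ} hξ θ hθ =>
      (DifferentiableAt.comp θ (f := fun θ => (θ, ξ))
        ((hM.contDiffAt_score z (q := (θ, ξ)) ⟨hθ, hξ⟩).differentiableAt two_ne_zero)
        (differentiableAt_id.prodMk (differentiableAt_const _)))
    -- Mean value inequality in `θ` for the difference of the scores at `ξ` and `ξ'`, whose gradient
    -- is at most `L * ‖ξ - ξ'‖`.
    have h1 := M.convex_domθ.norm_image_sub_le_of_norm_fderiv_le (𝕜 := ℝ)
      (f := fun θ' => M.score z θ' ξ - M.score z θ' ξ')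
      (fun θ hθ => (hdiff hξ θ hθ).sub (hdiff hξ' θ hθ)) (C := L * ‖ξ - ξ'‖)
      (fun θ hθ => by
        rw [fderiv_fun_sub (hdiff hξ θ hθ) (hdiff hξ' θ hθ)]
        exact hM.lipschitz_grad z θ hθ ξ hξ ξ' hξ') hθ₀ hθ
    refine h1.trans_eq ?_
    simp only [ξ, ξ', hz]
    ring
  · rw [integral_const_mul]
    calc L * ‖θ - θ₀‖ * _ ≤ L * ‖θ - θ₀‖ * χ := mul_le_mul_of_nonneg_left hint' (by positivity)
      _ = _ := by ring

end MomentModel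

end Expansion

end ORF

/-! ### The Jacobian: symmetry, lower bound, monotonicity -/

namespace ORF

open scoped Topology RealInnerProductSpace

section Curvature

variable {d p l k : ℕ} {𝒵 : Type*} [MeasurableSpace 𝒵] {M : MomentModel d p l k 𝒵}
  {f : Vec d → ℝ} {L R σ₀ σ : ℝ} {x : Vec d} {θ₀ : Vec p}

namespace MomentModel

/-- The Lipschitz inequality at two distinct parameters forces the sign; they exist since `domθ` is
open and `p > 0`. -/
lemma Regular.lipschitz_nonneg (hM : M.Regular f L R σ₀ x θ₀) (hp : 0 < p) : 0 ≤ L := by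
  have hθ₀ := M.Θ_subset hM.θ₀_mem
  obtain ⟨ε, hε, hball⟩ := Metric.isOpen_iff.1 M.isOpen_domθ θ₀ hθ₀
  set v : Vec p := EuclideanSpace.single ⟨0, hp⟩ (ε / 2)
  have hv : ‖v‖ = ε / 2 := by simp [v, abs_of_pos hε]
  have hmem : θ₀ + v ∈ M.domθ := hball (by rw [Metric.mem_ball, dist_self_add_left, hv]; linarith)
  obtain ⟨z⟩ : Nonempty 𝒵 := by
    by_contra hne
    rw [not_nonempty_iff] at hne
    have h1 : M.law Set.univ = 1 := measure_univ
    rw [Set.univ_eq_empty_iff.2 hne, measure_empty] at h1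
    exact zero_ne_one h1
  have h := hM.lipschitz_θ z (M.h₀ (M.feat z) (M.conf z))
    (M.maps_of_mem _ M.h₀_mem _ (M.feat_mem z) _) (θ₀ + v) hmem θ₀ hθ₀
  rw [add_sub_cancel_left, hv] at h
  have h2 := (norm_nonneg _).trans h
  exact nonneg_of_mul_nonneg_left h2 (by linarith)

/-- If all eigenvalues of the Jacobian are positive, then the moment is differentiable. -/
lemma Regular.differentiableAt_moment (hM : M.Regular f L R σ₀ x θ₀) (hσ₀ : 0 < σ₀)
    (hσ : Module.End.HasEigenvalue (M.jacobian x θ₀ : Vec p →ₗ[ℝ] Vec p) σ) :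
    DifferentiableAt ℝ (fun θ => M.moment x θ M.h₀) θ₀ := by
  by_contra hcon
  -- The derivative of a non-differentiable map is zero by default, so its eigenvalue would be zero,
  -- against the lower bound `σ₀`.
  have hJ : M.jacobian x θ₀ = 0 := fderiv_zero_of_not_differentiableAt hcon
  obtain ⟨u, hu⟩ := hσ.exists_hasEigenvector
  have h1 := hu.apply_eq_smul
  rw [hJ] at h1
  have h2 : σ • u = 0 := by simpa using h1.symm
  have h3 := hM.curvature σ hσ
  rcases smul_eq_zero.1 h2 with h | h
  · linarith
  · exact hu.2 h

/-- Differentiation under the integral along a line through `θ₀`, dominated by the Lipschitz bound,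
and uniqueness of the derivative. -/
lemma Regular.jacobian_apply (hM : M.Regular f L R σ₀ x θ₀) (hL : 0 ≤ L) (hx : x ∈ cube d)
    (hdiff : DifferentiableAt ℝ (fun θ => M.moment x θ M.h₀) θ₀) (v : Vec p) (j : Fin p) :
    M.jacobian x θ₀ v j =
      ∫ z, fderiv ℝ (M.scoreCoord j z) (M.evalPoint θ₀ M.h₀ z) (v, 0) ∂(M.condLaw x) := by
  have hθ₀ := M.Θ_subset hM.θ₀_mem
  have h1 : HasDerivAt (fun t : ℝ => M.moment x (θ₀ + t • v) M.h₀ j)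
      (M.jacobian x θ₀ v j) 0 := by
    have := hasDerivAt_line (g := fun θ => M.moment x θ M.h₀) (q := θ₀) (v := v) (t := 0)
      (by simpa using hdiff)
    have h2 := (EuclideanSpace.proj (𝕜 := ℝ) j).hasFDerivAt.comp_hasDerivAt (0 : ℝ) this
    rw [zero_smul, add_zero] at h2
    exact h2
  have hnear : ∀ᶠ t : ℝ in 𝓝 0, θ₀ + t • v ∈ M.domθ :=
    (continuous_const.add (continuous_id.smul continuous_const)).continuousAt.eventually_mem
      (M.isOpen_domθ.mem_nhds (by simpa using hθ₀))
  have hline : ∀ (t : ℝ) z, M.evalPoint (θ₀ + t • v) M.h₀ z =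
      M.evalPoint θ₀ M.h₀ z + t • (v, 0) := fun t z => by simp [evalPoint]
  have hdom : ∀ t : ℝ, θ₀ + t • v ∈ M.domθ → ∀ z, M.evalPoint θ₀ M.h₀ z + t • (v, 0) ∈ M.dom :=
    fun t ht z => by rw [← hline]; exact evalPoint_mem ht M.h₀_mem z
  have h2 : HasDerivAt (fun t : ℝ => ∫ z, M.scoreCoord j z (M.evalPoint θ₀ M.h₀ z + t • (v, 0))
      ∂(M.condLaw x)) (∫ z, fderiv ℝ (M.scoreCoord j z)
        (M.evalPoint θ₀ M.h₀ z + (0 : ℝ) • (v, 0)) (v, 0) ∂(M.condLaw x)) 0 := by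
    refine (hasDerivAt_integral_of_dominated_loc_of_deriv_le hnear
      (F' := fun t z => fderiv ℝ (M.scoreCoord j z)
        (M.evalPoint θ₀ M.h₀ z + t • (v, 0)) (v, 0)) (bound := fun _ => L * ‖v‖)
      (Filter.Eventually.of_forall fun t => ?_) ?_ ?_ ?_ (integrable_const _) ?_).2
    · simp_rw [← hline]
      exact (measurable_scoreCoord (measurable_evalPoint _ M.h₀_mem) j).aestronglyMeasurable
    · simp_rw [← hline]
      exact hM.integrable_scoreCoord hx (by simpa using hθ₀) M.h₀_mem j
    · simp_rw [← hline]
      exact (hM.integrable_fderiv_scoreCoord hL (by simpa using hθ₀) M.h₀_mem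
        j v).aestronglyMeasurable
    · refine Filter.Eventually.of_forall fun z t ht => ?_
      simpa using hM.abs_fderiv_scoreCoord_le hL j z (hdom t ht z) (v, 0)
    · exact Filter.Eventually.of_forall fun z t ht => hM.hasDerivAt_scoreCoord j z (hdom t ht z)
  have h3 : (fun t : ℝ => M.moment x (θ₀ + t • v) M.h₀ j) =ᶠ[𝓝 0]
      fun t : ℝ => ∫ z, M.scoreCoord j z (M.evalPoint θ₀ M.h₀ z + t • (v, 0)) ∂(M.condLaw x) := by
    filter_upwards [hnear] with t ht
    simp_rw [← hline]
    exact hM.moment_eq_integral hx ht M.h₀_mem j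
  have h4 := h1.unique (h2.congr_of_eventuallyEq h3)
  simpa using h4

/-- The `θ`-derivative of the score is the Hessian of the loss, hence symmetric, and so is its mean.
Symmetry is what turns a bound on eigenvalues into one on the quadratic form. -/
lemma Regular.isSymmetric_jacobian (hM : M.Regular f L R σ₀ x θ₀) (hL : 0 ≤ L) (hx : x ∈ cube d)
    (hdiff : DifferentiableAt ℝ (fun θ => M.moment x θ M.h₀) θ₀)
    (hconv : M.IsGradientOfConvexLoss) :
    (M.jacobian x θ₀ : Vec p →ₗ[ℝ] Vec p).IsSymmetric := by
  obtain ⟨loss, hloss⟩ := hconv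
  have hθ₀ := M.Θ_subset hM.θ₀_mem
  have hinner : ∀ u v : Vec p, ⟪M.jacobian x θ₀ u, v⟫ =
      ∫ z, ∑ j, v j * fderiv ℝ (M.scoreCoord j z) (M.evalPoint θ₀ M.h₀ z) (u, 0)
        ∂(M.condLaw x) := by
    intro u v
    rw [integral_finsetSum _ fun j _ =>
      (hM.integrable_fderiv_scoreCoord hL hθ₀ M.h₀_mem j u).const_mul _, PiLp.inner_apply]
    refine Finset.sum_congr rfl fun j _ => ?_
    rw [integral_const_mul, hM.jacobian_apply hL hx hdiff]
    simp
  intro u v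
  rw [ContinuousLinearMap.coe_coe, real_inner_comm _ u, hinner, hinner]
  refine integral_congr_ae (Filter.Eventually.of_forall fun z => ?_)
  set ξ := M.h₀ (M.feat z) (M.conf z)
  have hq : M.evalPoint θ₀ M.h₀ z ∈ M.dom := evalPoint_mem hθ₀ M.h₀_mem z
  have hξ : ξ ∈ M.domξ := hq.2
  set A := fderiv ℝ (fun θ => M.score z θ ξ) θ₀
  have hA : ∀ u v : Vec p, ∑ j, v j * fderiv ℝ (M.scoreCoord j z) (M.evalPoint θ₀ M.h₀ z) (u, 0) =
      ⟪A u, v⟫ := by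
    intro u v
    rw [PiLp.inner_apply]
    refine Finset.sum_congr rfl fun j _ => ?_
    rw [← (hM.fderiv_score_left_apply j z hq).2 u]
    simp [A, evalPoint, ξ]
  rcases Nat.eq_zero_or_pos p with rfl | hp
  · simp
  have hAd : HasFDerivAt (fun θ => M.score z θ ξ) A θ₀ :=
    (hM.fderiv_score_left_apply ⟨0, hp⟩ z hq).1
  have hf' : ∀ᶠ θ in 𝓝 θ₀, HasFDerivAt (fun θ => loss z θ ξ)
      (InnerProductSpace.toDual ℝ (Vec p) (M.score z θ ξ)) θ := by
    filter_upwards [M.isOpen_domθ.mem_nhds hθ₀] with θ hθ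
    exact (hloss z ξ hξ).2 θ hθ
  have hf'' : HasFDerivAt (fun θ => InnerProductSpace.toDual ℝ (Vec p) (M.score z θ ξ))
      ((innerSL ℝ : Vec p →L[ℝ] Vec p →L[ℝ] ℝ).comp A) θ₀ :=
    (innerSL ℝ : Vec p →L[ℝ] Vec p →L[ℝ] ℝ).hasFDerivAt.comp θ₀ hAd
  have hsymm := second_derivative_symmetric_of_eventually hf' hf'' u v
  beta_reduce
  rw [hA, hA]
  simpa using hsymm

lemma Regular.mul_norm_sq_le_inner_jacobian (hM : M.Regular f L R σ₀ x θ₀) (hL : 0 ≤ L)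
    (hx : x ∈ cube d) (hdiff : DifferentiableAt ℝ (fun θ => M.moment x θ M.h₀) θ₀)
    (hconv : M.IsGradientOfConvexLoss)
    (hσ : ∀ c, Module.End.HasEigenvalue (M.jacobian x θ₀ : Vec p →ₗ[ℝ] Vec p) c → σ ≤ c)
    (v : Vec p) : σ * ‖v‖ ^ 2 ≤ ⟪M.jacobian x θ₀ v, v⟫ :=
  mul_norm_sq_le_inner_apply_self (hM.isSymmetric_jacobian hL hx hdiff hconv) hσ v

/-- Quadratic expansion of the moment at the true nuisance function. -/
lemma Regular.norm_moment_sub_jacobian_le (hM : M.Regular f L R σ₀ x θ₀) (hL : 0 ≤ L)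
    (hx : x ∈ cube d) (hdiff : DifferentiableAt ℝ (fun θ => M.moment x θ M.h₀) θ₀) {θ : Vec p}
    (hθ : θ ∈ M.domθ) :
    ‖M.moment x θ M.h₀ - M.jacobian x θ₀ (θ - θ₀)‖ ≤ p * (L * ‖θ - θ₀‖ ^ 2) := by
  refine norm_le_card_mul fun j => ?_
  -- At the true nuisance function the nuisance error vanishes, and the linear term is the Jacobian.
  have h := (hM.abs_integral_expansion_le hL hx j hθ M.h₀_mem (by simp) (by simp)).2
  rw [(hM.moment_eq_zero_iff θ₀ hM.θ₀_mem).2 rfl] at h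
  rw [PiLp.sub_apply, hM.jacobian_apply hL hx hdiff]
  simpa [evalPoint] using h

end MomentModel

/-- Along the segment, the slope of a convex function lies between its derivatives at the two ends.
-/
lemma inner_sub_nonneg_of_convexOn {E : Type*} [NormedAddCommGroup E] [InnerProductSpace ℝ E]
    [CompleteSpace E] {U : Set E} {g : E → ℝ} {g' : E → E} (hg : ConvexOn ℝ U g)
    (hg' : ∀ θ ∈ U, HasGradientAt g (g' θ) θ) {θ θ' : E} (hθ : θ ∈ U) (hθ' : θ' ∈ U) :
    0 ≤ ⟪g' θ - g' θ', θ - θ'⟫ := by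
  have hline : ∀ t : ℝ, AffineMap.lineMap θ' θ t = θ' + t • (θ - θ') := fun t => by
    rw [AffineMap.lineMap_apply_module']; abel
  have hc := hg.comp_affineMap (AffineMap.lineMap (k := ℝ) θ' θ)
  have hd : ∀ t : ℝ, θ' + t • (θ - θ') ∈ U → HasDerivAt (g ∘ AffineMap.lineMap (k := ℝ) θ' θ)
      ⟪g' (θ' + t • (θ - θ')), θ - θ'⟫ t := by
    intro t ht
    have h1 := (hg' _ ht).hasFDerivAt
    have h2 : HasDerivAt (fun t : ℝ => θ' + t • (θ - θ')) (θ - θ') t := by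
      simpa using ((hasDerivAt_id t).smul_const (θ - θ')).const_add θ'
    have h3 := h1.comp_hasDerivAt t h2
    have h4 : (g ∘ AffineMap.lineMap (k := ℝ) θ' θ) = g ∘ fun t : ℝ => θ' + t • (θ - θ') := by
      funext t; simp only [Function.comp, hline]
    rw [h4]
    simpa using h3
  have m0 : (0 : ℝ) ∈ AffineMap.lineMap (k := ℝ) θ' θ ⁻¹' U := by simpa using hθ'
  have m1 : (1 : ℝ) ∈ AffineMap.lineMap (k := ℝ) θ' θ ⁻¹' U := by simpa using hθ
  have d0 := hc.le_slope_of_hasDerivAt m0 m1 zero_lt_one (hd 0 (by simpa using hθ'))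
  have d1 := hc.slope_le_of_hasDerivAt m0 m1 zero_lt_one (hd 1 (by simpa using hθ))
  have := d0.trans d1
  rw [inner_sub_left]
  simp only [zero_smul, add_zero, one_smul, add_sub_cancel] at this
  linarith

lemma MomentModel.Regular.inner_moment_sub_nonneg (hM : M.Regular f L R σ₀ x θ₀) (hx : x ∈ cube d)
    (hconv : M.IsGradientOfConvexLoss) {θ θ' : Vec p} (hθ : θ ∈ M.domθ) (hθ' : θ' ∈ M.domθ) :
    0 ≤ ⟪M.moment x θ M.h₀ - M.moment x θ' M.h₀, θ - θ'⟫ := by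
  obtain ⟨loss, hloss⟩ := hconv
  have e1 := hM.integrable_plugIn hx hθ M.h₀_mem
  have e2 := hM.integrable_plugIn hx hθ' M.h₀_mem
  have e3 : Integrable (fun z => M.plugIn θ M.h₀ z - M.plugIn θ' M.h₀ z) (M.condLaw x) := e1.sub e2
  rw [MomentModel.moment, MomentModel.moment, ← integral_sub e1 e2, real_inner_comm,
    ← integral_inner e3]
  refine integral_nonneg fun z => ?_
  have hξ := M.maps_of_mem _ M.h₀_mem _ (M.feat_mem z) (M.conf z)
  have h := inner_sub_nonneg_of_convexOn (hloss z _ hξ).1 (hloss z _ hξ).2 hθ hθ'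
  rw [real_inner_comm] at h
  exact h

end Curvature

/-! ### Inversion of the moment near its zero -/

section Inversion

lemma pos_of_hasEigenvalue {p : ℕ} {A : Vec p →ₗ[ℝ] Vec p} {c : ℝ}
    (h : Module.End.HasEigenvalue A c) : 0 < p := by
  rcases Nat.eq_zero_or_pos p with rfl | hp
  · obtain ⟨u, hu⟩ := h.exists_hasEigenvector
    exact absurd (Subsingleton.elim u 0) hu.2
  · exact hp

/-- Inversion of a monotone map with a quadratic expansion at its zero: an approximate zero is close
to the zero. -/
lemma norm_sub_le_of_monotone_expansion {E : Type*} [NormedAddCommGroup E] [InnerProductSpace ℝ E]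
    {U : Set E} (hU : Convex ℝ U) {F J : E → E} {θ₀ θ : E} {K L R σ₀ σ χ b : ℝ}
    (hθ₀ : θ₀ ∈ U) (hθ : θ ∈ U)
    (hmono : ∀ θ ∈ U, ∀ θ' ∈ U, 0 ≤ ⟪F θ - F θ', θ - θ'⟫)
    (hexp : ∀ θ ∈ U, ‖F θ - J (θ - θ₀)‖ ≤ K * ‖θ - θ₀‖ ^ 2)
    (hJ : ∀ v, σ * ‖v‖ ^ 2 ≤ ⟪J v, v⟫) (hK : 0 < K) (hL : 0 ≤ L) (hσ₀ : 0 < σ₀) (hσ : σ₀ ≤ σ)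
    (hχ : 0 ≤ χ) (hb : 0 ≤ b) (hR : ‖θ - θ₀‖ ≤ R)
    (hF : ‖F θ‖ ≤ b + L * χ * ‖θ - θ₀‖) {C₂ : ℝ} (hC₂ : 2 * L + 4 * L * R / (σ₀ / (2 * K)) ≤ C₂)
    (hpos : 0 < σ - C₂ * χ) :
    ‖θ - θ₀‖ ≤ (2 + 4 * R / (σ₀ / (2 * K))) * b / (σ - C₂ * χ) := by
  -- Up to this distance the remainder takes at most half of the curvature: `K * t ≤ σ₀ / 2 ≤ σ /
  -- 2`.
  set t₀ := σ₀ / (2 * K)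
  have ht₀ : 0 < t₀ := by positivity
  have hR0 : 0 ≤ R := (norm_nonneg _).trans hR
  have hKt₀ : K * t₀ = σ₀ / 2 := by simp only [t₀]; field_simp
  set t := ‖θ - θ₀‖
  have ht : 0 ≤ t := norm_nonneg _
  have hlow : ∀ θ' ∈ U, σ * ‖θ' - θ₀‖ ^ 2 - K * ‖θ' - θ₀‖ ^ 3 ≤ ⟪F θ', θ' - θ₀⟫ := by
    intro θ' hθ'
    have h1 : ⟪F θ', θ' - θ₀⟫ = ⟪J (θ' - θ₀), θ' - θ₀⟫ +
        ⟪F θ' - J (θ' - θ₀), θ' - θ₀⟫ := by rw [← inner_add_left]; congr 1; abel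
    have h2 := abs_real_inner_le_norm (F θ' - J (θ' - θ₀)) (θ' - θ₀)
    have h3 := mul_le_mul_of_nonneg_right (hexp θ' hθ') (norm_nonneg (θ' - θ₀))
    have h4 := neg_abs_le ⟪F θ' - J (θ' - θ₀), θ' - θ₀⟫
    have h5 := hJ (θ' - θ₀)
    rw [h1]
    nlinarith
  have hup : ⟪F θ, θ - θ₀⟫ ≤ (b + L * χ * t) * t :=
    (real_inner_le_norm _ _).trans (mul_le_mul_of_nonneg_right hF ht)
  have hR' : 0 ≤ 4 * R / t₀ := by positivity
  have hL' : 0 ≤ 4 * L * R / t₀ := by positivity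
  rw [le_div_iff₀ hpos]
  rcases le_or_gt t t₀ with hle | hgt
  · rcases ht.eq_or_lt with h0 | h0
    · rw [← h0, zero_mul]; positivity
    have h1 := (hlow θ hθ).trans hup
    have h2 : (σ - K * t - L * χ) * t ≤ b := by
      refine le_of_mul_le_mul_right ?_ h0
      change σ * t ^ 2 - K * t ^ 3 ≤ _ at h1
      nlinarith
    have h3 : K * t ≤ σ / 2 := by
      have := mul_le_mul_of_nonneg_left hle hK.le
      linarith
    have h4 : (σ - C₂ * χ) * t ≤ 2 * ((σ - K * t - L * χ) * t) := by
      have : σ - C₂ * χ ≤ 2 * (σ - K * t - L * χ) := by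
        have : 2 * L * χ ≤ C₂ * χ := mul_le_mul_of_nonneg_right (by linarith) hχ
        linarith
      nlinarith
    nlinarith [mul_nonneg hR' hb]
  -- Far from the zero the expansion is of no use at `θ`. It is applied at the point `θ₁` of the
  -- segment at distance `t₀`; by monotonicity, the component of `F` along the segment is at least
  -- as large at `θ` as at `θ₁`.
  · have htpos : 0 < t := ht₀.trans hgt
    set a := t₀ / t
    have ha : 0 < a := by positivity
    have ha1 : a < 1 := (div_lt_one htpos).2 hgt
    have hat : a * t = t₀ := by simp only [a]; field_simp
    set θ₁ := θ₀ + a • (θ - θ₀)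
    have hθ₁ : θ₁ ∈ U := hU.add_smul_sub_mem hθ₀ hθ ⟨ha.le, ha1.le⟩
    have hd1 : θ₁ - θ₀ = a • (θ - θ₀) := by simp [θ₁]
    have hd2 : θ - θ₁ = (1 - a) • (θ - θ₀) := by simp only [θ₁]; module
    have hn1 : ‖θ₁ - θ₀‖ = t₀ := by
      rw [hd1, norm_smul, Real.norm_eq_abs, abs_of_pos ha]; exact hat
    have h1 : ⟪F θ₁, θ - θ₀⟫ ≤ ⟪F θ, θ - θ₀⟫ := by
      have := hmono θ hθ θ₁ hθ₁
      rw [hd2, inner_smul_right, inner_sub_left] at this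
      have := nonneg_of_mul_nonneg_right this (by linarith)
      linarith
    have h2 := hlow θ₁ hθ₁
    rw [hn1, hd1, inner_smul_right] at h2
    have h3 : σ * t₀ ^ 2 / 2 ≤ a * ((b + L * χ * t) * t) := by
      have h4 : a * ⟪F θ₁, θ - θ₀⟫ ≤ a * ((b + L * χ * t) * t) :=
        mul_le_mul_of_nonneg_left (h1.trans hup) ha.le
      have h5 : K * t₀ ^ 3 = σ₀ / 2 * t₀ ^ 2 := by rw [← hKt₀]; ring
      have h6 : σ₀ / 2 * t₀ ^ 2 ≤ σ / 2 * t₀ ^ 2 := by gcongr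
      linarith
    have h4 : σ * t₀ / 2 ≤ b + L * χ * R := by
      have h5 : a * ((b + L * χ * t) * t) = t₀ * (b + L * χ * t) := by rw [← hat]; ring
      have h6 : σ * t₀ / 2 ≤ b + L * χ * t := by
        refine le_of_mul_le_mul_left ?_ ht₀
        linarith
      have h7 : L * χ * t ≤ L * χ * R := mul_le_mul_of_nonneg_left hR (by positivity)
      linarith
    -- The second summand of the lower bound for `C₂` serves here: as `C₂ * χ < σ`, the nuisance
    -- term takes at most half of `σ * t₀ / 2`.
    have h5 : L * χ * R ≤ σ * t₀ / 4 := by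
      have h6 : 4 * L * R / t₀ * χ ≤ C₂ * χ := mul_le_mul_of_nonneg_right (by linarith) hχ
      have h7 : 4 * L * R / t₀ * χ ≤ σ := by linarith
      have h8 := mul_le_mul_of_nonneg_right h7 ht₀.le
      have h9 : 4 * L * R / t₀ * χ * t₀ = 4 * (L * χ * R) := by field_simp
      linarith
    -- Now `b` is at least `σ * t₀ / 4`, so the trivial bound `t ≤ R` is good enough.
    have h6 : σ * R ≤ 4 * R / t₀ * b := by
      have h7 : σ * t₀ ≤ 4 * b := by linarith
      have h8 := mul_le_mul_of_nonneg_right h7 (div_nonneg hR0 ht₀.le)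
      have h9 : σ * t₀ * (R / t₀) = σ * R := by field_simp
      have h10 : 4 * b * (R / t₀) = 4 * R / t₀ * b := by ring
      linarith
    have h7 : t * (σ - C₂ * χ) ≤ R * σ := by
      have h8 : 0 ≤ C₂ * χ := mul_nonneg (by linarith) hχ
      exact mul_le_mul hR (by linarith) hpos.le hR0
    nlinarith

end Inversion

end ORF

/-! ### The error bound -/

theorem theorem4p2 {d p l : ℕ} (hd : 0 < d)
    -- density of the features: continuous, bounded away from zero and infinity
    (f : ORF.Vec d → ℝ) (hf : ContinuousOn f (ORF.cube d))
    (fmin fmax : ℝ) (hfmin : 0 < fmin)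
    (hfb : ∀ y ∈ ORF.cube d, fmin ≤ f y ∧ f y ≤ fmax)
    -- constants of the assumptions and of the forest
    (L R ψmax σ₀ : ℝ) (hσ₀ : 0 < σ₀)
    (ρ π γ : ℝ) (hρ : 0 < ρ) (hρ' : ρ ≤ 0.2) (hπ : 0 < π) (hπ' : π ≤ 1) (hγ : 0 < γ)
    (r : ℕ) (hr : 1 ≤ r) :
    ∃ C₁ C₂ : ℝ, 0 < C₁ ∧ 0 < C₂ ∧
      ∀ (k : ℕ) (𝒵 : Type*) [MeasurableSpace 𝒵] (M : ORF.MomentModel d p l k 𝒵)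
        (x : ORF.Vec d) (_ : x ∈ ORF.cube d) (θ₀ : ORF.Vec p)
        (_ : M.Regular f L R σ₀ x θ₀)
        (_ : M.IsGradientOfConvexLoss)
        (σ : ℝ) (_ : IsLeast {c : ℝ | Module.End.HasEigenvalue
          (M.jacobian x θ₀ : ORF.Vec p →ₗ[ℝ] ORF.Vec p) c} σ)
        -- sample size, subsample size, size of the estimation part, number of trees
        (n s s₂ B : ℕ) (_ : 1 ≤ s) (_ : s < n) (_ : s₂ ≤ s) (_ : γ * s ≤ s₂)
        (_ : (n : ℝ) / s ≤ B)
        -- the tree learner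
        (Ωt : Type*) [MeasurableSpace Ωt] (ν : Measure Ωt) [IsProbabilityMeasure ν]
        (T : (Fin s → 𝒵) → Ωt → ORF.SplitTree d) (_ : ORF.IsForestLearner M ρ π r s s₂ ν T)
        -- the first-stage nuisance estimator, computed from the last `n` observations
        (Ωa : Type*) [MeasurableSpace Ωa] (α : Measure Ωa) [IsProbabilityMeasure α]
        (hhat : (Fin n → 𝒵) → Ωa → ORF.Vec d → ORF.Vec k → ORF.Vec l)
        (_ : Measurable fun q : ((Fin n → 𝒵) × Ωa) × ORF.Vec d × ORF.Vec k =>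
          hhat q.1.1 q.1.2 q.2.1 q.2.2)
        (_ : ∀ᵐ q ∂((Measure.pi fun _ : Fin n => M.law).prod α), hhat q.1 q.2 ∈ M.H ∧
          ∀ z, ∀ θ ∈ M.Θ, ∀ j, |M.plugIn θ (hhat q.1 q.2) z j| ≤ ψmax)
        -- the probability space and the random sample
        (Ω : Type*) [MeasurableSpace Ω] (P : Measure Ω) [IsProbabilityMeasure P]
        (D₁ D₂ : Ω → Fin n → 𝒵) (a : Ω → Ωa) (G : Ω → Fin B → (Fin s ↪ Fin n) × Ωt)
        (_ : HasLaw (fun ω => (D₁ ω, D₂ ω, a ω, G ω)) (ORF.sampleLaw M n s B α ν) P)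
        -- nuisance error at most `χ` with probability at least `1 - δ`
        (δ χ : ℝ) (_ : 0 < δ) (_ : δ < 1) (_ : 0 ≤ χ)
        (_ : P {ω | ¬ M.rmse x (hhat (D₂ ω) (a ω)) ≤ ENNReal.ofReal χ} ≤ ENNReal.ofReal δ)
        -- the estimate solves the weighted moment condition
        (θhat : Ω → ORF.Vec p)
        (_ : ∀ᵐ ω ∂P, θhat ω ∈ M.Θ ∧
          ORF.weightedScore M s₂ T x (D₁ ω) (G ω) (θhat ω) (hhat (D₂ ω) (a ω)) = 0),
        0 < σ - C₂ * χ →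
          P {ω | ¬ ‖θhat ω - θ₀‖ ≤
            C₁ * ((s : ℝ) ^ (-(1 / (2 * ORF.kernelAlpha ρ π * d)))
                + Real.sqrt (s * Real.log (n / (s * δ)) / n) + χ ^ 2)
              / (σ - C₂ * χ)} ≤ ENNReal.ofReal (2 * δ) := by
  -- With `L` or `R` negative there is no such setting: an eigenvalue forces `p > 0`, which gives `L
  -- ≥ 0`, and `R` bounds a norm. Any positive constants do.
  by_cases hLR : 0 ≤ L ∧ 0 ≤ R
  swap
  · refine ⟨1, 1, one_pos, one_pos, ?_⟩
    intro k 𝒵 _ M x hx θ₀ hM hconv σ hσ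
    refine absurd ⟨hM.lipschitz_nonneg (ORF.pos_of_hasEigenvalue hσ.1), ?_⟩ hLR
    simpa using hM.diam_le θ₀ hM.θ₀_mem θ₀ hM.θ₀_mem
  obtain ⟨hL, hR⟩ := hLR
  obtain ⟨C, hC, hconc⟩ := ORF.exists_uniform_concentration p hd hf hfmin hfb L R ψmax hL hR hρ hρ'
    hπ hπ' hγ hr
  -- The added ones, here and in `C₂`, keep the constants positive when `L = 0`.
  set K : ℝ := p * L + 1
  have hK : 0 < K := by positivity
  set C₂ : ℝ := 2 * L + 4 * L * R / (σ₀ / (2 * K)) + 1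
  set A : ℝ := 2 + 4 * R / (σ₀ / (2 * K))
  have hA : 0 < A := by positivity
  refine ⟨A * (C + K), C₂, by positivity, by positivity, ?_⟩
  intro k 𝒵 _ M x hx θ₀ hM hconv σ hσ n s s₂ B hs hsn hs₂ hγs hB Ωt _ ν _ T hT Ωa _ α _ hhat hhm
    hgood Ω _ P _ D₁ D₂ a G hlaw δ χ hδ hδ1 hχ hrmse θhat hθhat hpos
  -- For `δ ≥ 1 / 2` the asserted bound `2 * δ` on a probability is trivial.
  rcases le_total (1 / 2) δ with hδ2 | hδ2
  · refine prob_le_one.trans ?_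
    rw [ENNReal.one_le_ofReal]
    linarith
  have hdiff := hM.differentiableAt_moment hσ₀ hσ.1
  have hevent := hconc M x hx σ₀ θ₀ hM n s s₂ B hs hsn.le hs₂ hγs hB ν T hT α hhat hhm hgood
    P D₁ D₂ a G hlaw δ hδ hδ2
  set S : ℝ := (s : ℝ) ^ (-ORF.rateExp d ρ π) + √(s * Real.log (n / (s * δ)) / n)
  have hS : 0 ≤ S := by positivity
  set bad₁ := {ω | ¬ M.rmse x (hhat (D₂ ω) (a ω)) ≤ ENNReal.ofReal χ}
  set bad₂ := {ω | ¬ (hhat (D₂ ω) (a ω) ∈ M.H ∧ ∀ θ ∈ M.Θ,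
    ‖ORF.weightedScore M s₂ T x (D₁ ω) (G ω) θ (hhat (D₂ ω) (a ω)) -
      M.moment x θ (hhat (D₂ ω) (a ω))‖ ≤ C * S)}
  set bad₃ := {ω | ¬ (θhat ω ∈ M.Θ ∧
    ORF.weightedScore M s₂ T x (D₁ ω) (G ω) (θhat ω) (hhat (D₂ ω) (a ω)) = 0)}
  have hbad₃ : P bad₃ = 0 := hθhat
  calc _ ≤ P (bad₁ ∪ bad₂ ∪ bad₃) := by
        refine measure_mono fun ω hω => ?_
        by_contra hnot
        simp only [Set.mem_union, not_or, bad₁, bad₂, bad₃, Set.mem_ofPred_eq, not_not] at hnot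
        obtain ⟨⟨hr, hH, hdev⟩, hΘ, hzero⟩ := hnot
        refine hω ?_
        set h := hhat (D₂ ω) (a ω)
        have hdom := M.Θ_subset hΘ
        have h1 : ‖M.moment x (θhat ω) h‖ ≤ C * S := by
          have := hdev _ hΘ
          rwa [hzero, zero_sub, norm_neg] at this
        have h2 := hM.norm_moment_le_sq hL hx hH hχ hr
        have h3 := hM.norm_moment_mixed_le hL hx hdom hH hχ hr
        have h4 : ‖M.moment x (θhat ω) M.h₀‖ ≤ (C * S + K * χ ^ 2) + L * χ * ‖θhat ω - θ₀‖ := by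
          -- As the weighted score vanishes at the estimate, the moment at the estimated nuisance is
          -- a pure deviation. Passing to `M.h₀` costs the quadratic bias at `θ₀` and the mixed
          -- increment.
          have h5 : M.moment x (θhat ω) M.h₀ = M.moment x (θhat ω) h - M.moment x θ₀ h -
              (M.moment x (θhat ω) h - M.moment x (θhat ω) M.h₀ - M.moment x θ₀ h) := by abel
          have h6 : ‖M.moment x θ₀ h‖ ≤ K * χ ^ 2 := by
            refine h2.trans ?_
            simp only [K]
            nlinarith [sq_nonneg χ]
          rw [h5]
          refine (norm_sub_le _ _).trans (add_le_add ((norm_sub_le _ _).trans ?_) h3)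
          exact add_le_add h1 h6
        have hmain := ORF.norm_sub_le_of_monotone_expansion M.convex_domθ (K := K) (R := R)
          (F := fun θ => M.moment x θ M.h₀) (J := M.jacobian x θ₀) (M.Θ_subset hM.θ₀_mem) hdom
          (fun θ hθ θ' hθ' => hM.inner_moment_sub_nonneg hx hconv hθ hθ')
          (fun θ hθ => (hM.norm_moment_sub_jacobian_le hL hx hdiff hθ).trans (by
            simp only [K]
            nlinarith [sq_nonneg ‖θ - θ₀‖]))
          (hM.mul_norm_sq_le_inner_jacobian hL hx hdiff hconv fun c hc => hσ.2 hc)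
          hK hL hσ₀ (hM.curvature σ hσ.1) hχ (by positivity)
          (hM.diam_le _ hΘ _ hM.θ₀_mem) h4 (le_add_of_nonneg_right zero_le_one) hpos
        refine hmain.trans (div_le_div_of_nonneg_right ?_ hpos.le)
        change A * (C * S + K * χ ^ 2) ≤ A * (C + K) * (S + χ ^ 2)
        have h7 : 0 ≤ A * (K * S + C * χ ^ 2) := by positivity
        nlinarith
    _ ≤ P bad₁ + P bad₂ + P bad₃ :=
        (measure_union_le _ _).trans (add_le_add_left (measure_union_le _ _) _)
    _ ≤ ENNReal.ofReal δ + ENNReal.ofReal δ + 0 :=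
        add_le_add (add_le_add hrmse hevent) hbad₃.le
    _ = ENNReal.ofReal (2 * δ) := by
        rw [add_zero, ← ENNReal.ofReal_add hδ.le hδ.le, two_mul]
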